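/- **Setting.** Let $n\ge 1$, $I=[0,1]$, and let $m$ be Lebesgue measure on $I^n$. Let $\Omega$ be a Polish space with its Borel $\sigma$-algebra, $\mathbb P$ a Borel probability measure on $\Omega$, and $\sigma:\Omega\to\Omega$ an invertible, ergodic, $\mathbb P$-preserving transformation. A *rectangular partition* of $I^n$ is a finite partition into rectangles $B_j=\prod_i B_{ij}$ with $B_{ij}=[a_{ij},b_{ij})$ if $b_{ij}<1$ and $B_{ij}=[a_{ij},b_{ij}]$ if $b_{ij}=1$. It is a *grid* if its rectangles are all the products of intervals of fixed subdivisions $0=a_{i,0}<\dots<a_{i,r_i}=1$, $i=1,\dots,n$. Its *crossing points* are the vertices of its rectangles that lie in the interior of $I^n$. For each $\omega\in\Omega$ let $f_\omega:I^n\to I^n$ be a Jabłoński map with rectangular partition $\mathcal B^\omega$, i.e. $f_\omega(x)=(\varphi_{\omega,1,B}(x_1),\dots,\varphi_{\omega,n,B}(x_n))$ for $x\in B\in\mathcal B^\omega$, where $\varphi_{\omega,i,B}$ maps the closed $i$-th side of $B$ into $[0,1]$. Let $F(\omega,x)=(\sigma\omega,f_\omega(x))$ be the skew product, and put $$\gamma_i(\omega)=\inf_{B\in\mathcal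 B^\omega,\ x_i\in \overline{B_i}}|\varphi_{\omega,i,B}'(x_i)|,\qquad \gamma(\omega)=\prod_{i=1}^n\gamma_i(\omega).$$ Let $\mathcal L_\omega$ be the transfer operator of $f_\omega$ with respect to $m$, acting on the space $BV(I^n)$ of functions of bounded variation in the sense of Tonelli–Cesari, with norm $\|h\|_{BV}=\|h\|_1+\max_i \mathbb V_i h$, where $\mathbb V_i h$ is the infimum, over $g=h$ a.e. whose variation along lines parallel to the $i$-th axis is a measurable function of the remaining coordinates, of the integral of that variation over the remaining coordinates. Assume that $\{f_\omega\}$ is *admissible*: the $\mathcal B^\omega$ are grids that have a common grid $\mathcal B$ as refinement (for instance $\mathcal B^\omega=\mathcal B$ for all $\omega$); all $\varphi_{\omega,i,B}$ are $C^2$ and monotonic on the closed sides; $F$ and the $\gamma_i$ are measurable and every $f_\omega$ is nonsingular; $\gamma_i>0$ a.s., and $\min_i\log\gamma_i$ is $\mathbb P$-integrable with $\int_\Omega\min_i\log\gamma_i\,d\mathbb P>0$; every $\mathcal L_\omega$ is bounded on $BV(I^n)$, and $\omega\mapsto\mathcal L_\omega$ is $\mathbb P$-continuous, i.e. $\Omega$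 is a countable union of Borel sets on each of which $\omega\mapsto\mathcal L_\omega$ is continuous in operator norm. Assume also $\int_\Omega\log^+\|\mathcal L_\omega\|_{BV}\,d\mathbb P<\infty$. An *ergodic ACIP* is an $F$-invariant, ergodic probability measure on $\Omega\times I^n$ that is absolutely continuous with respect to $\mathbb P\times m$. Let $q_\omega$ be the number of rectangles of $\mathcal B^\omega$, let $c_t(\omega)$ be the number of crossing points of $\mathcal B^{\sigma\omega}$, and let $$M(\omega)=\max_{z\in\mathbb R}\ \max_{1\le d\le n}\#\{B\in\mathcal B^{\sigma\omega}:\ \{x_d=z\}\cap\operatorname{Int}B\ne\emptyset\}.$$ **Lemma.** Let $M,c,q\in\mathbb R$ be such that $M(\omega)\le M$, $c_t(\omega)\le c$ and $q_\omega\le q$ for $\mathbb P$-a.e. $\omega$. 1. If $\int_\Omega\log\gamma\,d\mathbb P>\log M$ and $\mu_1,\dots,\mu_r$ are pairwise mutually singular ergodic ACIPs, then $$r\le\frac{c\,(\log q-\log M)}{\int_\Omega\log\gamma\,d\mathbb P-\log M}.$$ 2. $\log\gamma$ is $\mathbb P$-integrable and $\int_\Omega\log\gamma\,d\mathbb P\le\log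 q$. 3. If $\int_\Omega\log\gamma\,d\mathbb P>\log M$ and $\dfrac{c\,(\log q-\log M)}{\int_\Omega\log\gamma\,d\mathbb P-\log M}<2$, then there exists exactly one ergodic ACIP. -/

import Mathlib

open MeasureTheory Set Filter Topology
open scoped ENNReal

namespace Jablonski

noncomputable section

/-- The phase space `I^n`, `I = [0,1]`; its `volume` is the `n`-dimensional Lebesgue measure `m`. -/
abbrev Cube (n : ℕ) : Type := Fin n → unitInterval

/-! ### Rectangular partitions -/

/-- The data of a nondegenerate rectangle in `I^n` with sides parallel to the axes. -/
@[ext] structure Rect (n : ℕ) where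
  lo : Fin n → ℝ
  hi : Fin n → ℝ
  lo_nonneg : ∀ i, 0 ≤ lo i
  lo_lt_hi : ∀ i, lo i < hi i
  hi_le_one : ∀ i, hi i ≤ 1

/-- The rectangle as a subset of the cube: the `i`-th side is `[lo i, hi i)` if `hi i < 1`,
and `[lo i, hi i]` if `hi i = 1`. -/
def Rect.toSet {n : ℕ} (B : Rect n) : Set (Cube n) :=
  {x | ∀ i, B.lo i ≤ (x i : ℝ) ∧ ((x i : ℝ) < B.hi i ∨ B.hi i = 1)}

/-- The interior of the rectangle, in `ℝ^n`. -/
def Rect.openBox {n : ℕ} (B : Rect n) : Set (Fin n → ℝ) :=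
  {x | ∀ i, x i ∈ Ioo (B.lo i) (B.hi i)}

/-- The vertices of the rectangle. -/
def Rect.vertices {n : ℕ} (B : Rect n) : Set (Fin n → ℝ) :=
  {v | ∀ i, v i = B.lo i ∨ v i = B.hi i}

/-- A (finite) rectangular partition of `I^n`. -/
structure RectPartition (n : ℕ) where
  parts : Finset (Rect n)
  partition : ∀ x : Cube n, ∃! B : Rect n, B ∈ parts ∧ x ∈ B.toSet

namespace RectPartition

variable {n : ℕ}

/-- The crossing points: vertices of rectangles that lie in the interior of `I^n`. -/
def crossingPoints (P : RectPartition n) : Set (Fin n → ℝ) :=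
  {v | (∃ B ∈ P.parts, v ∈ B.vertices) ∧ ∀ i, v i ∈ Ioo (0 : ℝ) 1}

/-- The number of rectangles whose interior meets the hyperplane `x_d = z`. -/
def hyperplaneCount (P : RectPartition n) (d : Fin n) (z : ℝ) : ℕ :=
  {B : Rect n | B ∈ P.parts ∧ ({x : Fin n → ℝ | x d = z} ∩ B.openBox).Nonempty}.ncard

/-- The maximum of `hyperplaneCount` over all directions `d` and all `z` (the values are bounded
by the number of rectangles, so the suprema are maxima). -/
def maxHyperplaneCount (P : RectPartition n) : ℕ :=
  ⨆ d : Fin n, ⨆ z : ℝ, P.hyperplaneCount d z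

/-- `P` is a grid: for every `i` there is a subdivision `0 = a i 0 < a i 1 < ⋯ < a i (r i) = 1` of
`[0,1]`, and the rectangles are all products of consecutive subdivision intervals. -/
def IsGrid (P : RectPartition n) : Prop :=
  ∃ (r : Fin n → ℕ) (a : Fin n → ℕ → ℝ),
    (∀ i, a i 0 = 0 ∧ a i (r i) = 1 ∧ ∀ k < r i, a i k < a i (k + 1)) ∧
    ∀ B : Rect n, B ∈ P.parts ↔
      ∃ s : Fin n → ℕ, ∀ i, s i < r i ∧ B.lo i = a i (s i) ∧ B.hi i = a i (s i + 1)

/-- `Q` refines `P`: every rectangle of `Q` lies in a rectangle of `P`. -/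
def Refines (Q P : RectPartition n) : Prop :=
  ∀ B ∈ Q.parts, ∃ C ∈ P.parts, B.toSet ⊆ C.toSet

end RectPartition

/-! ### Jabłoński maps -/

/-- A Jabłoński map of `I^n`, with its rectangular partition and its components
`comp B i : [lo i, hi i] → [0,1]` (values of `comp` elsewhere are irrelevant). -/
structure JablonskiMap (n : ℕ) where
  part : RectPartition n
  comp : Rect n → Fin n → ℝ → ℝ
  comp_mapsTo : ∀ B ∈ part.parts, ∀ i,
    MapsTo (comp B i) (Icc (B.lo i) (B.hi i)) (Icc (0 : ℝ) 1)
  toFun : Cube n → Cube n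
  toFun_eq : ∀ B ∈ part.parts, ∀ x ∈ B.toSet, ∀ i, (toFun x i : ℝ) = comp B i (x i)

/-- All components are `C²` and monotonic on the closed sides of the rectangles. -/
def JablonskiMap.IsC2Monotone {n : ℕ} (f : JablonskiMap n) : Prop :=
  ∀ B ∈ f.part.parts, ∀ i,
    ContDiffOn ℝ 2 (f.comp B i) (Icc (B.lo i) (B.hi i)) ∧
    (MonotoneOn (f.comp B i) (Icc (B.lo i) (B.hi i)) ∨
      AntitoneOn (f.comp B i) (Icc (B.lo i) (B.hi i)))

/-- `γ_i`: the infimum of `|φ_i'|` over all rectangles and over their closed `i`-th sides. -/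
def JablonskiMap.expansion {n : ℕ} (f : JablonskiMap n) (i : Fin n) : ℝ :=
  ⨅ p : {p : Rect n × ℝ // p.1 ∈ f.part.parts ∧ p.2 ∈ Icc (p.1.lo i) (p.1.hi i)},
    |derivWithin (f.comp p.1.1 i) (Icc (p.1.1.lo i) (p.1.1.hi i)) p.1.2|

/-- `γ = γ_1 ⋯ γ_n`. -/
def JablonskiMap.totalExpansion {n : ℕ} (f : JablonskiMap n) : ℝ :=
  ∏ i, f.expansion i

/-! ### Functions of bounded variation in the sense of Tonelli and Cesari -/

/-- The variation of `g` along the line through `x` in direction `i`; it does not depend on the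
coordinate `x i`, so it is a function of the other `n - 1` coordinates. -/
def lineVariation {n : ℕ} (i : Fin n) (g : Cube n → ℝ) (x : Cube n) : ℝ≥0∞ :=
  eVariationOn (fun t : unitInterval => g (Function.update x i t)) univ

/-- The variation of the a.e.-class of `f` in direction `i`. The `(n-1)`-dimensional integral over
the other coordinates is written as an integral over `I^n`, the integrand being independent of
`x i` and `I` having measure `1`. -/
def dirVariation {n : ℕ} (i : Fin n) (f : Cube n → ℝ) : ℝ≥0∞ :=
  ⨅ (g : Cube n → ℝ) (_ : g =ᵐ[volume] f) (_ : AEMeasurable (lineVariation i g) volume),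
    ∫⁻ x, lineVariation i g x

/-- The total variation. -/
def totalVariation {n : ℕ} (f : Cube n → ℝ) : ℝ≥0∞ := ⨆ i : Fin n, dirVariation i f

/-- The norm `‖f‖₁ + V f`; it is `∞` for integrable `f` that are not of bounded variation. -/
def bvNorm {n : ℕ} (f : Cube n → ℝ) : ℝ≥0∞ := (∫⁻ x, ‖f x‖ₑ) + totalVariation f

/-- The operator norm on `BV(I^n)` of a map `T` acting on functions; `∞` if `T` is not bounded. -/
def bvOpNorm {n : ℕ} (T : (Cube n → ℝ) → (Cube n → ℝ)) : ℝ≥0∞ :=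
  ⨆ (h : Cube n → ℝ) (_ : Integrable h volume) (_ : bvNorm h ≤ 1), bvNorm (T h)

/-- The transfer (Perron–Frobenius) operator of a nonsingular map `f`: for integrable `h`, the
density with respect to `m` of the image under `f` of the signed measure with density `h`. -/
def transfer {n : ℕ} (f : Cube n → Cube n) (h : Cube n → ℝ) : Cube n → ℝ := fun x =>
  ((((volume : Measure (Cube n)).withDensity fun y => ENNReal.ofReal (h y)).map f).rnDeriv
      volume x).toReal -
  ((((volume : Measure (Cube n)).withDensity fun y => ENNReal.ofReal (-h y)).map f).rnDeriv
      volume x).toReal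

/-! ### Random Jabłoński maps -/

section Random

variable {Ω : Type*} {n : ℕ}

/-- The norm on `BV(I^n)` of the transfer operator `𝓛_ω`. -/
def generatorNorm (f : Ω → JablonskiMap n) (ω : Ω) : ℝ≥0∞ :=
  bvOpNorm (transfer (f ω).toFun)

/-- The operator norm distance between `𝓛_ω` and `𝓛_ω'` on `BV(I^n)`. -/
def generatorDist (f : Ω → JablonskiMap n) (ω ω' : Ω) : ℝ≥0∞ :=
  bvOpNorm fun h => transfer (f ω).toFun h - transfer (f ω').toFun h

/-- `ℙ`-continuity of `ω ↦ 𝓛_ω`: `Ω` is a countable union of Borel sets on each of which the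
generator is continuous for the operator norm of `BV(I^n)`. -/
def PContinuous [TopologicalSpace Ω] [MeasurableSpace Ω] (f : Ω → JablonskiMap n) : Prop :=
  ∃ U : ℕ → Set Ω, (∀ k, MeasurableSet (U k)) ∧ (⋃ k, U k) = univ ∧
    ∀ k, ∀ ω ∈ U k, Tendsto (fun ω' => generatorDist f ω' ω) (𝓝[U k] ω) (𝓝 0)

/-- The skew product `F(ω, x) = (σ ω, f_ω x)`. -/
def skewProduct (σ : Ω → Ω) (f : Ω → JablonskiMap n) : Ω × Cube n → Ω × Cube n :=
  fun p => (σ p.1, (f p.1).toFun p.2)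

/-- Admissible random Jabłoński maps. The partitions `𝓑^ω` are grids having a common grid as a
refinement; when they all coincide, they are that common grid. -/
structure Admissible [TopologicalSpace Ω] [MeasurableSpace Ω] (P : Measure Ω) (σ : Ω → Ω)
    (f : Ω → JablonskiMap n) : Prop where
  grid : ∀ ω, (f ω).part.IsGrid
  common_grid : ∃ Q : RectPartition n, Q.IsGrid ∧ ∀ ω, Q.Refines (f ω).part
  smooth : ∀ ω, (f ω).IsC2Monotone
  measurable_skewProduct : Measurable (skewProduct σ f)
  nonsingular : ∀ ω, Measure.QuasiMeasurePreserving (f ω).toFun volume volume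
  /- `log γ_i` is a real-valued measurable function (`Real.log 0 = 0` has to be excluded), and
  `min_i log γ_i` has a finite integral, which exceeds a positive constant. -/
  aemeasurable_expansion : ∀ i, AEMeasurable (fun ω => (f ω).expansion i) P
  expansion_pos : ∀ᵐ ω ∂P, ∀ i, 0 < (f ω).expansion i
  integrable_min_log : Integrable (fun ω => ⨅ i, Real.log ((f ω).expansion i)) P
  expanding_on_average : ∃ g : ℝ, 0 < g ∧ g < ∫ ω, ⨅ i, Real.log ((f ω).expansion i) ∂P
  /- The generator is a `ℙ`-continuous family of bounded operators on `BV(I^n)`. -/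
  bounded_generator : ∀ ω, generatorNorm f ω < ∞
  pContinuous : PContinuous f

/-- `∫ log⁺ ‖𝓛_ω‖_BV dℙ(ω) < ∞`. -/
def LogIntegrable [MeasurableSpace Ω] (P : Measure Ω) (f : Ω → JablonskiMap n) : Prop :=
  ∫⁻ ω, ENNReal.ofReal (Real.posLog (generatorNorm f ω).toReal) ∂P < ∞

/-- `μ` is an ergodic ACIP of the skew product: an ergodic invariant probability measure that is
absolutely continuous with respect to `ℙ × m`. -/
def IsErgodicACIP [MeasurableSpace Ω] (P : Measure Ω) (σ : Ω → Ω) (f : Ω → JablonskiMap n)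
    (μ : Measure (Ω × Cube n)) : Prop :=
  IsProbabilityMeasure μ ∧ Ergodic (skewProduct σ f) μ ∧ μ ≪ P.prod volume

/-- `q_ω`: the number of rectangles of `𝓑^ω`. -/
def numRects (f : Ω → JablonskiMap n) (ω : Ω) : ℕ := (f ω).part.parts.card

/-- `M(ω)`: the maximal number of rectangles of `𝓑^{σω}` whose interiors meet one hyperplane
`x_d = z`. -/
def complexity (σ : Ω → Ω) (f : Ω → JablonskiMap n) (ω : Ω) : ℕ :=
  (f (σ ω)).part.maxHyperplaneCount

/-- `c_t(ω)`: the number of crossing points of `𝓑^{σω}`. -/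
def numCrossing (σ : Ω → Ω) (f : Ω → JablonskiMap n) (ω : Ω) : ℕ :=
  (f (σ ω)).part.crossingPoints.ncard

end Random

end

end Jablonski

/-! The bound on the number of measures is a volume argument. Mutually singular ergodic ACIPs live
on disjoint invariant sets `A i` of positive `P × m`-measure. Suppose that over one `ω` each fibre
of `A i` contains, up to a null set, a box lying in one rectangle of the partition. The image of
that box under `f_ω` contains a box whose volume is larger by the factor `γ(ω)`. The partition at
`σω` cuts the new box into pieces, and the largest piece keeps at least the fraction `1/k` of the
volume, where `k` is the number of rectangles met. Always `k ≤ q`. In a grid, a box containing no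
crossing point is uncut in some direction, so all the rectangles it meets also meet one hyperplane
and `k ≤ M`. The boxes of different `A i` are disjoint, so at most `c` of the `r` boxes contain a
crossing point. The sum of the logarithms of the volumes therefore grows in each step by at least `r
(log γ - log M) - c (log q - log M)`. That sum is never positive, whereas Birkhoff sums of a
function with positive mean are almost surely unbounded above; so the mean is at most `0`, which is
the bound (`Inside.grow`, `Expanding.card_mul_le`).

The analytic work is to find the first boxes: over a set of `ω` of positive measure, every invariant
set of positive measure must contain an open cube of a fixed mesh (`Expanding.exists_openBox`). For
this a Lasota–Yorke inequality is proved on a class of measures adapted to product maps: finite sums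
of products of one-dimensional measures with densities of bounded variation, measured by a number
`z` that bounds the summed variations in each direction (`Fam`). A piecewise product map preserves
this class. Cutting and pushing along a block of length `N` replaces `z` by `3 Λ z + const`, where
`Λ` is the product of the bounds for `1/|φ'|`. The constant depends on Lipschitz constants and
cylinder volumes that need not be integrable in `ω`. It is used only where it is bounded. Elsewhere
a cruder one-step bound is used, whose logarithm is integrable: it involves only the variation of
`1/|φ'|`, and that is dominated by the norm of the transfer operator on `BV`, as one sees by
applying the operator to indicators of rectangles. The result is an inequality `z ↦ exp (u ω) z + K`
with `∫ u < 0` (`Expanding.exists_block`).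

Reading the products backwards from the arrival point and using a maximal ergodic lemma gives a set
`S` of arrival points over which the initial variation is forgotten uniformly (`Expanding.tight`).
Far in the past, start with the uniform distribution on a small cube nearly filled by the invariant
set. Its image over `S` has bounded `z` and almost no mass outside the set. Such a measure has a
summand with density bounded below on a cube of fixed mesh, so that cube is nearly filled as well.
Finitely many cubes are available, and a limit gives a completely filled one.

The same estimate makes the images of `P × m` uniformly absolutely continuous, so Cesàro averages
have an absolutely continuous invariant limit (`Expanding.exists_acip`). If the bound is below `2`,
no invariant set and its complement can both have positive measure. Every ACIP is then ergodic, and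
two of them coincide with their average.

Integrability of `log γ` holds because it lies between `n · min_i log γ_i` and `log q`. The upper
bound comes from summing `γ · vol B ≤ 1` over the rectangles `B`. -/

namespace Jablonski

noncomputable section

/-! ### Densities on `[0,1]` of bounded variation -/

/-- `G` is a monotone function whose increments dominate those of `ρ`. -/
def Majorant (ρ G : ℝ → ℝ) : Prop := Monotone G ∧ ∀ s t, s ≤ t → |ρ t - ρ s| ≤ G t - G s

/-- The variation of `ρ` on the real line is at most `v`. -/
def VarLE (ρ : ℝ → ℝ) (v : ℝ) : Prop := ∃ G, Majorant ρ G ∧ ∀ s t, G t - G s ≤ v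

/-- `ρ` is a nonnegative measurable function that vanishes outside `[0,1]`. -/
structure IsDensity (ρ : ℝ → ℝ) : Prop where
  nonneg : ∀ t, 0 ≤ ρ t
  meas : Measurable ρ
  supp : ∀ t, t ∉ Icc (0 : ℝ) 1 → ρ t = 0

/-- The measure with density `ρ`. -/
def den (ρ : ℝ → ℝ) : Measure ℝ := volume.withDensity fun t => ENNReal.ofReal (ρ t)

/-- `ν` has a density on `[0,1]` of variation at most `v`. -/
def HasVar (ν : Measure ℝ) (v : ℝ) : Prop := ∃ ρ, IsDensity ρ ∧ VarLE ρ v ∧ ν = den ρ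

lemma VarLE.nonneg {ρ : ℝ → ℝ} {v : ℝ} (h : VarLE ρ v) : 0 ≤ v := by
  obtain ⟨G, -, h⟩ := h
  simpa using h 0 0

lemma VarLE.mono {ρ : ℝ → ℝ} {v v' : ℝ} (h : VarLE ρ v) (hv : v ≤ v') : VarLE ρ v' := by
  obtain ⟨G, h1, h2⟩ := h
  exact ⟨G, h1, fun s t => (h2 s t).trans hv⟩

lemma IsDensity.le_of_varLE {ρ : ℝ → ℝ} (hρ : IsDensity ρ) {v : ℝ} (h : VarLE ρ v) (t : ℝ) :
    ρ t ≤ v := by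
  obtain ⟨G, ⟨hm, hG⟩, hv⟩ := h
  by_cases ht : t ∈ Icc (0 : ℝ) 1
  · have h1 := hG (-1) t (by linarith [ht.1])
    rw [hρ.supp (-1) (by simp), sub_zero] at h1
    exact (le_abs_self _).trans (h1.trans (hv _ _))
  · rw [hρ.supp t ht]
    simpa using hv 0 0

lemma IsDensity.integrable {ρ : ℝ → ℝ} (hρ : IsDensity ρ) {v : ℝ} (h : VarLE ρ v) :
    Integrable ρ := by
  have : ρ = (Icc (0 : ℝ) 1).indicator ρ := by
    ext t
    by_cases ht : t ∈ Icc (0 : ℝ) 1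
    · simp [ht]
    · rw [indicator_of_notMem ht, hρ.supp t ht]
  rw [this, integrable_indicator_iff measurableSet_Icc]
  refine Measure.integrableOn_of_bounded (M := v) (by simp) hρ.meas.aestronglyMeasurable ?_
  filter_upwards with t
  rw [Real.norm_of_nonneg (hρ.nonneg t)]
  exact hρ.le_of_varLE h t

lemma den_apply_toReal {ρ : ℝ → ℝ} (hρ : IsDensity ρ) (hi : Integrable ρ) {s : Set ℝ}
    (hs : MeasurableSet s) : (den ρ).real s = ∫ t in s, ρ t := by
  rw [Measure.real, den, withDensity_apply _ hs,
    ← ofReal_integral_eq_lintegral_ofReal hi.restrict (ae_of_all _ hρ.nonneg),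
    ENNReal.toReal_ofReal (integral_nonneg hρ.nonneg)]

lemma den_real_univ {ρ : ℝ → ℝ} (hρ : IsDensity ρ) (hi : Integrable ρ) :
    (den ρ).real univ = ∫ t, ρ t := by
  rw [den_apply_toReal hρ hi MeasurableSet.univ, Measure.restrict_univ]

lemma isFiniteMeasure_den {ρ : ℝ → ℝ} (hi : Integrable ρ) :
    IsFiniteMeasure (den ρ) := isFiniteMeasure_withDensity_ofReal hi.2

lemma HasVar.isFiniteMeasure {ν : Measure ℝ} {v : ℝ} (h : HasVar ν v) : IsFiniteMeasure ν := by
  obtain ⟨ρ, h1, h2, rfl⟩ := h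
  exact isFiniteMeasure_den (h1.integrable h2)

lemma HasVar.mono {ν : Measure ℝ} {v v' : ℝ} (h : HasVar ν v) (hv : v ≤ v') : HasVar ν v' := by
  obtain ⟨ρ, h1, h2, rfl⟩ := h
  exact ⟨ρ, h1, h2.mono hv, rfl⟩

lemma IsDensity.integral_le {ρ : ℝ → ℝ} (hρ : IsDensity ρ) {v : ℝ} (h : VarLE ρ v) :
    ∫ t, ρ t ≤ v := by
  have h1 : ∫ t, ρ t = ∫ t in Icc (0 : ℝ) 1, ρ t := by
    rw [setIntegral_eq_integral_of_forall_compl_eq_zero hρ.supp]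
  rw [h1]
  have h2 : ∫ t in Icc (0 : ℝ) 1, ρ t ≤ ∫ t in Icc (0 : ℝ) 1, v :=
    integral_mono (hρ.integrable h).restrict (integrable_const _) (hρ.le_of_varLE h)
  simpa using h2

lemma HasVar.real_univ_le {ν : Measure ℝ} {v : ℝ} (h : HasVar ν v) : ν.real univ ≤ v := by
  obtain ⟨ρ, h1, h2, rfl⟩ := h
  rw [den_real_univ h1 (h1.integrable h2)]
  exact h1.integral_le h2

lemma den_restrict {ρ : ℝ → ℝ} {J : Set ℝ} (hJ : MeasurableSet J) :
    (den ρ).restrict J = den (J.indicator ρ) := by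
  rw [den, restrict_withDensity hJ, ← withDensity_indicator hJ, den]
  congr 1
  ext t
  by_cases ht : t ∈ J <;> simp [ht]

lemma IsDensity.indicator {ρ : ℝ → ℝ} (hρ : IsDensity ρ) {J : Set ℝ} (hJ : MeasurableSet J) :
    IsDensity (J.indicator ρ) where
  nonneg t := indicator_nonneg (fun t _ => hρ.nonneg t) t
  meas := hρ.meas.indicator hJ
  supp t ht := by
    by_cases h : t ∈ J
    · rw [indicator_of_mem h, hρ.supp t ht]
    · rw [indicator_of_notMem h]

/-- Cutting a density along an order-connected set. -/
lemma Majorant.varLE_indicator {ρ G : ℝ → ℝ} (hρ : IsDensity ρ) (hi : Integrable ρ)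
    (hG : Majorant ρ G)
    {J : Set ℝ} (hJm : MeasurableSet J) (hJc : J.OrdConnected) (hJfin : volume J ≠ ∞) {l o : ℝ}
    (hl : 0 < l) (hJl : ENNReal.ofReal l ≤ volume J) (ho : ∀ s ∈ J, ∀ t ∈ J, G t - G s ≤ o) :
    VarLE (J.indicator ρ) (3 * o + 2 / l * ∫ t in J, ρ t) := by
  have hne : J.Nonempty := by
    rw [nonempty_iff_ne_empty]
    rintro rfl
    simp at hJl
    linarith
  obtain ⟨j, hj⟩ := hne
  have ho0 : 0 ≤ o := by simpa using ho j hj j hj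
  have hI0 : 0 ≤ ∫ t in J, ρ t := integral_nonneg hρ.nonneg
  set S : ℝ := o + 1 / l * ∫ t in J, ρ t with hS
  have hS0 : 0 ≤ S := by positivity
  have hsup : ∀ t ∈ J, ρ t ≤ S := by
    intro t ht
    by_cases hto : ρ t ≤ o
    · have : 0 ≤ 1 / l * ∫ t in J, ρ t := by positivity
      linarith
    · push Not at hto
      have h1 : ∀ s ∈ J, ρ t - o ≤ ρ s := by
        intro s hs
        rcases le_total s t with h | h
        · linarith [le_abs_self (ρ t - ρ s), hG.2 s t h, ho s hs t ht]
        · linarith [neg_abs_le (ρ s - ρ t), hG.2 t s h, ho t ht s hs]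
      have h2 : ∫ s in J, (ρ t - o) ≤ ∫ s in J, ρ s :=
        setIntegral_mono_on (integrableOn_const hJfin) hi.integrableOn hJm h1
      rw [setIntegral_const, smul_eq_mul] at h2
      have h3 : l ≤ volume.real J := by
        rw [Measure.real]
        exact (ENNReal.ofReal_le_iff_le_toReal hJfin).1 hJl
      have h4 : (ρ t - o) * l ≤ ∫ s in J, ρ s := by nlinarith
      rw [hS]
      have : ρ t - o ≤ 1 / l * ∫ s in J, ρ s := by
        rw [one_div, inv_mul_eq_div, le_div_iff₀ hl]
        exact h4
      linarith
  have hbdd : BddBelow (G '' J) := ⟨G j - o, by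
    rintro _ ⟨s, hs, rfl⟩
    linarith [ho s hs j hj]⟩
  set I : ℝ := sInf (G '' J) with hI
  have hI1 : ∀ t ∈ J, I ≤ G t := fun t ht => csInf_le hbdd ⟨t, ht, rfl⟩
  have hI2 : ∀ t ∈ J, G t - I ≤ o := by
    intro t ht
    have : G t - o ≤ I := by
      refine le_csInf ⟨_, j, hj, rfl⟩ ?_
      rintro _ ⟨s, hs, rfl⟩
      linarith [ho s hs t ht]
    linarith
  classical
  -- The majorant of the cut density jumps by `S` on entering `J`, follows `G` on `J`, and reaches
  -- `2 * S + o` on leaving. The two values `S` and the inner oscillation give the factor `3` in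
  -- front of `o`.
  set K : ℝ → ℝ := fun t => if t ∈ J then S + (G t - I) else if ∃ s ∈ J, t < s then 0
    else 2 * S + o with hK
  have Kin : ∀ t ∈ J, K t = S + (G t - I) := fun t ht => by simp [hK, ht]
  have Kbel : ∀ t, t ∉ J → (∃ s ∈ J, t < s) → K t = 0 := fun t ht h => by
    simp only [hK, if_neg ht, if_pos h]
  have Kab : ∀ t, t ∉ J → (¬ ∃ s ∈ J, t < s) → K t = 2 * S + o := fun t ht h => by
    simp only [hK, if_neg ht, if_neg h]
  have key : ∀ s t, s ≤ t → |J.indicator ρ t - J.indicator ρ s| ≤ K t - K s := by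
    intro s t hst
    by_cases hs : s ∈ J <;> by_cases ht : t ∈ J
    · rw [indicator_of_mem hs, indicator_of_mem ht, Kin s hs, Kin t ht]
      linarith [hG.2 s t hst]
    · have : ¬ ∃ r ∈ J, t < r := by
        rintro ⟨r, hr, htr⟩
        exact ht (hJc.out hs hr ⟨hst, htr.le⟩)
      rw [indicator_of_mem hs, indicator_of_notMem ht, Kin s hs, Kab t ht this, zero_sub, abs_neg,
        abs_of_nonneg (hρ.nonneg s)]
      linarith [hsup s hs, hI2 s hs]
    · have : s < t := lt_of_le_of_ne hst (by rintro rfl; exact hs ht)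
      rw [indicator_of_notMem hs, indicator_of_mem ht, Kin t ht, Kbel s hs ⟨t, ht, this⟩,
        sub_zero, abs_of_nonneg (hρ.nonneg t)]
      linarith [hsup t ht, hI1 t ht]
    · rw [indicator_of_notMem hs, indicator_of_notMem ht, sub_zero, abs_zero]
      by_cases h1 : ∃ r ∈ J, s < r <;> by_cases h2 : ∃ r ∈ J, t < r
      · rw [Kbel s hs h1, Kbel t ht h2, sub_zero]
      · rw [Kbel s hs h1, Kab t ht h2]; linarith
      · exact absurd (h2.imp fun r hr => ⟨hr.1, hst.trans_lt hr.2⟩) h1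
      · rw [Kab s hs h1, Kab t ht h2, sub_self]
  have Knn : ∀ t, 0 ≤ K t ∧ K t ≤ 2 * S + o := by
    intro t
    by_cases ht : t ∈ J
    · rw [Kin t ht]
      constructor <;> linarith [hI1 t ht, hI2 t ht]
    · by_cases h : ∃ r ∈ J, t < r
      · rw [Kbel t ht h]
        constructor <;> linarith
      · rw [Kab t ht h]
        constructor <;> linarith
  refine ⟨K, ⟨fun s t hst => ?_, key⟩, fun s t => ?_⟩
  · have := (abs_nonneg _).trans (key s t hst)
    linarith
  · have h1 := Knn s
    have h2 := Knn t
    have : 2 * S + o = 3 * o + 2 / l * ∫ t in J, ρ t := by rw [hS]; ring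
    linarith

/-- The increment over `[s, t]` is split at the infimum `m` of `ρ` there: `(ρ t - m) g t + m (g t -
g s) - (ρ s - m) g s`. The outer terms together cost `Λ` times the increment of `G`, because one
descends from `s` to a near-minimum and ascends from it to `t`. The middle term costs `H m (t - s)`,
at most `H` times the integral of `ρ`. The coefficient of `v` is thus exactly `Λ`, so iteration
multiplies only the expansion bounds, and the Lipschitz constants fall on the conserved mass. -/
lemma VarLE.mul_lipschitz {ρ g : ℝ → ℝ} {v Λ H : ℝ} (hρ : IsDensity ρ) (h : VarLE ρ v)
    (hg0 : ∀ t, 0 ≤ g t) (hgΛ : ∀ t, g t ≤ Λ) (hH : 0 ≤ H)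
    (hgH : ∀ s t, |g t - g s| ≤ H * |t - s|) :
    VarLE (fun t => ρ t * g t) (Λ * v + H * ∫ t, ρ t) := by
  have hi := hρ.integrable h
  obtain ⟨G, ⟨hm, hG⟩, hv⟩ := h
  have hΛ : 0 ≤ Λ := (hg0 0).trans (hgΛ 0)
  have hint : ∀ s t, s ≤ t →
      (∫ r in Iic t, ρ r) - (∫ r in Iic s, ρ r) = ∫ r in Ioc s t, ρ r := by
    intro s t hst
    rw [sub_eq_iff_eq_add', ← setIntegral_union (Iic_disjoint_Ioc le_rfl) measurableSet_Ioc
      hi.integrableOn hi.integrableOn, Iic_union_Ioc_eq_Iic hst]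
  set K : ℝ → ℝ := fun t => Λ * G t + H * ∫ r in Iic t, ρ r with hK
  have key : ∀ s t, s ≤ t → |ρ t * g t - ρ s * g s| ≤ K t - K s := by
    intro s t hst
    have h1 : K t - K s = Λ * (G t - G s) + H * ∫ r in Ioc s t, ρ r := by
      rw [← hint s t hst, hK]; ring
    rw [h1]
    refine le_of_forall_pos_le_add fun ε hε => ?_
    -- a point where `ρ` nearly attains its infimum on `[s, t]`
    have hne : (ρ '' Icc s t).Nonempty := ⟨_, s, ⟨le_rfl, hst⟩, rfl⟩
    have hbb : BddBelow (ρ '' Icc s t) := ⟨0, by rintro _ ⟨r, -, rfl⟩; exact hρ.nonneg r⟩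
    set m := sInf (ρ '' Icc s t) with hmdef
    have hm0 : 0 ≤ m := le_csInf hne (by rintro _ ⟨r, -, rfl⟩; exact hρ.nonneg r)
    have hmle : ∀ r ∈ Icc s t, m ≤ ρ r := fun r hr => csInf_le hbb ⟨r, hr, rfl⟩
    obtain ⟨_, ⟨r, hr, rfl⟩, hrm⟩ := exists_lt_of_csInf_lt hne
      (show m < m + ε / (2 * (Λ + 1)) by have : 0 < ε / (2 * (Λ + 1)) := by positivity
                                         linarith)
    have hmI : m * (t - s) ≤ ∫ r in Ioc s t, ρ r := by
      have h2 : ∫ r in Ioc s t, m ≤ ∫ r in Ioc s t, ρ r :=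
        setIntegral_mono_on (integrableOn_const (by simp)) hi.integrableOn measurableSet_Ioc
          fun r hr => hmle r ⟨hr.1.le, hr.2⟩
      rw [setIntegral_const, smul_eq_mul, Measure.real, Real.volume_Ioc,
        ENNReal.toReal_ofReal (by linarith)] at h2
      linarith
    have e1 := hG s r hr.1
    have e2 := hG r t hr.2
    have e3 := hmle s ⟨le_rfl, hst⟩
    have e4 := hmle t ⟨hst, le_rfl⟩
    have e5 : ρ s - m ≤ G r - G s + ε / (2 * (Λ + 1)) := by
      linarith [neg_abs_le (ρ r - ρ s)]
    have e6 : ρ t - m ≤ G t - G r + ε / (2 * (Λ + 1)) := by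
      linarith [le_abs_self (ρ t - ρ r)]
    have e7 : ρ t * g t - ρ s * g s = (ρ t - m) * g t + m * (g t - g s) - (ρ s - m) * g s := by
      ring
    have e8 : |(ρ t - m) * g t| ≤ (ρ t - m) * Λ := by
      rw [abs_mul, abs_of_nonneg (by linarith : 0 ≤ ρ t - m), abs_of_nonneg (hg0 t)]
      exact mul_le_mul_of_nonneg_left (hgΛ t) (by linarith)
    have e9 : |(ρ s - m) * g s| ≤ (ρ s - m) * Λ := by
      rw [abs_mul, abs_of_nonneg (by linarith : 0 ≤ ρ s - m), abs_of_nonneg (hg0 s)]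
      exact mul_le_mul_of_nonneg_left (hgΛ s) (by linarith)
    have e10 : |m * (g t - g s)| ≤ H * ∫ r in Ioc s t, ρ r := by
      rw [abs_mul, abs_of_nonneg hm0]
      calc m * |g t - g s| ≤ m * (H * |t - s|) := mul_le_mul_of_nonneg_left (hgH s t) hm0
        _ = H * (m * (t - s)) := by rw [abs_of_nonneg (by linarith : 0 ≤ t - s)]; ring
        _ ≤ _ := mul_le_mul_of_nonneg_left hmI hH
    have e11 : (ρ t - m) * Λ + (ρ s - m) * Λ ≤ Λ * (G t - G s) + ε := by
      have : (ρ t - m) + (ρ s - m) ≤ G t - G s + ε / (Λ + 1) := by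
        have : ε / (Λ + 1) = ε / (2 * (Λ + 1)) + ε / (2 * (Λ + 1)) := by field_simp; ring
        linarith
      have h3 : Λ * (ε / (Λ + 1)) ≤ ε := by
        rw [mul_div_assoc', div_le_iff₀ (by linarith)]
        nlinarith
      nlinarith [mul_le_mul_of_nonneg_left this hΛ]
    rw [e7]
    calc |(ρ t - m) * g t + m * (g t - g s) - (ρ s - m) * g s|
        ≤ |(ρ t - m) * g t + m * (g t - g s)| + |(ρ s - m) * g s| := abs_sub _ _
      _ ≤ |(ρ t - m) * g t| + |m * (g t - g s)| + |(ρ s - m) * g s| := by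
          gcongr; exact abs_add_le _ _
      _ ≤ _ := by linarith
  refine ⟨K, ⟨fun s t hst => ?_, key⟩, fun s t => ?_⟩
  · have := (abs_nonneg _).trans (key s t hst)
    linarith
  · have h2 : (∫ r in Iic t, ρ r) ≤ ∫ r, ρ r :=
      setIntegral_le_integral hi (ae_of_all _ hρ.nonneg)
    have h3 : 0 ≤ ∫ r in Iic s, ρ r := integral_nonneg hρ.nonneg
    have h4 : K t - K s = Λ * (G t - G s) + H * ((∫ r in Iic t, ρ r) - ∫ r in Iic s, ρ r) := by
      rw [hK]; ring
    rw [h4]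
    gcongr
    · exact hv s t
    · linarith

/-- The ordinary product rule, with `ρ ≤ v`. It loses the factor `Λ` of the Lipschitz version but
needs only the variation of `g`, which is the quantity that the norm of the transfer operator
controls. -/
lemma VarLE.mul_varLE {ρ g : ℝ → ℝ} {v Λ D : ℝ} (hρ : IsDensity ρ) (h : VarLE ρ v)
    (hg0 : ∀ t, 0 ≤ g t) (hgΛ : ∀ t, g t ≤ Λ) (hgD : VarLE g D) :
    VarLE (fun t => ρ t * g t) ((Λ + D) * v) := by
  have hle := hρ.le_of_varLE h
  have hv0 := h.nonneg
  obtain ⟨G, ⟨hm, hG⟩, hv⟩ := h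
  obtain ⟨E, ⟨hEm, hE⟩, hD⟩ := hgD
  have hΛ : 0 ≤ Λ := (hg0 0).trans (hgΛ 0)
  refine ⟨fun t => Λ * G t + v * E t, ⟨fun s t hst => ?_, fun s t hst => ?_⟩, fun s t => ?_⟩
  · have h1 := hm hst
    have h2 := hEm hst
    dsimp only
    gcongr
  · have h1 : ρ t * g t - ρ s * g s = g t * (ρ t - ρ s) + ρ s * (g t - g s) := by ring
    rw [h1]
    calc |g t * (ρ t - ρ s) + ρ s * (g t - g s)| ≤ |g t * (ρ t - ρ s)| + |ρ s * (g t - g s)| :=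
          abs_add_le _ _
      _ = g t * |ρ t - ρ s| + ρ s * |g t - g s| := by
          rw [abs_mul, abs_mul, abs_of_nonneg (hg0 t), abs_of_nonneg (hρ.nonneg s)]
      _ ≤ Λ * (G t - G s) + v * (E t - E s) := by
          gcongr
          · exact hgΛ t
          · exact hG s t hst
          · exact hle s
          · exact hE s t hst
      _ = _ := by ring
  · have h1 := mul_le_mul_of_nonneg_left (hv s t) hΛ
    have h2 := mul_le_mul_of_nonneg_left (hD s t) hv0
    dsimp only
    linarith

lemma VarLE.comp_monotone {ρ ψ : ℝ → ℝ} {v : ℝ} (h : VarLE ρ v) (hψ : Monotone ψ) :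
    VarLE (fun y => ρ (ψ y)) v := by
  obtain ⟨G, ⟨hm, hG⟩, hv⟩ := h
  exact ⟨fun y => G (ψ y), ⟨hm.comp hψ, fun s t hst => hG _ _ (hψ hst)⟩, fun s t => hv _ _⟩

lemma VarLE.comp_antitone {ρ ψ : ℝ → ℝ} {v : ℝ} (h : VarLE ρ v) (hψ : Antitone ψ) :
    VarLE (fun y => ρ (ψ y)) v := by
  obtain ⟨G, ⟨hm, hG⟩, hv⟩ := h
  refine ⟨fun y => - G (ψ y), ⟨fun s t hst => neg_le_neg (hm (hψ hst)), fun s t hst => ?_⟩,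
    fun s t => ?_⟩
  · have := hG _ _ (hψ hst)
    rw [abs_sub_comm]
    linarith
  · have := hv (ψ t) (ψ s)
    linarith

/-! ### Pushing densities by monotone branches -/

/-- `φ` is a monotone branch from `[a,b]` to `[0,1]`, and `g = 1/|φ'|` on `[a,b]`. -/
structure IsBranch (a b : ℝ) (φ g : ℝ → ℝ) : Prop where
  lt : a < b
  nonneg : 0 ≤ a
  le_one : b ≤ 1
  mono : MonotoneOn φ (Icc a b) ∨ AntitoneOn φ (Icc a b)
  maps : MapsTo φ (Icc a b) (Icc 0 1)
  meas : Measurable φ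
  gmeas : Measurable g
  deriv : ∃ φ' : ℝ → ℝ, ∀ t ∈ Icc a b, HasDerivWithinAt φ (φ' t) (Icc a b) t ∧ g t * |φ' t| = 1
  gnonneg : ∀ t, 0 ≤ g t

lemma IsBranch.continuousOn {a b : ℝ} {φ g : ℝ → ℝ} (h : IsBranch a b φ g) :
    ContinuousOn φ (Icc a b) := by
  obtain ⟨φ', h'⟩ := h.deriv
  exact fun t ht => (h' t ht).1.continuousWithinAt

/-- Equal values at `s < t` would make the monotone `φ` constant on `[s, t]`, so its derivative at
`s` would vanish, against `g * |φ'| = 1`. -/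
lemma IsBranch.injOn {a b : ℝ} {φ g : ℝ → ℝ} (h : IsBranch a b φ g) : InjOn φ (Icc a b) := by
  obtain ⟨φ', h'⟩ := h.deriv
  have key : ∀ s ∈ Icc a b, ∀ t ∈ Icc a b, s < t → φ s ≠ φ t := by
    intro s hs t ht hst heq
    have hc : ∀ r ∈ Icc s t, φ r = φ s := by
      intro r hr
      have hr' : r ∈ Icc a b := ⟨hs.1.trans hr.1, hr.2.trans ht.2⟩
      rcases h.mono with hm | hm
      · exact le_antisymm (heq ▸ hm hr' ht hr.2) (hm hs hr' hr.1)
      · exact le_antisymm (hm hs hr' hr.1) (heq ▸ hm hr' ht hr.2)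
    have hd : HasDerivWithinAt φ (φ' s) (Icc s t) s :=
      (h' s hs).1.mono (Icc_subset_Icc hs.1 ht.2)
    have hd0 : HasDerivWithinAt φ 0 (Icc s t) s :=
      (hasDerivWithinAt_const s (Icc s t) (φ s)).congr hc rfl
    have := (uniqueDiffOn_Icc hst s ⟨le_rfl, hst.le⟩).eq_deriv _ hd hd0
    have h2 := (h' s hs).2
    rw [this] at h2
    simp at h2
  intro s hs t ht heq
  rcases lt_trichotomy s t with hlt | rfl | hlt
  · exact absurd heq (key s hs t ht hlt)
  · rfl
  · exact absurd heq.symm (key t ht s hs hlt)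

/-- Postcomposition of a branch with the reflection of `[0,1]`. -/
lemma IsBranch.reflect {a b : ℝ} {φ g : ℝ → ℝ} (h : IsBranch a b φ g) :
    IsBranch a b (fun t => 1 - φ t) g where
  lt := h.lt
  nonneg := h.nonneg
  le_one := h.le_one
  mono := by
    rcases h.mono with hm | hm
    · right
      intro s hs t ht hst
      have := hm hs ht hst
      dsimp only
      linarith
    · left
      intro s hs t ht hst
      have := hm hs ht hst
      dsimp only
      linarith
  maps t ht := by
    have := h.maps ht
    exact ⟨by linarith [this.2], by linarith [this.1]⟩
  meas := h.meas.const_sub 1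
  gmeas := h.gmeas
  deriv := by
    obtain ⟨φ', h'⟩ := h.deriv
    refine ⟨fun t => - φ' t, fun t ht => ⟨(h' t ht).1.const_sub 1, ?_⟩⟩
    rw [abs_neg]
    exact (h' t ht).2
  gnonneg := h.gnonneg

/-- The image density is `ρ g` composed with the inverse branch. Once the inverse is extended to a
monotone function on the whole line, composition does not increase the variation, so the whole cost
is already contained in the variation of `ρ g`, with no extra jumps at the ends of the image. -/
lemma IsBranch.push_of_monotoneOn {a b : ℝ} {φ g : ℝ → ℝ} (h : IsBranch a b φ g)
    (hm : MonotoneOn φ (Icc a b))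
    {ρ : ℝ → ℝ} (hρ : IsDensity ρ) (hsupp : ∀ t, t ∉ Icc a b → ρ t = 0) {v : ℝ}
    (hv : VarLE (fun t => ρ t * g t) v) :
    ∃ ρ', IsDensity ρ' ∧ VarLE ρ' v ∧ (den ρ).map φ = den ρ' ∧
      (∀ t ∈ Icc a b, ρ' (φ t) = ρ t * g t) ∧ ∀ y, ρ' y ≠ 0 → ∃ t, ρ t ≠ 0 ∧ φ t = y := by
  classical
  -- Off the image the inverse takes the values `a - 1` and `b + 1`. These keep it monotone and lie
  -- outside `[a, b]`, where `ρ` vanishes.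
  set ψ : ℝ → ℝ := fun y => if hy : ∃ t ∈ Icc a b, φ t = y then hy.choose
    else if y < φ a then a - 1 else b + 1 with hψ
  have ψin : ∀ t ∈ Icc a b, ψ (φ t) = t := by
    intro t ht
    have hy : ∃ s ∈ Icc a b, φ s = φ t := ⟨t, ht, rfl⟩
    have : ψ (φ t) = hy.choose := by simp only [hψ, dif_pos hy]
    rw [this]
    exact h.injOn hy.choose_spec.1 ht hy.choose_spec.2
  have ψout : ∀ y, (¬ ∃ t ∈ Icc a b, φ t = y) → ψ y = if y < φ a then a - 1 else b + 1 := by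
    intro y hy
    simp only [hψ, dif_neg hy]
  have ha : a ∈ Icc a b := ⟨le_rfl, h.lt.le⟩
  have hb : b ∈ Icc a b := ⟨h.lt.le, le_rfl⟩
  have hψm : Monotone ψ := by
    intro y z hyz
    by_cases hy : ∃ t ∈ Icc a b, φ t = y <;> by_cases hz : ∃ t ∈ Icc a b, φ t = z
    · obtain ⟨s, hs, rfl⟩ := hy
      obtain ⟨t, ht, rfl⟩ := hz
      rw [ψin s hs, ψin t ht]
      by_contra! hlt
      have := hm ht hs hlt.le
      have := h.injOn ht hs (le_antisymm this hyz)
      linarith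
    · obtain ⟨s, hs, rfl⟩ := hy
      rw [ψin s hs, ψout z hz, if_neg]
      · linarith [hs.2]
      · linarith [hm ha hs hs.1]
    · obtain ⟨t, ht, rfl⟩ := hz
      rw [ψin t ht, ψout y hy, if_pos]
      · linarith [ht.1]
      · by_contra! hlt
        have hy' : y ∈ Icc (φ a) (φ t) := ⟨hlt, hyz⟩
        obtain ⟨r, hr, hr'⟩ := intermediate_value_Icc ht.1
          (h.continuousOn.mono (Icc_subset_Icc le_rfl ht.2)) hy'
        exact hy ⟨r, ⟨hr.1, hr.2.trans ht.2⟩, hr'⟩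
    · rw [ψout y hy, ψout z hz]
      split_ifs with h1 h2 h2
      · exact le_rfl
      · linarith [h.lt]
      · linarith
      · exact le_rfl
  have hρg : ∀ t, t ∉ Icc a b → ρ t * g t = 0 := fun t ht => by rw [hsupp t ht, zero_mul]
  have hout : ∀ y, (¬ ∃ t ∈ Icc a b, φ t = y) → ρ (ψ y) * g (ψ y) = 0 := by
    intro y hy
    apply hρg
    rw [ψout y hy]
    split_ifs
    · rintro ⟨h1, -⟩; linarith
    · rintro ⟨-, h1⟩; linarith
  refine ⟨fun y => ρ (ψ y) * g (ψ y), ⟨fun y => mul_nonneg (hρ.nonneg _) (h.gnonneg _),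
    (hρ.meas.mul h.gmeas).comp hψm.measurable, fun y hy => ?_⟩, hv.comp_monotone hψm, ?_, ?_, ?_⟩
  · apply hout
    rintro ⟨t, ht, rfl⟩
    exact hy (h.maps ht)
  · obtain ⟨φ', h'⟩ := h.deriv
    ext E hE
    have hE' : MeasurableSet (φ ⁻¹' E) := h.meas hE
    have hs : MeasurableSet (Icc a b ∩ φ ⁻¹' E) := measurableSet_Icc.inter hE'
    rw [Measure.map_apply h.meas hE, den, den, withDensity_apply _ hE, withDensity_apply _ hE']
    have e1 : ∫⁻ t in φ ⁻¹' E, ENNReal.ofReal (ρ t) =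
        ∫⁻ t in Icc a b ∩ φ ⁻¹' E, ENNReal.ofReal (ρ t) := by
      rw [← lintegral_indicator hE', ← lintegral_indicator hs]
      congr 1
      ext t
      by_cases ht : t ∈ Icc a b
      · by_cases ht2 : t ∈ φ ⁻¹' E
        · rw [indicator_of_mem ht2, indicator_of_mem (show t ∈ Icc a b ∩ φ ⁻¹' E from ⟨ht, ht2⟩)]
        · rw [indicator_of_notMem ht2, indicator_of_notMem (fun hh => ht2 hh.2)]
      · rw [indicator_of_notMem (fun hh => ht hh.1 : t ∉ Icc a b ∩ φ ⁻¹' E)]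
        by_cases ht2 : t ∈ φ ⁻¹' E
        · rw [indicator_of_mem ht2, hsupp t ht, ENNReal.ofReal_zero]
        · rw [indicator_of_notMem ht2]
    have e2 : ∫⁻ y in E, ENNReal.ofReal (ρ (ψ y) * g (ψ y)) =
        ∫⁻ y in φ '' (Icc a b ∩ φ ⁻¹' E), ENNReal.ofReal (ρ (ψ y) * g (ψ y)) := by
      have him : MeasurableSet (φ '' (Icc a b ∩ φ ⁻¹' E)) := by
        apply hs.image_of_continuousOn_injOn (h.continuousOn.mono inter_subset_left)
          (h.injOn.mono inter_subset_left)
      rw [← lintegral_indicator hE, ← lintegral_indicator him]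
      congr 1
      ext y
      by_cases hy : ∃ t ∈ Icc a b, φ t = y
      · by_cases hyE : y ∈ E
        · obtain ⟨t, ht, rfl⟩ := hy
          rw [indicator_of_mem hyE, indicator_of_mem
            (mem_image_of_mem φ (show t ∈ Icc a b ∩ φ ⁻¹' E from ⟨ht, hyE⟩))]
        · rw [indicator_of_notMem hyE, indicator_of_notMem]
          rintro ⟨t, ⟨-, ht⟩, rfl⟩
          exact hyE ht
      · rw [indicator_of_notMem (s := φ '' (Icc a b ∩ φ ⁻¹' E))]
        · by_cases hyE : y ∈ E
          · rw [indicator_of_mem hyE, hout y hy, ENNReal.ofReal_zero]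
          · rw [indicator_of_notMem hyE]
        · rintro ⟨t, ⟨ht, -⟩, rfl⟩
          exact hy ⟨t, ht, rfl⟩
    rw [e1, e2, lintegral_image_eq_lintegral_abs_deriv_mul hs
      (fun t ht => ((h' t ht.1).1.mono inter_subset_left)) (h.injOn.mono inter_subset_left)]
    refine setLIntegral_congr_fun hs fun t ht => ?_
    rw [ψin t ht.1, ← ENNReal.ofReal_mul (abs_nonneg _)]
    congr 1
    have := (h' t ht.1).2
    linear_combination (- ρ t) * this
  · intro t ht
    dsimp only
    rw [ψin t ht]
  · intro y hy
    by_contra hcon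
    push Not at hcon
    apply hy
    by_cases hy' : ∃ t ∈ Icc a b, φ t = y
    · obtain ⟨t, ht, rfl⟩ := hy'
      dsimp only
      rw [ψin t ht]
      by_contra hne
      exact hcon t (left_ne_zero_of_mul hne) rfl
    · exact hout y hy'

lemma den_map_reflect (ρ : ℝ → ℝ) :
    (den ρ).map (fun y => 1 - y) = den (fun y => ρ (1 - y)) := by
  ext E hE
  have hm : Measurable fun y : ℝ => 1 - y := measurable_id.const_sub 1
  rw [Measure.map_apply hm hE, den, den, withDensity_apply _ (hm hE), withDensity_apply _ hE,
    ← lintegral_indicator (hm hE), ← lintegral_indicator hE,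
    ← lintegral_sub_left_eq_self _ (1 : ℝ)]
  congr 1
  ext y
  by_cases hy : y ∈ E
  · rw [indicator_of_mem hy, indicator_of_mem]
    simpa using hy
  · rw [indicator_of_notMem hy, indicator_of_notMem]
    simpa using hy

/-- A decreasing branch becomes increasing after reflecting the target `[0,1]`, and reflecting a
density preserves its variation. -/
lemma IsBranch.push {a b : ℝ} {φ g : ℝ → ℝ} (h : IsBranch a b φ g)
    {ρ : ℝ → ℝ} (hρ : IsDensity ρ) (hsupp : ∀ t, t ∉ Icc a b → ρ t = 0) {v : ℝ}
    (hv : VarLE (fun t => ρ t * g t) v) :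
    ∃ ρ', IsDensity ρ' ∧ VarLE ρ' v ∧ (den ρ).map φ = den ρ' ∧
      (∀ t ∈ Icc a b, ρ' (φ t) = ρ t * g t) ∧ ∀ y, ρ' y ≠ 0 → ∃ t, ρ t ≠ 0 ∧ φ t = y := by
  rcases h.mono with hm | hm
  · exact h.push_of_monotoneOn hm hρ hsupp hv
  · have hm' : MonotoneOn (fun t => 1 - φ t) (Icc a b) := fun s hs t ht hst => by
      have := hm hs ht hst
      dsimp only
      linarith
    obtain ⟨ρ', h1, h2, h3, h4, h5⟩ := h.reflect.push_of_monotoneOn hm' hρ hsupp hv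
    have hms : Measurable fun y : ℝ => 1 - y := measurable_id.const_sub 1
    refine ⟨fun y => ρ' (1 - y), ⟨fun y => h1.nonneg _, h1.meas.comp hms, fun y hy => h1.supp _ ?_⟩,
      h2.comp_antitone (fun s t hst => by linarith), ?_, fun t ht => h4 t ht, fun y hy => ?_⟩
    · intro hy'
      exact hy ⟨by linarith [hy'.2], by linarith [hy'.1]⟩
    · rw [← den_map_reflect ρ', ← h3, Measure.map_map hms (h.meas.const_sub 1)]
      congr 1
      ext t
      simp
    · obtain ⟨t, ht, ht'⟩ := h5 _ hy
      exact ⟨t, ht, by linarith⟩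

/-! ### Iterated branches -/

/-- The composition of the first `N` branches. -/
def iter (φ : ℕ → ℝ → ℝ) : ℕ → ℝ → ℝ
  | 0 => id
  | N + 1 => fun t => iter (fun k => φ (k + 1)) N (φ 0 t)

/-- The points whose first iterates lie in the domains of the branches. -/
def cyl (a b : ℕ → ℝ) (φ : ℕ → ℝ → ℝ) : ℕ → Set ℝ
  | 0 => univ
  | N + 1 => Ioo (a 0) (b 0) ∩ φ 0 ⁻¹' cyl (fun k => a (k + 1)) (fun k => b (k + 1))
      (fun k => φ (k + 1)) N

lemma measurable_iter (N : ℕ) : ∀ {φ : ℕ → ℝ → ℝ}, (∀ k < N, Measurable (φ k)) →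
    Measurable (iter φ N) := by
  induction N with
  | zero => intro φ _; exact measurable_id
  | succ N ih =>
    intro φ h
    exact (ih fun k hk => h (k + 1) (by omega)).comp (h 0 (by omega))

lemma measurableSet_cyl (N : ℕ) : ∀ {a b : ℕ → ℝ} {φ : ℕ → ℝ → ℝ},
    (∀ k < N, Measurable (φ k)) → MeasurableSet (cyl a b φ N) := by
  induction N with
  | zero => intro a b φ _; exact MeasurableSet.univ
  | succ N ih =>
    intro a b φ h
    exact measurableSet_Ioo.inter ((h 0 (by omega)) (ih fun k hk => h (k + 1) (by omega)))

/-- Preimages of intervals under monotone branches are intervals. A density is therefore cut only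
once along a whole block, so the factor `3` occurs once per block and not once per step. -/
lemma ordConnected_cyl (N : ℕ) : ∀ {a b : ℕ → ℝ} {φ g : ℕ → ℝ → ℝ},
    (∀ k < N, IsBranch (a k) (b k) (φ k) (g k)) → (cyl a b φ N).OrdConnected := by
  induction N with
  | zero => intro a b φ g _; exact ordConnected_univ
  | succ N ih =>
    intro a b φ g h
    have h0 := h 0 (by omega)
    have h1 := ih (a := fun k => a (k + 1)) (b := fun k => b (k + 1)) (φ := fun k => φ (k + 1))
      (g := fun k => g (k + 1)) (fun k hk => h (k + 1) (by omega))
    refine ⟨fun s hs t ht r hr => ?_⟩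
    have hr' : r ∈ Ioo (a 0) (b 0) := ⟨hs.1.1.trans_le hr.1, hr.2.trans_lt ht.1.2⟩
    refine ⟨hr', ?_⟩
    have i := Ioo_subset_Icc_self (a := a 0) (b := b 0)
    rcases h0.mono with hm | hm
    · exact h1.out hs.2 ht.2 ⟨hm (i hs.1) (i hr') hr.1, hm (i hr') (i ht.1) hr.2⟩
    · exact h1.out ht.2 hs.2 ⟨hm (i hr') (i ht.1) hr.2, hm (i hs.1) (i hr') hr.1⟩

/-- Pushing a density supported in a cylinder. -/
lemma push_iter (N : ℕ) : ∀ {a b Λ : ℕ → ℝ} {φ g : ℕ → ℝ → ℝ} {κ : ℝ}, 1 ≤ κ →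
    (∀ k < N, IsBranch (a k) (b k) (φ k) (g k)) → (∀ k < N, ∀ t, g k t ≤ Λ k) →
    (∀ k < N, Λ k ≤ κ) → (∀ k < N, ∀ s t, |g k t - g k s| ≤ κ * |t - s|) →
    ∀ {ρ : ℝ → ℝ} {v : ℝ}, IsDensity ρ → VarLE ρ v → (∀ t, t ∉ cyl a b φ N → ρ t = 0) →
    HasVar ((den ρ).map (iter φ N)) ((∏ k ∈ Finset.range N, Λ k) * v + N * κ ^ N * ∫ t, ρ t) := by
  induction N with
  | zero =>
    intro a b Λ φ g κ _ _ _ _ _ ρ v hρ hv _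
    refine ⟨ρ, hρ, by simpa using hv, ?_⟩
    simp [iter]
  | succ N ih =>
    intro a b Λ φ g κ hκ hb hΛ hΛκ hH ρ v hρ hv hs
    have h0 := hb 0 (by omega)
    have hi := hρ.integrable hv
    have hΛ0 : ∀ k < N + 1, 0 ≤ Λ k := fun k hk =>
      ((hb k hk).gnonneg 0).trans (hΛ k hk 0)
    have hs0 : ∀ t, t ∉ Icc (a 0) (b 0) → ρ t = 0 := fun t ht =>
      hs t fun hh => ht (Ioo_subset_Icc_self hh.1)
    have hv1 : VarLE (fun t => ρ t * g 0 t) (Λ 0 * v + κ * ∫ t, ρ t) :=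
      hv.mul_lipschitz hρ h0.gnonneg (hΛ 0 (by omega)) (by linarith) (hH 0 (by omega))
    obtain ⟨ρ', h1, h2, h3, -, h5⟩ := h0.push hρ hs0 hv1
    have hmass : ∫ t, ρ' t = ∫ t, ρ t := by
      rw [← den_real_univ h1 (h1.integrable h2), ← den_real_univ hρ hi, ← h3,
        Measure.real, Measure.map_apply h0.meas MeasurableSet.univ, preimage_univ, Measure.real]
    have hs' : ∀ y, y ∉ cyl (fun k => a (k + 1)) (fun k => b (k + 1)) (fun k => φ (k + 1)) N →
        ρ' y = 0 := by
      intro y hy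
      by_contra hne
      obtain ⟨t, ht, rfl⟩ := h5 y hne
      have : t ∈ cyl a b φ (N + 1) := by
        by_contra hcon
        exact ht (hs t hcon)
      exact hy this.2
    have := ih (a := fun k => a (k + 1)) (b := fun k => b (k + 1)) (φ := fun k => φ (k + 1))
      (g := fun k => g (k + 1)) (Λ := fun k => Λ (k + 1)) hκ (fun k hk => hb (k + 1) (by omega))
      (fun k hk => hΛ (k + 1) (by omega)) (fun k hk => hΛκ (k + 1) (by omega))
      (fun k hk => hH (k + 1) (by omega)) h1 h2 hs'
    have hmap : (den ρ).map (iter φ (N + 1)) =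
        (den ρ').map (iter (fun k => φ (k + 1)) N) := by
      rw [← h3, Measure.map_map (measurable_iter N fun k hk => (hb (k + 1) (by omega)).meas)
        h0.meas]
      rfl
    rw [hmap]
    refine this.mono ?_
    rw [Finset.prod_range_succ', hmass]
    have hP : ∏ k ∈ Finset.range N, Λ (k + 1) ≤ κ ^ N := by
      have := Finset.prod_le_prod (s := Finset.range N) (f := fun k => Λ (k + 1))
        (g := fun _ => κ) (fun k hk => hΛ0 _ (by have := Finset.mem_range.1 hk; omega))
        (fun k hk => hΛκ _ (by have := Finset.mem_range.1 hk; omega))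
      simpa using this
    have hI : 0 ≤ ∫ t, ρ t := integral_nonneg hρ.nonneg
    have hκ0 : 0 ≤ κ := by linarith
    have e1 : (∏ k ∈ Finset.range N, Λ (k + 1)) * (κ * ∫ t, ρ t) ≤ κ ^ N * (κ * ∫ t, ρ t) :=
      mul_le_mul_of_nonneg_right hP (by positivity)
    have e2 : (N : ℝ) * κ ^ N * ∫ t, ρ t ≤ N * κ ^ (N + 1) * ∫ t, ρ t := by
      have : κ ^ N ≤ κ ^ (N + 1) := pow_le_pow_right₀ hκ (by omega)
      gcongr
    push_cast
    have e3 : κ ^ (N + 1) * ∫ t, ρ t = κ ^ N * (κ * ∫ t, ρ t) := by ring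
    nlinarith

/-! ### Families of product densities -/

/-- `μ` is a finite sum of product measures with one-dimensional factors of bounded variation, and
in every direction the variations of the summands add up to at most `z`. -/
def Fam {n : ℕ} (μ : Measure (Fin n → ℝ)) (z : ℝ) : Prop :=
  ∃ (ι : Type) (_ : Fintype ι) (ν : ι → Fin n → Measure ℝ) (v : ι → Fin n → ℝ),
    (∀ w i, HasVar (ν w i) (v w i)) ∧ μ = ∑ w, Measure.pi (ν w) ∧
    ∀ i, ∑ w, v w i * ∏ j ∈ Finset.univ.erase i, (ν w j).real univ ≤ z

lemma Fam.mono {n : ℕ} {μ : Measure (Fin n → ℝ)} {z z' : ℝ} (h : Fam μ z) (hz : z ≤ z') :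
    Fam μ z' := by
  obtain ⟨ι, _, ν, v, h1, h2, h3⟩ := h
  exact ⟨ι, _, ν, v, h1, h2, fun i => (h3 i).trans hz⟩

/-- Both sides are masses for the product measure: the left side is the mass of a union of disjoint
boxes. -/
lemma sum_prod_real_le {n : ℕ} {κ : Type*} [Fintype κ] (τ : Fin n → Measure ℝ)
    [∀ i, IsFiniteMeasure (τ i)] (S : κ → Fin n → Set ℝ) (hS : ∀ w i, MeasurableSet (S w i))
    (hd : Pairwise fun w w' => Disjoint (univ.pi (S w)) (univ.pi (S w'))) :
    ∑ w, ∏ j, (τ j).real (S w j) ≤ ∏ j, (τ j).real univ := by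
  have h1 : ∀ w, ∏ j, (τ j).real (S w j) = (Measure.pi τ).real (univ.pi (S w)) := by
    intro w
    rw [Measure.real, Measure.pi_pi, ENNReal.toReal_prod]
    rfl
  have h2 : ∏ j, (τ j).real univ = (Measure.pi τ).real univ := by
    rw [Measure.real, Measure.pi_univ, ENNReal.toReal_prod]
    rfl
  rw [h2, Finset.sum_congr rfl fun w _ => h1 w,
    ← measureReal_biUnion_finset (fun w _ w' _ hww' => hd hww')
      (fun w _ => MeasurableSet.univ_pi (hS w))]
  exact measureReal_mono (subset_univ _)

/-- A value strictly inside both hulls gives points of `J` and `J'` on either side of it, and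
monotonicity of `G` then forces the two intervals to overlap. This lets oscillations of `G` be
treated as lengths of disjoint intervals. -/
lemma disjoint_hull {G : ℝ → ℝ} (hG : Monotone G) {J J' : Set ℝ} (hJ : J.OrdConnected)
    (hJ' : J'.OrdConnected) (hne : J.Nonempty) (hne' : J'.Nonempty) (hd : Disjoint J J') :
    Disjoint (Ioo (sInf (G '' J)) (sSup (G '' J))) (Ioo (sInf (G '' J')) (sSup (G '' J'))) := by
  rw [Set.disjoint_left]
  rintro y ⟨h1, h2⟩ ⟨h3, h4⟩
  obtain ⟨_, ⟨s, hs, rfl⟩, hsy⟩ := exists_lt_of_csInf_lt (hne.image G) h1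
  obtain ⟨_, ⟨t, ht, rfl⟩, hty⟩ := exists_lt_of_lt_csSup (hne.image G) h2
  obtain ⟨_, ⟨s', hs', rfl⟩, hsy'⟩ := exists_lt_of_csInf_lt (hne'.image G) h3
  obtain ⟨_, ⟨t', ht', rfl⟩, hty'⟩ := exists_lt_of_lt_csSup (hne'.image G) h4
  have e1 : s < t' := hG.reflect_lt (hsy.trans hty')
  have e2 : s' < t := hG.reflect_lt (hsy'.trans hty)
  rcases le_total s s' with h | h
  · exact Set.disjoint_left.1 hd (hJ.out hs ht ⟨h, e2.le⟩) hs'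
  · exact Set.disjoint_left.1 hd hs (hJ'.out hs' ht' ⟨h, e1.le⟩)

/-- The oscillations of a monotone function over the `i`-th sides of disjoint boxes. -/
lemma sum_osc_mul_prod_le {n : ℕ} {κ : Type*} [Fintype κ] (ν : Fin n → Measure ℝ)
    [∀ i, IsFiniteMeasure (ν i)] (J : κ → Fin n → Set ℝ) (hJ : ∀ w i, MeasurableSet (J w i))
    (hJc : ∀ w i, (J w i).OrdConnected) (hJne : ∀ w i, (J w i).Nonempty)
    (hd : Pairwise fun w w' => Disjoint (univ.pi (J w)) (univ.pi (J w')))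
    {G : ℝ → ℝ} (hG : Monotone G) {v : ℝ} (hv : ∀ s t, G t - G s ≤ v) (i : Fin n) :
    ∑ w, (sSup (G '' J w i) - sInf (G '' J w i)) * ∏ j ∈ Finset.univ.erase i, (ν j).real (J w j) ≤
      v * ∏ j ∈ Finset.univ.erase i, (ν j).real univ := by
  have hb : ∀ s, BddAbove (G '' s) ∧ BddBelow (G '' s) := fun s =>
    ⟨⟨G 0 + v, by rintro _ ⟨t, -, rfl⟩; linarith [hv 0 t]⟩,
      ⟨G 0 - v, by rintro _ ⟨t, -, rfl⟩; linarith [hv t 0]⟩⟩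
  set A : ℝ := sInf (G '' univ) with hA
  set B : ℝ := sSup (G '' univ) with hB
  have hAB : B - A ≤ v := by
    have : B ≤ A + v := by
      refine csSup_le (univ_nonempty.image G) ?_
      rintro _ ⟨t, -, rfl⟩
      have : G t - v ≤ A := by
        refine le_csInf (univ_nonempty.image G) ?_
        rintro _ ⟨s, -, rfl⟩
        linarith [hv s t]
      linarith
    linarith
  have hsub : ∀ w, Ioo (sInf (G '' J w i)) (sSup (G '' J w i)) ⊆ Ioo A B := fun w =>
    Ioo_subset_Ioo (csInf_le_csInf (hb _).2 ((hJne w i).image G) (image_mono (subset_univ _)))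
      (csSup_le_csSup (hb _).1 ((hJne w i).image G) (image_mono (subset_univ _)))
  have hle : ∀ w, sInf (G '' J w i) ≤ sSup (G '' J w i) := fun w =>
    csInf_le_csSup ((hJne w i).image G) (hb _).2 (hb _).1
  -- In coordinate `i` the measure is replaced by Lebesgue measure on the range of `G`, and each
  -- side by the hull of its `G`-values. Oscillations become lengths, and the boxes stay disjoint
  -- whichever coordinate separated them, so the additivity of product masses applies.
  let τ : Fin n → Measure ℝ := fun j => if j = i then volume.restrict (Ioo A B) else ν j
  let S : κ → Fin n → Set ℝ := fun w j =>
    if j = i then Ioo (sInf (G '' J w i)) (sSup (G '' J w i)) else J w j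
  have hfin : ∀ j, IsFiniteMeasure (τ j) := by
    intro j
    by_cases h : j = i
    · have : IsFiniteMeasure ((volume : Measure ℝ).restrict (Ioo A B)) := ⟨by simp⟩
      simpa only [τ, if_pos h]
    · simp only [τ, if_neg h]; infer_instance
  have hSm : ∀ w j, MeasurableSet (S w j) := by
    intro w j
    by_cases h : j = i
    · simp only [S, if_pos h]; exact measurableSet_Ioo
    · simp only [S, if_neg h]; exact hJ w j
  have hSd : Pairwise fun w w' => Disjoint (univ.pi (S w)) (univ.pi (S w')) := by
    intro w w' hww'
    have : Disjoint (univ.pi (J w)) (univ.pi (J w')) := hd hww'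
    change Disjoint (univ.pi (S w)) (univ.pi (S w'))
    rw [disjoint_univ_pi] at this ⊢
    obtain ⟨j, hj⟩ := this
    refine ⟨j, ?_⟩
    by_cases h : j = i
    · subst h
      simp only [S, if_true]
      exact disjoint_hull hG (hJc _ _) (hJc _ _) (hJne _ _) (hJne _ _) hj
    · simpa only [S, if_neg h]
  have key := sum_prod_real_le τ S hSm hSd
  have e1 : ∀ w, ∏ j, (τ j).real (S w j) = (sSup (G '' J w i) - sInf (G '' J w i)) *
      ∏ j ∈ Finset.univ.erase i, (ν j).real (J w j) := by
    intro w
    rw [← Finset.mul_prod_erase _ _ (Finset.mem_univ i)]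
    congr 1
    · simp only [τ, S, if_true]
      rw [Measure.real, Measure.restrict_apply measurableSet_Ioo, inter_eq_left.2 (hsub w),
        Real.volume_Ioo, ENNReal.toReal_ofReal (by linarith [hle w])]
    · refine Finset.prod_congr rfl fun j hj => ?_
      simp only [τ, S, if_neg (Finset.ne_of_mem_erase hj)]
  have hAB0 : A ≤ B := csInf_le_csSup (univ_nonempty.image G) (hb _).2 (hb _).1
  have e2 : ∏ j, (τ j).real univ = (B - A) * ∏ j ∈ Finset.univ.erase i, (ν j).real univ := by
    rw [← Finset.mul_prod_erase _ _ (Finset.mem_univ i)]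
    congr 1
    · simp only [τ, if_true]
      rw [Measure.real, Measure.restrict_apply MeasurableSet.univ, univ_inter,
        Real.volume_Ioo, ENNReal.toReal_ofReal (by linarith)]
    · refine Finset.prod_congr rfl fun j hj => ?_
      simp only [τ, if_neg (Finset.ne_of_mem_erase hj)]
  rw [Finset.sum_congr rfl fun w _ => e1 w, e2] at key
  exact key.trans (mul_le_mul_of_nonneg_right hAB
    (Finset.prod_nonneg fun j _ => measureReal_nonneg))

lemma restrict_finset_sum {α ι : Type*} [MeasurableSpace α] (t : Finset ι) (m : ι → Measure α)
    (s : Set α) : (∑ i ∈ t, m i).restrict s = ∑ i ∈ t, (m i).restrict s := by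
  classical
  induction t using Finset.induction_on with
  | empty => simp
  | insert a t ha ih => rw [Finset.sum_insert ha, Finset.sum_insert ha, Measure.restrict_add, ih]

/-- The effect of a piecewise product map on a family of product densities. -/
lemma Fam.step {n : ℕ} {κ : Type} [Fintype κ] {μ : Measure (Fin n → ℝ)} {z α β : ℝ} (h : Fam μ z)
    (hα : 0 ≤ α)
    (J : κ → Fin n → Set ℝ) (hJ : ∀ w i, MeasurableSet (J w i))
    (hJc : ∀ w i, (J w i).OrdConnected) (hJne : ∀ w i, (J w i).Nonempty)
    (hd : Pairwise fun w w' => Disjoint (univ.pi (J w)) (univ.pi (J w')))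
    (hβ : 0 ≤ β) (Φ : κ → Fin n → ℝ → ℝ) (hΦ : ∀ w i, Measurable (Φ w i))
    (hstep : ∀ w i ρ G o, IsDensity ρ → Integrable ρ → Majorant ρ G → 0 ≤ o →
      (∀ s ∈ J w i, ∀ t ∈ J w i, G t - G s ≤ o) →
      HasVar (((den ρ).restrict (J w i)).map (Φ w i)) (α * o + β * ∫ t in J w i, ρ t)) :
    Fam (∑ w, (μ.restrict (univ.pi (J w))).map fun x i => Φ w i (x i))
      (α * z + β * μ.real univ) := by
  obtain ⟨ι, _, ν, v, h1, rfl, h3⟩ := h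
  have hfin : ∀ u i, IsFiniteMeasure (ν u i) := fun u i => (h1 u i).isFiniteMeasure
  choose ρ hρ hv hνρ using h1
  choose G hG hGv using hv
  have hint : ∀ u i, Integrable (ρ u i) := fun u i => (hρ u i).integrable ⟨G u i, hG u i, hGv u i⟩
  have hb : ∀ u i s, BddAbove (G u i '' s) ∧ BddBelow (G u i '' s) := fun u i s =>
    ⟨⟨G u i 0 + v u i, by rintro _ ⟨t, -, rfl⟩; linarith [hGv u i 0 t]⟩,
      ⟨G u i 0 - v u i, by rintro _ ⟨t, -, rfl⟩; linarith [hGv u i t 0]⟩⟩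
  set o : ι → κ → Fin n → ℝ := fun u w i =>
    sSup (G u i '' J w i) - sInf (G u i '' J w i) with ho
  have ho0 : ∀ u w i, 0 ≤ o u w i := fun u w i => sub_nonneg.2
    (csInf_le_csSup ((hJne w i).image _) (hb u i _).2 (hb u i _).1)
  have hmass : ∀ u w i, ∫ t in J w i, ρ u i t = (ν u i).real (J w i) := fun u w i => by
    rw [hνρ, den_apply_toReal (hρ u i) (hint u i) (hJ w i)]
  have hmapm : ∀ w, Measurable fun (x : Fin n → ℝ) i => Φ w i (x i) := fun w =>
    measurable_pi_lambda _ fun i => (hΦ w i).comp (measurable_pi_apply i)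
  have hmapuniv : ∀ u w i, (((ν u i).restrict (J w i)).map (Φ w i)).real univ =
      (ν u i).real (J w i) := by
    intro u w i
    rw [Measure.real, Measure.map_apply (hΦ w i) MeasurableSet.univ, preimage_univ,
      Measure.restrict_apply MeasurableSet.univ, univ_inter, Measure.real]
  refine ⟨ι × κ, inferInstance, fun p i => ((ν p.1 i).restrict (J p.2 i)).map (Φ p.2 i),
    fun p i => α * o p.1 p.2 i + β * (ν p.1 i).real (J p.2 i), ?_, ?_, ?_⟩
  · rintro ⟨u, w⟩ i
    have := hstep w i (ρ u i) (G u i) (o u w i) (hρ u i) (hint u i) (hG u i) (ho0 u w i) ?_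
    · rwa [← hνρ, hmass] at this
    · intro s hs t ht
      exact sub_le_sub (le_csSup (hb u i _).1 ⟨t, ht, rfl⟩) (csInf_le (hb u i _).2 ⟨s, hs, rfl⟩)
  · rw [Fintype.sum_prod_type, Finset.sum_comm]
    refine Finset.sum_congr rfl fun w _ => ?_
    rw [restrict_finset_sum, Measure.map_finset_sum' (hmapm w).aemeasurable]
    refine Finset.sum_congr rfl fun u _ => ?_
    rw [Measure.restrict_pi_pi, Measure.pi_map_pi fun i => (hΦ w i).aemeasurable]
  · intro i
    have hreal : (∑ u, Measure.pi (ν u)).real univ = ∑ u, ∏ j, (ν u j).real univ := by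
      rw [Measure.real, Measure.finsetSum_apply, ENNReal.toReal_sum (by simp)]
      refine Finset.sum_congr rfl fun u _ => ?_
      rw [Measure.pi_univ, ENNReal.toReal_prod]
      rfl
    rw [Fintype.sum_prod_type]
    simp only [hmapuniv]
    calc ∑ u, ∑ w, (α * o u w i + β * (ν u i).real (J w i)) *
          ∏ j ∈ Finset.univ.erase i, (ν u j).real (J w j)
        = ∑ u, (α * ∑ w, o u w i * ∏ j ∈ Finset.univ.erase i, (ν u j).real (J w j) +
            β * ∑ w, ∏ j, (ν u j).real (J w j)) := by
          refine Finset.sum_congr rfl fun u _ => ?_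
          rw [Finset.mul_sum, Finset.mul_sum, ← Finset.sum_add_distrib]
          refine Finset.sum_congr rfl fun w _ => ?_
          rw [← Finset.mul_prod_erase Finset.univ _ (Finset.mem_univ i)]
          ring
      _ ≤ ∑ u, (α * (v u i * ∏ j ∈ Finset.univ.erase i, (ν u j).real univ) +
            β * ∏ j, (ν u j).real univ) := by
          refine Finset.sum_le_sum fun u _ => ?_
          have e1 := sum_osc_mul_prod_le (ν u) J hJ hJc hJne hd (hG u i).1 (hGv u i) i
          have e2 := sum_prod_real_le (ν u) J hJ hd
          gcongr
      _ = α * ∑ u, v u i * ∏ j ∈ Finset.univ.erase i, (ν u j).real univ +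
            β * (∑ u, Measure.pi (ν u)).real univ := by
          rw [hreal, Finset.sum_add_distrib, Finset.mul_sum, Finset.mul_sum]
      _ ≤ _ := by
          have := h3 i
          gcongr

/-- A density that vanishes outside `[0,1]` is bounded by its variation, hence so is its integral.
Applied to one factor of each summand, this compares mass and variation; the direction used exists
because `1 ≤ n`. -/
lemma Fam.real_univ_le {n : ℕ} (hn : 1 ≤ n) {μ : Measure (Fin n → ℝ)} {z : ℝ} (h : Fam μ z) :
    μ.real univ ≤ z := by
  obtain ⟨ι, _, ν, v, h1, rfl, h3⟩ := h
  have hfin : ∀ u i, IsFiniteMeasure (ν u i) := fun u i => (h1 u i).isFiniteMeasure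
  refine le_trans ?_ (h3 ⟨0, hn⟩)
  rw [Measure.real, Measure.finsetSum_apply, ENNReal.toReal_sum (by simp)]
  refine Finset.sum_le_sum fun u _ => ?_
  rw [Measure.pi_univ, ENNReal.toReal_prod,
    ← Finset.mul_prod_erase Finset.univ _ (Finset.mem_univ ⟨0, hn⟩)]
  exact mul_le_mul_of_nonneg_right (h1 u _).real_univ_le
    (Finset.prod_nonneg fun j _ => ENNReal.toReal_nonneg)

/-- Product measures with densities. -/
lemma pi_den {n : ℕ} {ρ : Fin n → ℝ → ℝ} (hρ : ∀ i, IsDensity (ρ i))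
    (hi : ∀ i, Integrable (ρ i)) :
    Measure.pi (fun i => den (ρ i)) =
      (volume : Measure (Fin n → ℝ)).withDensity fun x => ENNReal.ofReal (∏ i, ρ i (x i)) := by
  have hf : ∀ i, IsFiniteMeasure (den (ρ i)) := fun i => isFiniteMeasure_den (hi i)
  refine Measure.pi_eq fun s hs => ?_
  have hmeas : Measurable fun x : Fin n → ℝ => ∏ i, ρ i (x i) :=
    Finset.measurable_prod _ fun i _ => (hρ i).meas.comp (measurable_pi_apply i)
  rw [withDensity_apply _ (MeasurableSet.univ_pi hs), ← lintegral_indicator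
    (MeasurableSet.univ_pi hs)]
  have e1 : ∀ x : Fin n → ℝ, (univ.pi s).indicator (fun x => ENNReal.ofReal (∏ i, ρ i (x i))) x =
      ENNReal.ofReal (∏ i, (s i).indicator (ρ i) (x i)) := by
    intro x
    by_cases hx : x ∈ univ.pi s
    · rw [indicator_of_mem hx]
      congr 1
      exact Finset.prod_congr rfl fun i _ => (indicator_of_mem (hx i (mem_univ i)) _).symm
    · rw [indicator_of_notMem hx]
      have : ∃ i, x i ∉ s i := by simpa [Set.mem_pi] using hx
      obtain ⟨i, hi⟩ := this
      rw [Finset.prod_eq_zero (Finset.mem_univ i) (indicator_of_notMem hi _), ENNReal.ofReal_zero]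
  simp_rw [e1]
  have e2 : ∀ i, Integrable ((s i).indicator (ρ i)) := fun i => (hi i).indicator (hs i)
  have e3 : Integrable (fun x : Fin n → ℝ => ∏ i, (s i).indicator (ρ i) (x i)) volume :=
    Integrable.fintype_prod e2
  rw [← ofReal_integral_eq_lintegral_ofReal e3
    (ae_of_all _ fun x => Finset.prod_nonneg fun i _ =>
      indicator_nonneg (fun t _ => (hρ i).nonneg t) _),
    integral_fintype_prod_volume_eq_prod,
    ENNReal.ofReal_prod_of_nonneg fun i _ => integral_nonneg fun t =>
      indicator_nonneg (fun t _ => (hρ i).nonneg t) _]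
  refine Finset.prod_congr rfl fun i _ => ?_
  rw [integral_indicator (hs i), ← den_apply_toReal (hρ i) (hi i) (hs i), Measure.real,
    ENNReal.ofReal_toReal (measure_ne_top _ _)]

lemma Fam.absolutelyContinuous {n : ℕ} {μ : Measure (Fin n → ℝ)} {z : ℝ} (h : Fam μ z) :
    μ ≪ volume := by
  obtain ⟨ι, _, ν, v, h1, rfl, h3⟩ := h
  choose ρ hρ hv hνρ using h1
  intro s hs
  rw [Measure.finsetSum_apply, Finset.sum_eq_zero]
  intro u _
  have : ν u = fun i => den (ρ u i) := funext fun i => hνρ u i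
  rw [this, pi_den (hρ u) fun i => (hρ u i).integrable (hv u i)]
  exact withDensity_absolutelyContinuous _ _ hs

/-- Uniform absolute continuity. -/
lemma Fam.measure_le {n : ℕ} {μ : Measure (Fin n → ℝ)} {z : ℝ} (h : Fam μ z)
    (hμ : μ univ = 1) {L : ℝ} (hL : 0 < L) (s : Set (Fin n → ℝ)) (hs : MeasurableSet s) :
    μ s ≤ ENNReal.ofReal (L ^ n) * volume s + ENNReal.ofReal (n * z / L) := by
  obtain ⟨ι, _, ν, v, h1, rfl, h3⟩ := h
  have hfin : ∀ u i, IsFiniteMeasure (ν u i) := fun u i => (h1 u i).isFiniteMeasure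
  choose ρ hρ hv hνρ using h1
  have hint : ∀ u i, Integrable (ρ u i) := fun u i => (hρ u i).integrable (hv u i)
  have hv0 : ∀ u i, 0 ≤ v u i := fun u i => (hv u i).nonneg
  set c : ι → ℝ := fun u => ∏ j, (ν u j).real univ with hc
  have hc0 : ∀ u, 0 ≤ c u := fun u => Finset.prod_nonneg fun j _ => measureReal_nonneg
  have hpu : ∀ u, Measure.pi (ν u) univ = ENNReal.ofReal (c u) := by
    intro u
    rw [Measure.pi_univ, hc, ENNReal.ofReal_prod_of_nonneg fun i _ => measureReal_nonneg]
    exact Finset.prod_congr rfl fun i _ => (ENNReal.ofReal_toReal (measure_ne_top _ _)).symm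
  have hcsum : ∑ u, c u = 1 := by
    rw [Measure.finsetSum_apply, Finset.sum_congr rfl fun u _ => hpu u,
      ← ENNReal.ofReal_sum_of_nonneg fun u _ => hc0 u] at hμ
    exact (ENNReal.ofReal_eq_one).1 hμ
  set d : ι → ℝ := fun u => ∑ i, v u i * ∏ j ∈ Finset.univ.erase i, (ν u j).real univ with hd
  have hd0 : ∀ u i, 0 ≤ v u i * ∏ j ∈ Finset.univ.erase i, (ν u j).real univ := fun u i =>
    mul_nonneg (hv0 u i) (Finset.prod_nonneg fun j _ => measureReal_nonneg)
  have hdsum : ∑ u, d u ≤ n * z := by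
    rw [hd, Finset.sum_comm]
    calc _ ≤ ∑ _i : Fin n, z := Finset.sum_le_sum fun i _ => h3 i
      _ = _ := by simp
  have key : ∀ u, Measure.pi (ν u) s ≤ ENNReal.ofReal (L ^ n * c u) * volume s +
      ENNReal.ofReal (d u / L) := by
    intro u
    -- A summand whose factors all have variation at most `L` times their mass has density at most
    -- `L ^ n * c u`. Any other summand has mass below `d u / L`, and these masses add up to at most
    -- `n * z / L`.
    by_cases hu : ∀ i, v u i ≤ L * (ν u i).real univ
    · refine le_trans ?_ le_self_add
      have : ν u = fun i => den (ρ u i) := funext fun i => hνρ u i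
      rw [this, pi_den (hρ u) (hint u), withDensity_apply _ hs, ← setLIntegral_const]
      refine lintegral_mono fun x => ENNReal.ofReal_le_ofReal ?_
      calc ∏ i, ρ u i (x i) ≤ ∏ i, (L * (ν u i).real univ) :=
            Finset.prod_le_prod (fun i _ => (hρ u i).nonneg _)
              fun i _ => ((hρ u i).le_of_varLE (hv u i) _).trans (hu i)
        _ = L ^ n * c u := by rw [Finset.prod_mul_distrib, hc]; simp
    · push Not at hu
      obtain ⟨i, hi⟩ := hu
      refine le_trans ?_ le_add_self
      refine (measure_mono (subset_univ s)).trans ?_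
      rw [hpu u]
      apply ENNReal.ofReal_le_ofReal
      rw [le_div_iff₀ hL]
      refine le_trans ?_ (Finset.single_le_sum (fun i _ => hd0 u i) (Finset.mem_univ i))
      rw [hc]
      dsimp only
      rw [← Finset.mul_prod_erase Finset.univ _ (Finset.mem_univ i), mul_right_comm, mul_comm _ L]
      exact mul_le_mul_of_nonneg_right hi.le (Finset.prod_nonneg fun j _ => measureReal_nonneg)
  rw [Measure.finsetSum_apply]
  refine (Finset.sum_le_sum fun u _ => key u).trans ?_
  rw [Finset.sum_add_distrib, ← Finset.sum_mul,
    ← ENNReal.ofReal_sum_of_nonneg fun u _ => mul_nonneg (by positivity) (hc0 u),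
    ← ENNReal.ofReal_sum_of_nonneg fun u _ => div_nonneg (Finset.sum_nonneg fun i _ => hd0 u i)
      hL.le, ← Finset.mul_sum, hcsum, mul_one, ← Finset.sum_div]
  gcongr

/-! ### Boxes on which a piece of the family has a large density -/

/-- If `ρ` fell below half its integral `m` somewhere in each of the `K` subintervals, it would be
at most `m / 2` plus the increment of `G` on each. Summing the integrals gives `m ≤ m / 2 + V m /
K`, which is less than `m` by the choice of `K`. -/
lemma exists_interval_le {ρ G : ℝ → ℝ} (hρ : IsDensity ρ) (hG : Majorant ρ G) {V : ℝ}
    (hm : 0 < ∫ t, ρ t) (hv : ∀ s t, G t - G s ≤ V * ∫ t, ρ t) {K : ℕ} (hK : 2 * V < K)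
    (hK0 : 0 < K) :
    ∃ k < K, ∀ t ∈ Ioo ((k : ℝ) / K) ((k + 1) / K), (∫ t, ρ t) / 2 ≤ ρ t := by
  have hi : Integrable ρ := hρ.integrable ⟨G, hG, hv⟩
  set m := ∫ t, ρ t with hmdef
  have hKr : (0 : ℝ) < K := by exact_mod_cast hK0
  by_contra! hcon
  have hx : ∀ k : ℕ, (k : ℝ) / K ≤ ((k + 1 : ℕ) : ℝ) / K := fun k => by
    gcongr
    linarith
  have h1 : ∀ k < K, ∫ t in ((k : ℝ) / K)..(((k + 1 : ℕ) : ℝ) / K), ρ t ≤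
      1 / K * (m / 2 + (G (((k + 1 : ℕ) : ℝ) / K) - G ((k : ℝ) / K))) := by
    intro k hk
    obtain ⟨t, ht, htm⟩ := hcon k hk
    have h2 : ∀ s ∈ Icc ((k : ℝ) / K) (((k + 1 : ℕ) : ℝ) / K),
        ρ s ≤ m / 2 + (G (((k + 1 : ℕ) : ℝ) / K) - G ((k : ℝ) / K)) := by
      intro s hs
      have a1 := hG.1 hs.1
      have a2 := hG.1 hs.2
      have a3 := hG.1 ht.1.le
      have a4 : G t ≤ G (((k + 1 : ℕ) : ℝ) / K) := hG.1 (by push_cast; exact ht.2.le)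
      rcases le_total s t with h | h
      · linarith [hG.2 s t h, neg_abs_le (ρ t - ρ s)]
      · linarith [hG.2 t s h, le_abs_self (ρ s - ρ t)]
    have h3 := intervalIntegral.integral_mono_on (hx k) hi.intervalIntegrable
      intervalIntegrable_const h2
    rw [intervalIntegral.integral_const, smul_eq_mul] at h3
    have h4 : ((k + 1 : ℕ) : ℝ) / K - (k : ℝ) / K = 1 / K := by push_cast; ring
    rwa [h4] at h3
  have h2 : ∑ k ∈ Finset.range K, ∫ t in ((k : ℝ) / K)..(((k + 1 : ℕ) : ℝ) / K), ρ t = m := by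
    rw [intervalIntegral.sum_integral_adjacent_intervals (a := fun k : ℕ => (k : ℝ) / K)
      fun k _ => hi.intervalIntegrable]
    rw [Nat.cast_zero, zero_div, div_self hKr.ne', intervalIntegral.integral_of_le zero_le_one,
      ← integral_Icc_eq_integral_Ioc, setIntegral_eq_integral_of_forall_compl_eq_zero hρ.supp]
  have h3 : m ≤ ∑ k ∈ Finset.range K,
      1 / K * (m / 2 + (G (((k + 1 : ℕ) : ℝ) / K) - G ((k : ℝ) / K))) := by
    rw [← h2]
    exact Finset.sum_le_sum fun k hk => h2.symm ▸ h1 k (Finset.mem_range.1 hk)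
  rw [← Finset.mul_sum, Finset.sum_add_distrib,
    Finset.sum_range_sub (fun k : ℕ => G ((k : ℝ) / K))] at h3
  simp only [Finset.sum_const, Finset.card_range, nsmul_eq_mul] at h3
  have h4 := hv (((0 : ℕ) : ℝ) / K) ((K : ℝ) / K)
  have h5 : 1 / (K : ℝ) * (K * (m / 2) + (G ((K : ℝ) / K) - G (((0 : ℕ) : ℝ) / K))) ≤
      m / 2 + V * m / K := by
    rw [mul_add, ← mul_assoc, one_div_mul_cancel hKr.ne', one_mul, one_div, inv_mul_eq_div]
    gcongr
  have h6 : V * m / K < m / 2 := by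
    rw [div_lt_div_iff₀ hKr two_pos]
    nlinarith
  linarith

/-- The open boxes of the uniform grid of mesh `1 / K`. -/
def gridBox {n : ℕ} (K : ℕ) (k : Fin n → ℕ) : Set (Fin n → ℝ) :=
  univ.pi fun i => Ioo ((k i : ℝ) / K) ((k i + 1) / K)

lemma measurableSet_gridBox {n : ℕ} (K : ℕ) (k : Fin n → ℕ) : MeasurableSet (gridBox K k) :=
  MeasurableSet.univ_pi fun _ => measurableSet_Ioo

/-- By averaging, some summand has both a share of the mass of `E` and variations in all directions
that are not much larger than its weight `c` allows. Each of its factors is then at least half its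
mass on some subinterval of length `1 / K`, so the product density is at least `c / 2 ^ n` on a grid
box. A small mass of `E` thus forces a small volume of `E` in that box. -/
lemma Fam.exists_gridBox {n : ℕ} (hn : 1 ≤ n) {μ : Measure (Fin n → ℝ)} {z : ℝ} (h : Fam μ z)
    (hμ : μ univ = 1) {ε : ℝ} (hε : 0 < ε) {E : Set (Fin n → ℝ)} (hE : MeasurableSet E)
    (hμE : μ E ≤ ENNReal.ofReal ε) {K : ℕ} (hK : 2 * ((n + 1) * z) < K) :
    ∃ k : Fin n → Fin K, volume (gridBox K (fun i => (k i : ℕ)) ∩ E) ≤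
      ENNReal.ofReal (2 ^ n * ((n + 1) * ε)) := by
  have hz : 1 ≤ z := by
    have := h.real_univ_le hn
    rwa [Measure.real, hμ, ENNReal.toReal_one] at this
  have hK0 : 0 < K := by
    have : (0 : ℝ) < K := lt_of_le_of_lt (by positivity) hK
    exact_mod_cast this
  obtain ⟨ι, _, ν, v, h1, rfl, h3⟩ := h
  have hfin : ∀ u i, IsFiniteMeasure (ν u i) := fun u i => (h1 u i).isFiniteMeasure
  choose ρ hρ hv hνρ using h1
  have hint : ∀ u i, Integrable (ρ u i) := fun u i => (hρ u i).integrable (hv u i)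
  have hv0 : ∀ u i, 0 ≤ v u i := fun u i => (hv u i).nonneg
  set c : ι → ℝ := fun u => ∏ j, (ν u j).real univ with hc
  have hc0 : ∀ u, 0 ≤ c u := fun u => Finset.prod_nonneg fun j _ => measureReal_nonneg
  have hpu : ∀ u, Measure.pi (ν u) univ = ENNReal.ofReal (c u) := by
    intro u
    rw [Measure.pi_univ, hc, ENNReal.ofReal_prod_of_nonneg fun i _ => measureReal_nonneg]
    exact Finset.prod_congr rfl fun i _ => (ENNReal.ofReal_toReal (measure_ne_top _ _)).symm
  have hcsum : ∑ u, c u = 1 := by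
    rw [Measure.finsetSum_apply, Finset.sum_congr rfl fun u _ => hpu u,
      ← ENNReal.ofReal_sum_of_nonneg fun u _ => hc0 u] at hμ
    exact (ENNReal.ofReal_eq_one).1 hμ
  set d : ι → Fin n → ℝ := fun u i => v u i * ∏ j ∈ Finset.univ.erase i, (ν u j).real univ with hd
  have hd0 : ∀ u i, 0 ≤ d u i := fun u i =>
    mul_nonneg (hv0 u i) (Finset.prod_nonneg fun j _ => measureReal_nonneg)
  set a : ι → ℝ := fun u => (Measure.pi (ν u)).real E with ha
  have ha0 : ∀ u, 0 ≤ a u := fun u => measureReal_nonneg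
  have hasum : ∑ u, a u ≤ ε := by
    rw [Measure.finsetSum_apply] at hμE
    have : ∑ u, Measure.pi (ν u) E = ENNReal.ofReal (∑ u, a u) := by
      rw [ENNReal.ofReal_sum_of_nonneg fun u _ => ha0 u]
      exact Finset.sum_congr rfl fun u _ => (ENNReal.ofReal_toReal (measure_ne_top _ _)).symm
    rw [this] at hμE
    exact (ENNReal.ofReal_le_ofReal_iff hε.le).1 hμE
  have hz0 : 0 < z := by linarith
  -- The sums over all summands are at most `1` for `a u / ε` and at most `1` for `d u i / z` in
  -- each of the `n` directions, while the weights `c u` sum to `1`. This is the origin of the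
  -- factor `n + 1`.
  obtain ⟨u, hcu, hu⟩ : ∃ u, 0 < c u ∧ a u / ε + ∑ i, d u i / z ≤ (n + 1) * c u := by
    by_contra! hcon
    have hpos : 0 < ∑ u, (a u / ε + ∑ i, d u i / z - (n + 1) * c u) := by
      apply Finset.sum_pos'
      · intro u _
        rcases (hc0 u).eq_or_lt with h | h
        · rw [← h, mul_zero, sub_zero]
          exact add_nonneg (div_nonneg (ha0 u) hε.le)
            (Finset.sum_nonneg fun i _ => div_nonneg (hd0 u i) hz0.le)
        · linarith [hcon u h]
      · obtain ⟨u, hu, hu'⟩ : ∃ u ∈ Finset.univ, 0 < c u := by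
          by_contra! hh
          have : ∑ u, c u ≤ 0 := Finset.sum_nonpos hh
          linarith
        exact ⟨u, hu, by linarith [hcon u hu']⟩
    rw [Finset.sum_sub_distrib, Finset.sum_add_distrib, ← Finset.mul_sum, hcsum,
      ← Finset.sum_div, Finset.sum_comm] at hpos
    have e1 : (∑ u, a u) / ε ≤ 1 := (div_le_one hε).2 hasum
    have e2 : ∑ i, ∑ u, d u i / z ≤ n := by
      calc ∑ i, ∑ u, d u i / z ≤ ∑ _i : Fin n, (1 : ℝ) := by
            refine Finset.sum_le_sum fun i _ => ?_
            rw [← Finset.sum_div]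
            exact (div_le_one hz0).2 (h3 i)
        _ = n := by simp
    linarith
  have hau : a u ≤ (n + 1) * ε * c u := by
    have : a u / ε ≤ (n + 1) * c u := by
      have : 0 ≤ ∑ i, d u i / z := Finset.sum_nonneg fun i _ => div_nonneg (hd0 u i) hz0.le
      linarith
    rw [div_le_iff₀ hε] at this
    linarith
  have hm : ∀ i, 0 < (ν u i).real univ := by
    intro i
    refine lt_of_le_of_ne measureReal_nonneg fun hh => ?_
    exact hcu.ne' (Finset.prod_eq_zero (Finset.mem_univ i) hh.symm)
  have hmρ : ∀ i, (ν u i).real univ = ∫ t, ρ u i t := fun i => by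
    rw [hνρ u i, den_real_univ (hρ u i) (hint u i)]
  have hvu : ∀ i, v u i ≤ (n + 1) * z * ∫ t, ρ u i t := by
    intro i
    have h4 : d u i / z ≤ (n + 1) * c u := by
      have h5 : d u i / z ≤ ∑ i, d u i / z :=
        Finset.single_le_sum (f := fun i => d u i / z) (fun i _ => div_nonneg (hd0 u i) hz0.le)
          (Finset.mem_univ i)
      have h6 : 0 ≤ a u / ε := div_nonneg (ha0 u) hε.le
      linarith
    rw [div_le_iff₀ hz0] at h4
    have h5 : c u = (ν u i).real univ * ∏ j ∈ Finset.univ.erase i, (ν u j).real univ :=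
      (Finset.mul_prod_erase Finset.univ _ (Finset.mem_univ i)).symm
    have h6 : 0 < ∏ j ∈ Finset.univ.erase i, (ν u j).real univ :=
      Finset.prod_pos fun j _ => hm j
    rw [h5] at h4
    rw [← hmρ]
    refine le_of_mul_le_mul_right ?_ h6
    calc _ ≤ _ := h4
      _ = _ := by ring
  have hk : ∀ i, ∃ k < K, ∀ t ∈ Ioo ((k : ℝ) / K) ((k + 1) / K), (∫ t, ρ u i t) / 2 ≤ ρ u i t := by
    intro i
    obtain ⟨G, hG, hGv⟩ := hv u i
    exact exists_interval_le (hρ u i) hG (by rw [← hmρ]; exact hm i)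
      (fun s t => (hGv s t).trans (hvu i)) hK hK0
  choose k hkK hkρ using hk
  refine ⟨fun i => ⟨k i, hkK i⟩, ?_⟩
  have hU : MeasurableSet (gridBox K k ∩ E) := (measurableSet_gridBox K k).inter hE
  have h5 : ENNReal.ofReal (c u / 2 ^ n) * volume (gridBox K k ∩ E) ≤ ENNReal.ofReal (a u) := by
    have e1 : ENNReal.ofReal (a u) = Measure.pi (ν u) E := ENNReal.ofReal_toReal (measure_ne_top _ _)
    have e2 : ν u = fun i => den (ρ u i) := funext fun i => hνρ u i
    rw [e1]
    refine le_trans ?_ (measure_mono (inter_subset_right (s := gridBox K k)))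
    rw [e2, pi_den (hρ u) (hint u), withDensity_apply _ hU, ← setLIntegral_const]
    refine setLIntegral_mono' hU fun x hx => ENNReal.ofReal_le_ofReal ?_
    calc c u / 2 ^ n = ∏ i, (∫ t, ρ u i t) / 2 := by
          rw [Finset.prod_div_distrib, hc]
          simp [hmρ]
      _ ≤ ∏ i, ρ u i (x i) := Finset.prod_le_prod
          (fun i _ => div_nonneg (integral_nonneg (hρ u i).nonneg) two_pos.le)
          fun i _ => hkρ i _ (hx.1 i (mem_univ i))
  have h6 : volume (gridBox K k ∩ E) ≤ ENNReal.ofReal (2 ^ n / c u) * ENNReal.ofReal (a u) := by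
    have : ENNReal.ofReal (2 ^ n / c u) * ENNReal.ofReal (c u / 2 ^ n) = 1 := by
      rw [← ENNReal.ofReal_mul (by positivity), div_mul_div_cancel₀ hcu.ne',
        div_self (by positivity), ENNReal.ofReal_one]
    calc volume (gridBox K k ∩ E)
        = ENNReal.ofReal (2 ^ n / c u) *
          (ENNReal.ofReal (c u / 2 ^ n) * volume (gridBox K k ∩ E)) := by
          rw [← mul_assoc, this, one_mul]
      _ ≤ _ := by gcongr
  refine h6.trans ?_
  rw [← ENNReal.ofReal_mul (by positivity)]
  apply ENNReal.ofReal_le_ofReal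
  rw [div_mul_eq_mul_div, div_le_iff₀ hcu]
  calc 2 ^ n * a u ≤ 2 ^ n * ((n + 1) * ε * c u) := by gcongr
    _ = _ := by ring

/-! ### Geometry of rectangular partitions -/

/-- The inclusion of `I^n` in `ℝ^n`. -/
def emb {n : ℕ} (x : Cube n) : Fin n → ℝ := fun i => x i

lemma measurable_emb {n : ℕ} : Measurable (emb (n := n)) :=
  measurable_pi_lambda _ fun i => measurable_subtype_coe.comp (measurable_pi_apply i)

/-- The unit cube as a subset of `ℝ^n`. -/
def unitCube (n : ℕ) : Set (Fin n → ℝ) := univ.pi fun _ => Icc (0 : ℝ) 1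

lemma measurableSet_unitCube (n : ℕ) : MeasurableSet (unitCube n) :=
  MeasurableSet.univ_pi fun _ => measurableSet_Icc

lemma emb_mem {n : ℕ} (x : Cube n) : emb x ∈ unitCube n := fun i _ => (x i).2

lemma exists_emb_eq {n : ℕ} {y : Fin n → ℝ} (hy : y ∈ unitCube n) : ∃ x : Cube n, emb x = y :=
  ⟨fun i => ⟨y i, hy i (mem_univ i)⟩, rfl⟩

lemma emb_injective {n : ℕ} : Function.Injective (emb (n := n)) := by
  intro x y h
  ext i
  exact congrFun h i

lemma map_emb {n : ℕ} : (volume : Measure (Cube n)).map emb = volume.restrict (unitCube n) := by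
  have h : (volume : Measure (Fin n → ℝ)).restrict (unitCube n) =
      Measure.pi fun _ : Fin n => (volume : Measure ℝ).restrict (Icc 0 1) :=
    Measure.restrict_pi_pi _ _
  rw [h]
  exact (measurePreserving_pi (fun _ : Fin n => (volume : Measure unitInterval))
    (fun _ : Fin n => (volume : Measure ℝ).restrict (Icc 0 1))
    fun _ => unitInterval.measurePreserving_coe).map_eq

lemma volume_emb_preimage {n : ℕ} {S : Set (Fin n → ℝ)} (hS : MeasurableSet S)
    (hS1 : S ⊆ unitCube n) : volume (emb ⁻¹' S) = volume S := by
  rw [← Measure.map_apply measurable_emb hS, map_emb, Measure.restrict_apply hS,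
    inter_eq_left.2 hS1]

lemma measurableEmbedding_emb {n : ℕ} : MeasurableEmbedding (emb (n := n)) where
  injective := emb_injective
  measurable := measurable_emb
  measurableSet_image' := by
    intro s hs
    have hr : Measurable fun y : Fin n → ℝ =>
        (fun i => projIcc (0 : ℝ) 1 zero_le_one (y i) : Cube n) :=
      measurable_pi_lambda _ fun i => (continuous_projIcc.measurable).comp (measurable_pi_apply i)
    have : emb '' s = unitCube n ∩
        (fun y : Fin n → ℝ => (fun i => projIcc (0 : ℝ) 1 zero_le_one (y i) : Cube n)) ⁻¹' s := by
      ext y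
      constructor
      · rintro ⟨x, hx, rfl⟩
        refine ⟨emb_mem x, ?_⟩
        have : (fun i => projIcc (0 : ℝ) 1 zero_le_one (emb x i) : Cube n) = x := by
          ext i
          simp [emb]
        simpa [this]
      · rintro ⟨hy, hy'⟩
        refine ⟨_, hy', ?_⟩
        ext i
        simp only [emb]
        rw [projIcc_of_mem zero_le_one (hy i (mem_univ i))]
    rw [this]
    exact (measurableSet_unitCube n).inter (hr hs)

namespace Rect

variable {n : ℕ}

lemma openBox_eq (B : Rect n) : B.openBox = univ.pi fun i => Ioo (B.lo i) (B.hi i) := by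
  ext x
  exact ⟨fun h i _ => h i, fun h i => h i (mem_univ i)⟩

lemma measurableSet_openBox (B : Rect n) : MeasurableSet B.openBox := by
  rw [openBox_eq]
  exact MeasurableSet.univ_pi fun _ => measurableSet_Ioo

lemma openBox_subset (B : Rect n) : B.openBox ⊆ unitCube n := fun _ hx i _ =>
  ⟨(B.lo_nonneg i).trans (hx i).1.le, (hx i).2.le.trans (B.hi_le_one i)⟩

lemma mem_toSet_of_emb {B : Rect n} {x : Cube n} (h : emb x ∈ B.openBox) : x ∈ B.toSet :=
  fun i => ⟨(h i).1.le, Or.inl (h i).2⟩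

lemma volume_openBox (B : Rect n) : volume B.openBox = ENNReal.ofReal (∏ i, (B.hi i - B.lo i)) := by
  rw [openBox_eq, Real.volume_pi_Ioo,
    ENNReal.ofReal_prod_of_nonneg fun i _ => sub_nonneg.2 (B.lo_lt_hi i).le]

/-- The lower vertex as a point of the cube. -/
def corner (B : Rect n) : Cube n := fun i =>
  ⟨B.lo i, B.lo_nonneg i, (B.lo_lt_hi i).le.trans (B.hi_le_one i)⟩

lemma corner_mem (B : Rect n) : B.corner ∈ B.toSet := fun i => ⟨le_rfl, Or.inl (B.lo_lt_hi i)⟩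

lemma bounds_of_subset {B C : Rect n} (h : C.toSet ⊆ B.toSet) (i : Fin n) :
    B.lo i ≤ C.lo i ∧ C.hi i ≤ B.hi i := by
  refine ⟨(h C.corner_mem i).1, ?_⟩
  by_contra! hlt
  -- A value below `C.hi i ≤ 1` but at least `B.hi i`. The corner of `C` moved to this height lies
  -- in `C` but not in `B`; the exception for sides ending at `1` does not interfere, as `B.hi i <
  -- 1`.
  set t := max (C.lo i) (B.hi i) with ht
  have ht1 : t < C.hi i := max_lt (C.lo_lt_hi i) hlt
  have ht2 : C.lo i ≤ t := le_max_left _ _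
  have htI : t ∈ unitInterval := ⟨(C.lo_nonneg i).trans ht2, ht1.le.trans (C.hi_le_one i)⟩
  have hx : Function.update C.corner i ⟨t, htI⟩ ∈ C.toSet := by
    intro j
    by_cases hj : j = i
    · subst hj
      rw [Function.update_self]
      exact ⟨ht2, Or.inl ht1⟩
    · rw [Function.update_of_ne hj]
      exact C.corner_mem j
  have := (h hx i).2
  rw [Function.update_self] at this
  rcases this with h1 | h1
  · exact absurd h1 (not_lt.2 (le_max_right _ _))
  · linarith [C.hi_le_one i]

end Rect

namespace RectPartition

variable {n : ℕ}

lemma disjoint_openBox (P : RectPartition n) {B C : Rect n} (hB : B ∈ P.parts) (hC : C ∈ P.parts)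
    (hBC : B ≠ C) : Disjoint B.openBox C.openBox := by
  rw [Set.disjoint_left]
  intro y hyB hyC
  obtain ⟨x, rfl⟩ := exists_emb_eq (B.openBox_subset hyB)
  exact hBC ((P.partition x).unique ⟨hB, Rect.mem_toSet_of_emb hyB⟩
    ⟨hC, Rect.mem_toSet_of_emb hyC⟩)

lemma ae_mem_openBox (P : RectPartition n) :
    ∀ᵐ x : Cube n, ∃ B ∈ P.parts, emb x ∈ B.openBox := by
  have h : ∀ B ∈ P.parts, ∀ᵐ x : Cube n, ∀ i, (x i : ℝ) ≠ B.lo i ∧ (x i : ℝ) ≠ B.hi i := by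
    intro B _
    rw [ae_all_iff]
    intro i
    have key : ∀ c : ℝ, ∀ᵐ x : Cube n, (x i : ℝ) ≠ c := by
      intro c
      by_cases hc : c ∈ unitInterval
      · filter_upwards [Measure.ae_eval_ne (μ := fun _ : Fin n => (volume : Measure unitInterval))
          i ⟨c, hc⟩] with x hx hxc
        exact hx (Subtype.ext hxc)
      · exact ae_of_all _ fun x hx => hc (hx ▸ (x i).2)
    exact (key _).and (key _)
  have h' := (ae_ball_iff P.parts.countable_toSet).2 h
  filter_upwards [h'] with x hx
  obtain ⟨B, ⟨hB, hxB⟩, -⟩ := P.partition x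
  refine ⟨B, hB, fun i => ⟨lt_of_le_of_ne (hxB i).1 (hx B hB i).1.symm, ?_⟩⟩
  rcases (hxB i).2 with h1 | h1
  · exact h1
  · exact lt_of_le_of_ne (h1 ▸ (x i).2.2) (hx B hB i).2

lemma unitCube_ae_mem (P : RectPartition n) :
    ∀ᵐ y ∂(volume.restrict (unitCube n)), ∃ B ∈ P.parts, y ∈ B.openBox := by
  rw [← map_emb, measurableEmbedding_emb.ae_map_iff]
  exact P.ae_mem_openBox

lemma volume_eq_sum (P : RectPartition n) {S : Set (Fin n → ℝ)} (hS : MeasurableSet S)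
    (hS1 : S ⊆ unitCube n) : volume S = ∑ B ∈ P.parts, volume (S ∩ B.openBox) := by
  rw [← measure_biUnion_finset]
  · rw [← inter_iUnion₂]
    have h1 := P.unitCube_ae_mem
    rw [ae_restrict_iff' (measurableSet_unitCube n)] at h1
    apply measure_congr
    filter_upwards [h1] with y hy
    apply propext
    constructor
    · intro hyS
      obtain ⟨B, hB, hyB⟩ := hy (hS1 hyS)
      exact ⟨hyS, mem_iUnion₂.2 ⟨B, hB, hyB⟩⟩
    · exact fun h => h.1
  · intro B hB C hC hBC
    exact (P.disjoint_openBox hB hC hBC).mono inter_subset_right inter_subset_right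
  · exact fun B _ => hS.inter B.measurableSet_openBox

lemma volume_unitCube : volume (unitCube n) = 1 := by
  rw [unitCube, volume_pi_pi]
  simp

lemma sum_volume (P : RectPartition n) : ∑ B ∈ P.parts, ∏ i, (B.hi i - B.lo i) = 1 := by
  have h := P.volume_eq_sum (measurableSet_unitCube n) le_rfl
  rw [volume_unitCube] at h
  have h2 : ∀ B ∈ P.parts, volume (unitCube n ∩ B.openBox) =
      ENNReal.ofReal (∏ i, (B.hi i - B.lo i)) := fun B _ => by
    rw [inter_eq_right.2 B.openBox_subset, B.volume_openBox]
  rw [Finset.sum_congr rfl h2, ← ENNReal.ofReal_sum_of_nonneg fun B _ =>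
    Finset.prod_nonneg fun i _ => sub_nonneg.2 (B.lo_lt_hi i).le] at h
  exact ENNReal.ofReal_eq_one.1 h.symm

lemma parts_nonempty (P : RectPartition n) : P.parts.Nonempty := by
  obtain ⟨B, ⟨hB, -⟩, -⟩ := P.partition fun _ => 0
  exact ⟨B, hB⟩

end RectPartition

/-! ### Branches of Jabłoński maps -/

namespace JablonskiMap

variable {n : ℕ}

/-- The rectangle of the partition of `f` that contains `C`. -/
def host (f : JablonskiMap n) (C : Rect n) : Rect n := by
  classical
  exact if h : ∃ B ∈ f.part.parts, C.toSet ⊆ B.toSet then h.choose else C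

lemma host_spec {f : JablonskiMap n} {C : Rect n} (h : ∃ B ∈ f.part.parts, C.toSet ⊆ B.toSet) :
    f.host C ∈ f.part.parts ∧ C.toSet ⊆ (f.host C).toSet := by
  rw [host, dif_pos h]
  exact h.choose_spec

/-- The `i`-th component of `f` on `C`. -/
def br (f : JablonskiMap n) (C : Rect n) (i : Fin n) (t : ℝ) : ℝ := by
  classical
  exact if t ∈ Icc (C.lo i) (C.hi i) then f.comp (f.host C) i t else 0

/-- The reciprocal of the absolute value of the derivative of the `i`-th component of `f` on `C`,
extended as a constant on both sides. -/
def slope (f : JablonskiMap n) (C : Rect n) (i : Fin n) (t : ℝ) : ℝ :=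
  1 / |derivWithin (f.comp (f.host C) i) (Icc ((f.host C).lo i) ((f.host C).hi i))
    (max (C.lo i) (min (C.hi i) t))|

lemma toFun_eq_br {f : JablonskiMap n} {C : Rect n}
    (h : ∃ B ∈ f.part.parts, C.toSet ⊆ B.toSet) {x : Cube n} (hx : x ∈ C.toSet) (i : Fin n) :
    (f.toFun x i : ℝ) = f.br C i (x i) := by
  obtain ⟨h1, h2⟩ := host_spec h
  rw [br, if_pos, f.toFun_eq _ h1 x (h2 hx) i]
  refine ⟨(hx i).1, ?_⟩
  rcases (hx i).2 with h3 | h3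
  · exact h3.le
  · rw [h3]; exact (x i).2.2

lemma expansion_le {f : JablonskiMap n} {B : Rect n} (hB : B ∈ f.part.parts) (i : Fin n) {t : ℝ}
    (ht : t ∈ Icc (B.lo i) (B.hi i)) :
    f.expansion i ≤ |derivWithin (f.comp B i) (Icc (B.lo i) (B.hi i)) t| := by
  refine ciInf_le (f := fun p : {p : Rect n × ℝ // p.1 ∈ f.part.parts ∧
    p.2 ∈ Icc (p.1.lo i) (p.1.hi i)} => |derivWithin (f.comp p.1.1 i)
      (Icc (p.1.1.lo i) (p.1.1.hi i)) p.1.2|) ?_ ⟨(B, t), hB, ht⟩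
  exact ⟨0, by rintro _ ⟨p, rfl⟩; exact abs_nonneg _⟩

/-- Regularity of all the branches on subrectangles. -/
lemma exists_branch {f : JablonskiMap n} (hf : f.IsC2Monotone) {C : Rect n}
    (h : ∃ B ∈ f.part.parts, C.toSet ⊆ B.toSet) (i : Fin n) (hγ : 0 < f.expansion i) :
    IsBranch (C.lo i) (C.hi i) (f.br C i) (f.slope C i) ∧
    (∀ t, f.slope C i t ≤ 1 / f.expansion i) ∧ (∀ t, 0 < f.slope C i t) ∧
    ∃ H, 0 ≤ H ∧ ∀ s t, |f.slope C i t - f.slope C i s| ≤ H * |t - s| := by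
  obtain ⟨h1, h2⟩ := host_spec h
  set B := f.host C with hB
  obtain ⟨hb1, hb2⟩ := Rect.bounds_of_subset h2 i
  have hCB : Icc (C.lo i) (C.hi i) ⊆ Icc (B.lo i) (B.hi i) := Icc_subset_Icc hb1 hb2
  obtain ⟨hC2, hmono⟩ := hf B h1 i
  set φ := f.comp B i with hφ
  set s := Icc (B.lo i) (B.hi i) with hs
  have hsu : UniqueDiffOn ℝ s := uniqueDiffOn_Icc (B.lo_lt_hi i)
  have hd1 : ContDiffOn ℝ 1 (derivWithin φ s) s := hC2.derivWithin hsu (by norm_num)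
  set pr : ℝ → ℝ := fun t => max (C.lo i) (min (C.hi i) t) with hpr
  have hprm : ∀ t, pr t ∈ Icc (C.lo i) (C.hi i) := fun t =>
    ⟨le_max_left _ _, max_le (C.lo_lt_hi i).le (min_le_left _ _)⟩
  have hpr_eq : ∀ t ∈ Icc (C.lo i) (C.hi i), pr t = t := fun t ht => by
    simp only [hpr]
    rw [min_eq_right ht.2, max_eq_right ht.1]
  have hprc : Continuous pr := by fun_prop
  have hslope : ∀ t, f.slope C i t = 1 / |derivWithin φ s (pr t)| := fun t => rfl
  have hge : ∀ t, f.expansion i ≤ |derivWithin φ s (pr t)| := fun t =>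
    expansion_le h1 i (hCB (hprm t))
  have hbr : ∀ t ∈ Icc (C.lo i) (C.hi i), f.br C i t = φ t := fun t ht => by
    rw [br, if_pos ht]
  have hcont : Continuous (f.slope C i) := by
    have : Continuous fun t => derivWithin φ s (pr t) :=
      hd1.continuousOn.comp_continuous hprc fun t => hCB (hprm t)
    have h3 : f.slope C i = fun t => 1 / |derivWithin φ s (pr t)| := rfl
    rw [h3]
    refine continuous_const.div this.abs fun t => ?_
    linarith [hge t]
  refine ⟨⟨C.lo_lt_hi i, C.lo_nonneg i, C.hi_le_one i, ?_, ?_, ?_, hcont.measurable, ?_, ?_⟩,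
    ?_, ?_, ?_⟩
  · rcases hmono with hm | hm
    · exact Or.inl ((hm.mono hCB).congr fun t ht => (hbr t ht).symm)
    · exact Or.inr ((hm.mono hCB).congr fun t ht => (hbr t ht).symm)
  · intro t ht
    rw [hbr t ht]
    exact f.comp_mapsTo B h1 i (hCB ht)
  · have : f.br C i = (Icc (C.lo i) (C.hi i)).piecewise φ 0 := by
      ext t
      by_cases ht : t ∈ Icc (C.lo i) (C.hi i)
      · rw [hbr t ht, piecewise_eq_of_mem _ _ _ ht]
      · rw [br, if_neg ht, piecewise_eq_of_notMem _ _ _ ht]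
        rfl
    rw [this]
    exact ContinuousOn.measurable_piecewise (hC2.continuousOn.mono hCB) continuousOn_const
      measurableSet_Icc
  · refine ⟨derivWithin φ s, fun t ht => ⟨?_, ?_⟩⟩
    · have : HasDerivWithinAt φ (derivWithin φ s t) s t :=
        ((hC2.differentiableOn (by norm_num)) t (hCB ht)).hasDerivWithinAt
      exact (this.mono hCB).congr hbr (hbr t ht)
    · have h3 := hge t
      rw [hslope, hpr_eq t ht, one_div_mul_cancel]
      rw [hpr_eq t ht] at h3
      linarith
  · intro t
    rw [hslope]
    positivity
  · intro t
    rw [hslope]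
    exact one_div_le_one_div_of_le hγ (hge t)
  · intro t
    rw [hslope]
    exact one_div_pos.2 (lt_of_lt_of_le hγ (hge t))
  · have hd2 : ContinuousOn (derivWithin (derivWithin φ s) s) s :=
      hd1.continuousOn_derivWithin hsu le_rfl
    obtain ⟨M, hM⟩ := isCompact_Icc.exists_bound_of_continuousOn hd2
    have hlip : LipschitzOnWith (Real.toNNReal M) (derivWithin φ s) s := by
      refine (convex_Icc _ _).lipschitzOnWith_of_nnnorm_derivWithin_le
        (hd1.differentiableOn (by norm_num)) fun x hx => ?_
      rw [← NNReal.coe_le_coe, coe_nnnorm]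
      exact (hM x hx).trans (Real.le_coe_toNNReal M)
    have hprl : ∀ u v, |pr u - pr v| ≤ |u - v| := fun u v => by
      have e1 := abs_max_sub_max_le_max (C.lo i) (min (C.hi i) u) (C.lo i) (min (C.hi i) v)
      have e2 := abs_min_sub_min_le_max (C.hi i) u (C.hi i) v
      rw [sub_self, abs_zero] at e1 e2
      exact e1.trans (max_le (abs_nonneg _) (e2.trans (max_le (abs_nonneg _) le_rfl)))
    -- The difference of the reciprocals of `x` and `y` is `(y - x) / (x y)`. The numerator is
    -- controlled by the bound `M` for the second derivative, and the denominator by the square of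
    -- the expansion.
    refine ⟨Real.toNNReal M / f.expansion i ^ 2, by positivity, fun u v => ?_⟩
    have e1 := hge u
    have e2 := hge v
    have e3 := hlip.dist_le_mul _ (hCB (hprm v)) _ (hCB (hprm u))
    rw [Real.dist_eq, Real.dist_eq] at e3
    rw [hslope, hslope, div_sub_div _ _ (by linarith) (by linarith), one_mul, mul_one, abs_div,
      abs_mul, abs_abs, abs_abs, div_mul_eq_mul_div]
    apply div_le_div₀ (by positivity) _ (by positivity)
    · rw [sq]
      exact mul_le_mul e2 e1 hγ.le (abs_nonneg _)
    · rw [abs_sub_comm]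
      exact (abs_abs_sub_abs_le_abs_sub _ _).trans (e3.trans
        (mul_le_mul_of_nonneg_left (hprl v u) (NNReal.coe_nonneg _)))

end JablonskiMap

/-! ### The cocycle over the skew product -/

section Cocycle

variable {Ω : Type*} {n : ℕ} {σ : Ω → Ω} {f : Ω → JablonskiMap n}

/-- The composition of `f_ω, f_{σω}, …, f_{σ^{t-1}ω}`. -/
def cyc (σ : Ω → Ω) (f : Ω → JablonskiMap n) (t : ℕ) (ω : Ω) (x : Cube n) : Cube n :=
  ((skewProduct σ f)^[t] (ω, x)).2

lemma iterate_skewProduct (t : ℕ) (ω : Ω) (x : Cube n) :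
    (skewProduct σ f)^[t] (ω, x) = (σ^[t] ω, cyc σ f t ω x) := by
  have h : ∀ t (p : Ω × Cube n), ((skewProduct σ f)^[t] p).1 = σ^[t] p.1 := by
    intro t
    induction t with
    | zero => intro p; rfl
    | succ t ih => intro p; rw [Function.iterate_succ_apply, ih]; rfl
  exact Prod.ext (h t _) rfl

lemma cyc_succ (t : ℕ) (ω : Ω) (x : Cube n) :
    cyc σ f (t + 1) ω x = cyc σ f t (σ ω) ((f ω).toFun x) := rfl

lemma cyc_add (s t : ℕ) (ω : Ω) (x : Cube n) :
    cyc σ f (s + t) ω x = cyc σ f s (σ^[t] ω) (cyc σ f t ω x) := by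
  rw [cyc, Function.iterate_add_apply, iterate_skewProduct, iterate_skewProduct]

lemma measurable_cyc [MeasurableSpace Ω] (hF : Measurable (skewProduct σ f)) (t : ℕ) (ω : Ω) :
    Measurable (cyc σ f t ω) :=
  measurable_snd.comp ((hF.iterate t).comp measurable_prodMk_left)

lemma quasiMeasurePreserving_cyc
    (hns : ∀ ω, Measure.QuasiMeasurePreserving (f ω).toFun volume volume) (t : ℕ) (ω : Ω) :
    Measure.QuasiMeasurePreserving (cyc σ f t ω) volume volume := by
  induction t generalizing ω with
  | zero => exact Measure.QuasiMeasurePreserving.id volume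
  | succ t ih => exact (ih (σ ω)).comp (hns ω)

/-! ### Cylinders -/

/-- The `i`-th side of the cylinder of the path `W`. -/
def side (σ : Ω → Ω) (f : Ω → JablonskiMap n) (N : ℕ) (ω : Ω) (W : ℕ → Rect n) (i : Fin n) :
    Set ℝ :=
  cyl (fun k => (W k).lo i) (fun k => (W k).hi i) (fun k => (f (σ^[k] ω)).br (W k) i) N

/-- The `i`-th component of the cocycle on the cylinder of the path `W`. -/
def pathMap (σ : Ω → Ω) (f : Ω → JablonskiMap n) (N : ℕ) (ω : Ω) (W : ℕ → Rect n) (i : Fin n) :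
    ℝ → ℝ :=
  iter (fun k => (f (σ^[k] ω)).br (W k) i) N

/-- On a rectangle of `Q` each coordinate of the image depends on that coordinate alone. Hence the
points with a prescribed itinerary form a product of one-dimensional cylinders. -/
lemma mem_cylinder_iff {Q : RectPartition n} (hQ : ∀ ω, Q.Refines (f ω).part) (N : ℕ) :
    ∀ (ω : Ω) (W : ℕ → Rect n) (_ : ∀ k, W k ∈ Q.parts) (x : Cube n),
      (∀ k < N, emb (cyc σ f k ω x) ∈ (W k).openBox) ↔
        emb x ∈ univ.pi (side σ f N ω W) := by
  induction N with
  | zero => intro ω W _ x; simp [side, cyl, Set.mem_pi]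
  | succ N ih =>
    intro ω W hW x
    have h1 : (∀ k < N + 1, emb (cyc σ f k ω x) ∈ (W k).openBox) ↔
        emb x ∈ (W 0).openBox ∧
          ∀ k < N, emb (cyc σ f k (σ ω) ((f ω).toFun x)) ∈ (W (k + 1)).openBox := by
      constructor
      · exact fun h => ⟨h 0 (by omega), fun k hk => h (k + 1) (by omega)⟩
      · rintro ⟨h0, h⟩ (_ | k) hk
        · exact h0
        · exact h k (by omega)
    rw [h1, ih (σ ω) (fun k => W (k + 1)) (fun k => hW (k + 1))]
    constructor
    · rintro ⟨h0, h⟩ i _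
      refine ⟨h0 i, ?_⟩
      have h3 := h i (mem_univ i)
      have h4 := (f ω).toFun_eq_br (hQ ω _ (hW 0)) (Rect.mem_toSet_of_emb h0) i
      change (((f ω).toFun x i : unitInterval) : ℝ) ∈ _ at h3
      rw [h4] at h3
      exact h3
    · intro h
      have h0 : emb x ∈ (W 0).openBox := fun i => (h i (mem_univ i)).1
      refine ⟨h0, fun i _ => ?_⟩
      have h4 := (f ω).toFun_eq_br (hQ ω _ (hW 0)) (Rect.mem_toSet_of_emb h0) i
      change (((f ω).toFun x i : unitInterval) : ℝ) ∈ _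
      rw [h4]
      exact (h i (mem_univ i)).2

lemma cyc_eq_pathMap {Q : RectPartition n} (hQ : ∀ ω, Q.Refines (f ω).part) (N : ℕ) :
    ∀ (ω : Ω) (W : ℕ → Rect n) (_ : ∀ k, W k ∈ Q.parts) (x : Cube n),
      emb x ∈ univ.pi (side σ f N ω W) →
        emb (cyc σ f N ω x) = fun i => pathMap σ f N ω W i (emb x i) := by
  induction N with
  | zero => intro ω W _ x _; rfl
  | succ N ih =>
    intro ω W hW x hx
    have h0 : emb x ∈ (W 0).openBox := fun i => (hx i (mem_univ i)).1
    have h4 := (f ω).toFun_eq_br (hQ ω _ (hW 0)) (Rect.mem_toSet_of_emb h0)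
    have h5 : emb ((f ω).toFun x) ∈ univ.pi (side σ f N (σ ω) fun k => W (k + 1)) := by
      intro i _
      change (((f ω).toFun x i : unitInterval) : ℝ) ∈ _
      rw [h4]
      exact (hx i (mem_univ i)).2
    rw [cyc_succ, ih (σ ω) (fun k => W (k + 1)) (fun k => hW (k + 1)) _ h5]
    ext i
    have : emb ((f ω).toFun x) i = (f ω).br (W 0) i (emb x i) := h4 i
    rw [this]
    rfl

lemma absolutelyContinuous_of_map_emb {μ : Measure (Cube n)} (h : μ.map emb ≪ volume) :
    μ ≪ volume := by
  intro s hs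
  have h1 : volume (emb '' s) = 0 := by
    have h2 : ((volume : Measure (Cube n)).map emb) (emb '' s) = 0 := by
      rw [measurableEmbedding_emb.map_apply, preimage_image_eq _ emb_injective, hs]
    rw [map_emb, Measure.restrict_apply' (measurableSet_unitCube n)] at h2
    rwa [inter_eq_left.2] at h2
    rintro _ ⟨x, -, rfl⟩
    exact emb_mem x
  have h3 := h h1
  rwa [measurableEmbedding_emb.map_apply, preimage_image_eq _ emb_injective] at h3

/-- The effect of the cocycle on families of product densities, in terms of its effect on
one-dimensional densities. -/
lemma Fam.map_cyc [MeasurableSpace Ω] (hF : Measurable (skewProduct σ f))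
    (hns : ∀ ω, Measure.QuasiMeasurePreserving (f ω).toFun volume volume)
    {Q : RectPartition n} (hQ : ∀ ω, Q.Refines (f ω).part) {N : ℕ} (hN : 1 ≤ N) {ω : Ω}
    {g : ℕ → Rect n → Fin n → ℝ → ℝ}
    (hb : ∀ k < N, ∀ C ∈ Q.parts, ∀ i,
      IsBranch (C.lo i) (C.hi i) ((f (σ^[k] ω)).br C i) (g k C i))
    {α β : ℝ} (hα : 0 ≤ α) (hβ : 0 ≤ β)
    (hstep : ∀ W : ℕ → Rect n, (∀ k, W k ∈ Q.parts) → (univ.pi (side σ f N ω W)).Nonempty →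
      ∀ i ρ G o, IsDensity ρ → Integrable ρ → Majorant ρ G → 0 ≤ o →
      (∀ s ∈ side σ f N ω W i, ∀ t ∈ side σ f N ω W i, G t - G s ≤ o) →
      HasVar (((den ρ).restrict (side σ f N ω W i)).map (pathMap σ f N ω W i))
        (α * o + β * ∫ t in side σ f N ω W i, ρ t))
    {μ : Measure (Cube n)} {z : ℝ} (hμ : Fam (μ.map emb) z) :
    Fam ((μ.map (cyc σ f N ω)).map emb) (α * z + β * μ.real univ) := by
  classical
  obtain ⟨C0, hC0⟩ := Q.parts_nonempty
  -- A path of length `N` is continued by an arbitrary rectangle, because cylinders are formed from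
  -- infinite paths; only the first `N` entries matter.
  let ext : (Fin N → Q.parts) → ℕ → Rect n := fun w k => if h : k < N then (w ⟨k, h⟩).1 else C0
  have hext : ∀ w k, ext w k ∈ Q.parts := by
    intro w k
    by_cases h : k < N
    · simp only [ext, dif_pos h]; exact (w ⟨k, h⟩).2
    · simp only [ext, dif_neg h]; exact hC0
  let K := {w : Fin N → Q.parts // (univ.pi (side σ f N ω (ext w))).Nonempty}
  have hKfin : Fintype K := Subtype.fintype _
  let J : K → Fin n → Set ℝ := fun w => side σ f N ω (ext w.1)
  have hbm : ∀ (w : K) i, ∀ k < N, IsBranch ((ext w.1 k).lo i) ((ext w.1 k).hi i)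
      ((f (σ^[k] ω)).br (ext w.1 k) i) (g k (ext w.1 k) i) := fun w i k hk =>
    hb k hk _ (hext _ _) i
  have hJm : ∀ w i, MeasurableSet (J w i) := fun w i =>
    measurableSet_cyl N fun k hk => (hbm w i k hk).meas
  have hJc : ∀ w i, (J w i).OrdConnected := fun w i => ordConnected_cyl N (hbm w i)
  have hJne : ∀ w i, (J w i).Nonempty := fun w i => by
    obtain ⟨y, hy⟩ := w.2
    exact ⟨y i, hy i (mem_univ i)⟩
  have hΦm : ∀ (w : K) i, Measurable (pathMap σ f N ω (ext w.1) i) := fun w i =>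
    measurable_iter N fun k hk => (hbm w i k hk).meas
  have hsub : ∀ w : K, univ.pi (J w) ⊆ unitCube n := by
    intro w y hy
    obtain ⟨M, rfl⟩ : ∃ M, N = M + 1 := ⟨N - 1, by omega⟩
    exact Rect.openBox_subset _ fun i => (hy i (mem_univ i)).1
  have hd : Pairwise fun w w' => Disjoint (univ.pi (J w)) (univ.pi (J w')) := by
    intro w w' hww'
    rw [Set.disjoint_left]
    intro y hy hy'
    obtain ⟨x, rfl⟩ := exists_emb_eq (hsub w hy)
    apply hww'
    apply Subtype.ext
    funext k
    have h1 := (mem_cylinder_iff hQ N ω _ (hext w.1) x).2 hy k k.2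
    have h2 := (mem_cylinder_iff hQ N ω _ (hext w'.1) x).2 hy' k k.2
    simp only [ext, dif_pos k.2] at h1 h2
    by_contra hne
    refine Set.disjoint_left.1 (Q.disjoint_openBox (w.1 k).2 (w'.1 k).2 ?_) h1 h2
    exact fun h => hne (Subtype.ext h)
  have hμac := absolutelyContinuous_of_map_emb hμ.absolutelyContinuous
  let R : K → Set (Cube n) := fun w => emb ⁻¹' univ.pi (J w)
  have hRm : ∀ w, MeasurableSet (R w) := fun w => measurable_emb (MeasurableSet.univ_pi (hJm w))
  -- Boundaries of the rectangles are null and the cocycle is nonsingular, so almost every orbit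
  -- meets only open rectangles. The measure `μ` is absolutely continuous and does not see the
  -- exceptions.
  have hcover : ∀ᵐ x ∂μ, x ∈ ⋃ w, R w := by
    apply hμac.ae_le
    have h1 : ∀ᵐ x : Cube n, ∀ k : ℕ, ∃ B ∈ Q.parts, emb (cyc σ f k ω x) ∈ B.openBox :=
      ae_all_iff.2 fun k => (quasiMeasurePreserving_cyc hns k ω).ae Q.ae_mem_openBox
    filter_upwards [h1] with x hx
    choose B hB hxB using hx
    let w : Fin N → Q.parts := fun k => ⟨B k, hB k⟩
    have hw : emb x ∈ univ.pi (side σ f N ω (ext w)) := by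
      rw [← mem_cylinder_iff hQ N ω _ (hext w) x]
      intro k hk
      simp only [ext, dif_pos hk, w]
      exact hxB k
    exact mem_iUnion.2 ⟨⟨w, ⟨_, hw⟩⟩, hw⟩
  have hRd : Pairwise fun w w' => Disjoint (R w) (R w') := fun w w' hww' =>
    (hd hww').preimage emb
  have hμsum : μ = ∑ w, μ.restrict (R w) := by
    rw [← Measure.sum_fintype, ← Measure.restrict_iUnion hRd hRm,
      Measure.restrict_eq_self_of_ae_mem hcover]
  have hcm := measurable_cyc hF N ω
  have hΦm' : ∀ w : K, Measurable fun (x : Fin n → ℝ) i => pathMap σ f N ω (ext w.1) i (x i) :=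
    fun w => measurable_pi_lambda _ fun i => (hΦm w i).comp (measurable_pi_apply i)
  have hmap : (μ.map (cyc σ f N ω)).map emb = ∑ w : K,
      ((μ.map emb).restrict (univ.pi (J w))).map
        fun x i => pathMap σ f N ω (ext w.1) i (x i) := by
    rw [Measure.map_map measurable_emb hcm]
    conv_lhs => rw [hμsum]
    rw [Measure.map_finset_sum' (measurable_emb.comp hcm).aemeasurable]
    refine Finset.sum_congr rfl fun w _ => ?_
    rw [Measure.restrict_map measurable_emb (MeasurableSet.univ_pi (hJm w)),
      Measure.map_map (hΦm' w) measurable_emb]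
    apply Measure.map_congr
    filter_upwards [ae_restrict_mem (hRm w)] with x hx
    exact cyc_eq_pathMap hQ N ω _ (hext w.1) x hx
  rw [hmap]
  have huniv : (μ.map emb).real univ = μ.real univ := by
    rw [Measure.real, Measure.map_apply measurable_emb MeasurableSet.univ, preimage_univ,
      Measure.real]
  rw [← huniv]
  exact hμ.step hα J hJm hJc hJne hd hβ (fun w i => pathMap σ f N ω (ext w.1) i) hΦm
    fun w i => hstep _ (hext w.1) w.2 i

/-- The estimate for long blocks, with a factor `3` but with optimal expansion. -/
lemma Fam.map_cyc_block [MeasurableSpace Ω] (hF : Measurable (skewProduct σ f))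
    (hns : ∀ ω, Measure.QuasiMeasurePreserving (f ω).toFun volume volume)
    {Q : RectPartition n} (hQ : ∀ ω, Q.Refines (f ω).part) {N : ℕ} (hN : 1 ≤ N) {ω : Ω}
    {g : ℕ → Rect n → Fin n → ℝ → ℝ} {Λ : ℕ → ℝ} {κ η : ℝ} (hκ : 1 ≤ κ) (hη : 0 < η)
    (hb : ∀ k < N, ∀ C ∈ Q.parts, ∀ i,
      IsBranch (C.lo i) (C.hi i) ((f (σ^[k] ω)).br C i) (g k C i))
    (hΛ0 : ∀ k < N, 0 ≤ Λ k)
    (hΛ : ∀ k < N, ∀ C ∈ Q.parts, ∀ i t, g k C i t ≤ Λ k) (hΛκ : ∀ k < N, Λ k ≤ κ)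
    (hH : ∀ k < N, ∀ C ∈ Q.parts, ∀ i, ∀ s t, |g k C i t - g k C i s| ≤ κ * |t - s|)
    (hvol : ∀ W : ℕ → Rect n, (∀ k, W k ∈ Q.parts) → (univ.pi (side σ f N ω W)).Nonempty →
      ENNReal.ofReal η ≤ volume (univ.pi (side σ f N ω W)))
    {μ : Measure (Cube n)} {z : ℝ} (hμ : Fam (μ.map emb) z) :
    Fam ((μ.map (cyc σ f N ω)).map emb) (3 * (∏ k ∈ Finset.range N, Λ k) * z +
      ((∏ k ∈ Finset.range N, Λ k) * (2 / η) + N * κ ^ N) * μ.real univ) := by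
  have hP : 0 ≤ ∏ k ∈ Finset.range N, Λ k :=
    Finset.prod_nonneg fun k hk => hΛ0 k (Finset.mem_range.1 hk)
  refine hμ.map_cyc hF hns hQ hN hb (by positivity) (by positivity) ?_
  intro W hW hne i ρ G o hρ hint hG ho0 ho
  have hbW : ∀ i, ∀ k < N, IsBranch ((W k).lo i) ((W k).hi i) ((f (σ^[k] ω)).br (W k) i)
      (g k (W k) i) := fun i k hk => hb k hk _ (hW k) i
  have hJm : ∀ i, MeasurableSet (side σ f N ω W i) := fun i =>
    measurableSet_cyl N fun k hk => (hbW i k hk).meas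
  have hsub : ∀ i, side σ f N ω W i ⊆ Icc 0 1 := by
    intro i t ht
    obtain ⟨M, rfl⟩ : ∃ M, N = M + 1 := ⟨N - 1, by omega⟩
    exact ⟨((W 0).lo_nonneg i).trans ht.1.1.le, ht.1.2.le.trans ((W 0).hi_le_one i)⟩
  have hvolle : ∀ i, volume (side σ f N ω W i) ≤ 1 := fun i => by
    refine (measure_mono (hsub i)).trans ?_
    simp
  have hfin : volume (side σ f N ω W i) ≠ ∞ := ((hvolle i).trans_lt ENNReal.one_lt_top).ne
  -- The other sides have length at most `1`, so the volume of the cylinder is a lower bound for the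
  -- length of each side.
  have hge : ENNReal.ofReal η ≤ volume (side σ f N ω W i) := by
    refine (hvol W hW hne).trans ?_
    rw [volume_pi_pi, ← Finset.mul_prod_erase _ _ (Finset.mem_univ i)]
    exact mul_le_of_le_one_right' (Finset.prod_le_one' fun j _ => hvolle j)
  have hcut := hG.varLE_indicator hρ hint (hJm i) (ordConnected_cyl N (hbW i)) hfin hη hge ho
  have hρ1 := hρ.indicator (hJm i)
  have hI : ∫ t, (side σ f N ω W i).indicator ρ t = ∫ t in side σ f N ω W i, ρ t :=
    integral_indicator (hJm i)
  have := push_iter N (Λ := Λ) hκ (hbW i) (fun k hk => hΛ k hk _ (hW k) i) hΛκ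
    (fun k hk => hH k hk _ (hW k) i) hρ1 hcut fun t ht => indicator_of_notMem ht _
  rw [den_restrict (hJm i)]
  refine HasVar.mono this (le_of_eq ?_)
  rw [hI]
  ring

/-- The estimate for a single step, which only involves the variation of the slopes. -/
lemma Fam.map_toFun [MeasurableSpace Ω] (hn : 1 ≤ n) (hF : Measurable (skewProduct σ f))
    (hns : ∀ ω, Measure.QuasiMeasurePreserving (f ω).toFun volume volume)
    {Q : RectPartition n} (hQ : ∀ ω, Q.Refines (f ω).part) {ω : Ω}
    {g : Rect n → Fin n → ℝ → ℝ} {Λ D s : ℝ} (hs : 0 < s)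
    (hsQ : ∀ C ∈ Q.parts, ∀ i, s ≤ C.hi i - C.lo i)
    (hb : ∀ C ∈ Q.parts, ∀ i, IsBranch (C.lo i) (C.hi i) ((f ω).br C i) (g C i))
    (hΛ0 : 0 ≤ Λ) (hD0 : 0 ≤ D)
    (hΛ : ∀ C ∈ Q.parts, ∀ i t, g C i t ≤ Λ)
    (hD : ∀ C ∈ Q.parts, ∀ i, VarLE (g C i) D)
    {μ : Measure (Cube n)} {z : ℝ} (hμ : Fam (μ.map emb) z) :
    Fam ((μ.map (f ω).toFun).map emb) ((3 + 2 / s) * (Λ + D) * z) := by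
  have key : Fam ((μ.map (cyc σ f 1 ω)).map emb) (3 * (Λ + D) * z +
      (2 / s * (Λ + D)) * μ.real univ) := by
    refine hμ.map_cyc hF hns hQ le_rfl (g := fun _ => g) (fun k hk C hC i => ?_) (by positivity)
      (by positivity) ?_
    · obtain rfl : k = 0 := by omega
      exact hb C hC i
    intro W hW hne i ρ G o hρ hint hG ho0 ho
    have hside : side σ f 1 ω W i = Ioo ((W 0).lo i) ((W 0).hi i) := by
      simp [side, cyl]
    have hmap : pathMap σ f 1 ω W i = (f ω).br (W 0) i := rfl
    rw [hmap, hside]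
    rw [hside] at ho
    have hbr := hb _ (hW 0) i
    have hcut := hG.varLE_indicator hρ hint measurableSet_Ioo ordConnected_Ioo
      (by simp) hs (by
        rw [Real.volume_Ioo]
        exact ENNReal.ofReal_le_ofReal (hsQ _ (hW 0) i)) ho
    have hρ1 := hρ.indicator (J := Ioo ((W 0).lo i) ((W 0).hi i)) measurableSet_Ioo
    obtain ⟨ρ', h1, h2, h3, -⟩ := hbr.push hρ1
      (fun t ht => indicator_of_notMem (fun h => ht (Ioo_subset_Icc_self h)) _)
      (hcut.mul_varLE hρ1 hbr.gnonneg (hΛ _ (hW 0) i) (hD _ (hW 0) i))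
    rw [den_restrict measurableSet_Ioo]
    refine ⟨ρ', h1, h2.mono (le_of_eq ?_), h3⟩
    ring
  -- The mass is at most `z`, so the additive term is absorbed. This makes the one-step estimate
  -- purely multiplicative, as its iteration along orbits requires.
  refine Fam.mono key ?_
  have huniv : (μ.map emb).real univ = μ.real univ := by
    rw [Measure.real, Measure.map_apply measurable_emb MeasurableSet.univ, preimage_univ,
      Measure.real]
  have := hμ.real_univ_le hn
  rw [huniv] at this
  have h2 : 2 / s * (Λ + D) * μ.real univ ≤ 2 / s * (Λ + D) * z := by gcongr
  linarith

end Cocycle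

/-! ### Variation on dense subsets -/

lemma eVariationOn_le_of_majorant {α : Type*} [LinearOrder α] {h G : α → ℝ} {S : Set α} {d : ℝ}
    (hG : ∀ s ∈ S, ∀ t ∈ S, s ≤ t → |h t - h s| ≤ G t - G s)
    (hd : ∀ s ∈ S, ∀ t ∈ S, G t - G s ≤ d) : eVariationOn h S ≤ ENNReal.ofReal d := by
  refine iSup_le ?_
  rintro ⟨N, u, hu, huS⟩
  dsimp only
  calc ∑ i ∈ Finset.range N, edist (h (u (i + 1))) (h (u i))
      ≤ ∑ i ∈ Finset.range N, ENNReal.ofReal (G (u (i + 1)) - G (u i)) := by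
        refine Finset.sum_le_sum fun i _ => ?_
        rw [edist_dist, Real.dist_eq]
        exact ENNReal.ofReal_le_ofReal (hG _ (huS i) _ (huS (i + 1)) (hu (Nat.le_succ i)))
    _ = ENNReal.ofReal (G (u N) - G (u 0)) := by
        rw [← ENNReal.ofReal_sum_of_nonneg, Finset.sum_range_sub (fun i => G (u i))]
        intro i _
        exact (abs_nonneg _).trans (hG _ (huS i) _ (huS (i + 1)) (hu (Nat.le_succ i)))
    _ ≤ ENNReal.ofReal d := ENNReal.ofReal_le_ofReal (hd _ (huS 0) _ (huS N))

/-- Increments of a continuous function are controlled by its variation on a dense subset. -/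
lemma abs_sub_le_variation {h : ℝ → ℝ} {Y : Set ℝ} (hY : eVariationOn h Y ≠ ∞) {s t : ℝ}
    (hst : s ≤ t) (hc : ContinuousOn h (Icc s t)) (hd : Ioo s t ⊆ closure Y) :
    |h t - h s| ≤ (eVariationOn h (Y ∩ Iio t)).toReal - (eVariationOn h (Y ∩ Iio s)).toReal := by
  rcases hst.eq_or_lt with rfl | hlt
  · simp
  have hfin : ∀ r, eVariationOn h (Y ∩ Iio r) ≠ ∞ := fun r =>
    ne_top_of_le_ne_top hY (eVariationOn.mono h inter_subset_left)
  set A := (eVariationOn h (Y ∩ Iio t)).toReal - (eVariationOn h (Y ∩ Iio s)).toReal with hA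
  have key : ∀ s' ∈ Y, ∀ t' ∈ Y, s < s' → s' < t' → t' < t → |h t' - h s'| ≤ A := by
    intro s' hs' t' ht' h1 h2 h3
    have e1 : eVariationOn h (Y ∩ Iio s) + eVariationOn h (Y ∩ Icc s' t') ≤
        eVariationOn h (Y ∩ Iio t) := by
      refine (eVariationOn.add_le_union h fun x hx y hy =>
        (hx.2.trans h1).le.trans hy.2.1).trans (eVariationOn.mono h ?_)
      rintro x (hx | hx)
      · exact ⟨hx.1, hx.2.trans hlt⟩
      · exact ⟨hx.1, hx.2.2.trans_lt h3⟩
    have e2 : edist (h t') (h s') ≤ eVariationOn h (Y ∩ Icc s' t') :=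
      eVariationOn.edist_le h ⟨ht', h2.le, le_rfl⟩ ⟨hs', le_rfl, h2.le⟩
    have e3 : eVariationOn h (Y ∩ Iio s) + edist (h t') (h s') ≤ eVariationOn h (Y ∩ Iio t) := by
      refine le_trans ?_ e1
      gcongr
    have e4 := ENNReal.toReal_mono (hfin t) e3
    rw [ENNReal.toReal_add (hfin s) (edist_ne_top _ _), edist_dist, ENNReal.toReal_ofReal
      dist_nonneg, Real.dist_eq] at e4
    linarith
  refine le_of_forall_pos_le_add fun ε hε => ?_
  have hcs := Metric.continuousWithinAt_iff.1 (hc s ⟨le_rfl, hlt.le⟩) (ε / 2) (by positivity)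
  have hct := Metric.continuousWithinAt_iff.1 (hc t ⟨hlt.le, le_rfl⟩) (ε / 2) (by positivity)
  obtain ⟨δ, hδ, hcs⟩ := hcs
  obtain ⟨δ', hδ', hct⟩ := hct
  set m := (s + t) / 2 with hm
  have hsm : s < m := by rw [hm]; linarith
  have hmt : m < t := by rw [hm]; linarith
  have hex : ∀ a b, s ≤ a → a < b → b ≤ t → ∃ y ∈ Y, a < y ∧ y < b := by
    intro a b h1 h2 h3
    have hmid : (a + b) / 2 ∈ Ioo s t := ⟨by linarith, by linarith⟩
    obtain ⟨y, hy1, hy2⟩ := mem_closure_iff.1 (hd hmid) (Ioo a b) isOpen_Ioo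
      ⟨by linarith, by linarith⟩
    exact ⟨y, hy2, hy1.1, hy1.2⟩
  obtain ⟨s', hs', h1, h2⟩ := hex s (min m (s + δ)) le_rfl (lt_min hsm (by linarith))
    ((min_le_left _ _).trans hmt.le)
  obtain ⟨t', ht', h3, h4⟩ := hex (max m (t - δ')) t (hsm.le.trans (le_max_left _ _))
    (max_lt hmt (by linarith)) le_rfl
  have h5 := key s' hs' t' ht' h1 ((h2.trans_le (min_le_left _ _)).trans
    ((le_max_left _ _).trans_lt h3)) h4
  have h2m : s' < m := h2.trans_le (min_le_left _ _)
  have h3m : m < t' := (le_max_left _ _).trans_lt h3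
  have h2' : s' < s + δ := h2.trans_le (min_le_right _ _)
  have h3' : t - δ' < t' := (le_max_right _ _).trans_lt h3
  have h6 : |h s' - h s| < ε / 2 := by
    have := hcs (x := s') ⟨h1.le, by linarith⟩ (by
      rw [Real.dist_eq, abs_of_nonneg (by linarith)]; linarith)
    rwa [Real.dist_eq] at this
  have h7 : |h t' - h t| < ε / 2 := by
    have := hct (x := t') ⟨by linarith, h4.le⟩ (by
      rw [Real.dist_eq, abs_of_nonpos (by linarith)]; linarith)
    rwa [Real.dist_eq] at this
  rw [abs_lt] at h6 h7
  rw [abs_le] at h5 ⊢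
  constructor <;> linarith [h5.1, h5.2, h6.1, h6.2, h7.1, h7.2]

lemma toReal_variation_mono {h : ℝ → ℝ} {Y : Set ℝ} (hY : eVariationOn h Y ≠ ∞) :
    Monotone fun t => (eVariationOn h (Y ∩ Iio t)).toReal := fun _ _ hst =>
  ENNReal.toReal_mono (ne_top_of_le_ne_top hY (eVariationOn.mono h inter_subset_left))
    (eVariationOn.mono h (inter_subset_inter_right _ (Iio_subset_Iio hst)))

lemma toReal_variation_sub_le {h : ℝ → ℝ} {Y : Set ℝ} (hY : eVariationOn h Y ≠ ∞) (s t : ℝ) :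
    (eVariationOn h (Y ∩ Iio t)).toReal - (eVariationOn h (Y ∩ Iio s)).toReal ≤
      (eVariationOn h Y).toReal := by
  have := ENNReal.toReal_mono hY (eVariationOn.mono h (inter_subset_left (s := Y) (t := Iio t)))
  linarith [ENNReal.toReal_nonneg (a := eVariationOn h (Y ∩ Iio s))]

lemma eVariationOn_Ioo_le_of_dense {h : ℝ → ℝ} {a b : ℝ} (hc : ContinuousOn h (Ioo a b))
    {Y : Set ℝ} (hd : Ioo a b ⊆ closure Y) : eVariationOn h (Ioo a b) ≤ eVariationOn h Y := by
  by_cases hY : eVariationOn h Y = ∞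
  · rw [hY]; exact le_top
  rw [← ENNReal.ofReal_toReal hY]
  refine eVariationOn_le_of_majorant
    (G := fun t => (eVariationOn h (Y ∩ Iio t)).toReal) (fun s hs t ht hst => ?_)
    fun s _ t _ => toReal_variation_sub_le hY s t
  have hsub : Icc s t ⊆ Ioo a b := fun r hr => ⟨hs.1.trans_le hr.1, hr.2.trans_lt ht.2⟩
  exact abs_sub_le_variation hY hst (hc.mono hsub)
    ((Ioo_subset_Icc_self.trans hsub).trans hd)

/-- The rational points of an open interval. -/
def ratIoo (a b : ℝ) : Set ℝ := Ioo a b ∩ range ((↑) : ℚ → ℝ)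

lemma countable_ratIoo (a b : ℝ) : (ratIoo a b).Countable :=
  (countable_range _).mono inter_subset_right

lemma Icc_subset_closure_ratIoo {a b : ℝ} (hab : a < b) : Icc a b ⊆ closure (ratIoo a b) := by
  rw [← closure_Ioo hab.ne]
  exact closure_minimal (Rat.isDenseEmbedding_coe_real.dense.open_subset_closure_inter isOpen_Ioo)
    isClosed_closure

/-- Continuity makes the variation over the rational points sufficient, and that variation can be
measured in `ω`. The majorant is the variation up to the clamped point, since `g` is constant on
both sides of `[a, b]`. -/
lemma VarLE.of_eVariationOn {g : ℝ → ℝ} {a b : ℝ} (hab : a < b) (hg : ContinuousOn g (Icc a b))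
    (hc : ∀ t, g t = g (max a (min b t)))
    (hfin : eVariationOn g (ratIoo a b) ≠ ∞) :
    VarLE g (eVariationOn g (ratIoo a b)).toReal := by
  set Y := ratIoo a b
  have hpr : ∀ t, max a (min b t) ∈ Icc a b := fun t =>
    ⟨le_max_left _ _, max_le hab.le (min_le_left _ _)⟩
  have hprm : Monotone fun t => max a (min b t) := fun s t hst =>
    max_le_max le_rfl (min_le_min le_rfl hst)
  refine ⟨fun t => (eVariationOn g (Y ∩ Iio (max a (min b t)))).toReal,
    ⟨(toReal_variation_mono hfin).comp hprm, fun s t hst => ?_⟩,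
    fun s t => toReal_variation_sub_le hfin _ _⟩
  rw [hc s, hc t]
  exact abs_sub_le_variation hfin (hprm hst) (hg.mono (Icc_subset_Icc (hpr s).1 (hpr t).2))
    fun r hr => Icc_subset_closure_ratIoo hab ⟨(hpr s).1.trans hr.1.le, hr.2.le.trans (hpr t).2⟩

/-- A Lipschitz bound on a dense set extends by continuity, and clamping is a contraction. The bound
thus becomes a countable family of conditions, which defines a measurable set of parameters. -/
lemma lipschitz_of_rat {g : ℝ → ℝ} {a b κ : ℝ} (hab : a < b) (hg : ContinuousOn g (Icc a b))
    (hc : ∀ t, g t = g (max a (min b t))) (hκ : 0 ≤ κ)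
    (h : ∀ s ∈ ratIoo a b, ∀ t ∈ ratIoo a b, |g t - g s| ≤ κ * |t - s|) (s t : ℝ) :
    |g t - g s| ≤ κ * |t - s| := by
  have hpr : ∀ t, max a (min b t) ∈ Icc a b := fun t =>
    ⟨le_max_left _ _, max_le hab.le (min_le_left _ _)⟩
  have hl : LipschitzOnWith ⟨κ, hκ⟩ g (ratIoo a b) := LipschitzOnWith.of_dist_le_mul
    fun x hx y hy => by rw [Real.dist_eq, Real.dist_eq]; exact h y hy x hx
  have hsub : ratIoo a b ⊆ Icc a b := fun x hx => Ioo_subset_Icc_self hx.1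
  have hl' : LipschitzOnWith ⟨κ, hκ⟩ g (Icc a b) := by
    have hcl : closure (ratIoo a b) = Icc a b := Subset.antisymm
      (closure_minimal hsub isClosed_Icc) (Icc_subset_closure_ratIoo hab)
    rw [← hcl]
    refine LipschitzOnWith.closure ?_ hl
    rw [hcl]
    exact hg
  have h1 := hl'.dist_le_mul _ (hpr t) _ (hpr s)
  rw [Real.dist_eq, Real.dist_eq] at h1
  rw [hc s, hc t]
  refine h1.trans (mul_le_mul_of_nonneg_left ?_ hκ)
  have e1 := abs_max_sub_max_le_max a (min b t) a (min b s)
  have e2 := abs_min_sub_min_le_max b t b s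
  rw [sub_self, abs_zero] at e1 e2
  exact e1.trans (max_le (abs_nonneg _) (e2.trans (max_le (abs_nonneg _) le_rfl)))

/-- The variation is a lower semicontinuous function of the values at the points of `S`, for the
product topology. As `S` is countable, the vector of values depends measurably on `ω`. -/
lemma measurable_eVariationOn {Ω : Type*} [MeasurableSpace Ω] {u : Ω → ℝ → ℝ} {S : Set ℝ}
    (hS : S.Countable) (hu : ∀ t ∈ S, Measurable fun ω => u ω t) :
    Measurable fun ω => eVariationOn (u ω) S := by
  classical
  have : Countable S := hS.to_subtype
  let e : (S → ℝ) → ℝ → ℝ := fun y t => if h : t ∈ S then y ⟨t, h⟩ else 0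
  have hlsc : LowerSemicontinuous fun y : S → ℝ => eVariationOn (e y) S := by
    intro y c hc
    refine eVariationOn.lowerSemicontinuous_aux (p := 𝓝 y) (fun t ht => ?_) hc
    simp only [e, dif_pos ht]
    exact (continuous_apply (⟨t, ht⟩ : S)).continuousAt
  have h2 : (fun ω => eVariationOn (u ω) S) =
      (fun y : S → ℝ => eVariationOn (e y) S) ∘ fun ω (t : S) => u ω t := by
    ext ω
    refine eVariationOn.congr fun t ht => ?_
    simp only [e, dif_pos ht]
  rw [h2]
  exact hlsc.measurable.comp (measurable_pi_lambda _ fun t => hu t t.2)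

lemma ofReal_mul_eVariationOn_le {h : ℝ → ℝ} {S : Set ℝ} {c : ℝ} (hc : 0 ≤ c) :
    ENNReal.ofReal c * eVariationOn h S ≤ eVariationOn (fun t => c * h t) S := by
  rcases hc.eq_or_lt with rfl | hc
  · simp
  have hl : LipschitzOnWith (Real.toNNReal c⁻¹) (fun y : ℝ => c⁻¹ * y) univ := by
    refine LipschitzOnWith.of_dist_le_mul fun x _ y _ => ?_
    rw [Real.dist_eq, Real.dist_eq, ← mul_sub, abs_mul, abs_of_pos (inv_pos.2 hc),
      Real.coe_toNNReal _ (inv_pos.2 hc).le]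
  have h1 := hl.comp_eVariationOn_le (g := fun t => c * h t) (s := S) (mapsTo_univ _ _)
  have h2 : (fun y : ℝ => c⁻¹ * y) ∘ (fun t => c * h t) = h := by
    ext t
    simp only [Function.comp]
    rw [inv_mul_cancel_left₀ hc.ne']
  rw [h2] at h1
  calc ENNReal.ofReal c * eVariationOn h S
      ≤ ENNReal.ofReal c * (ENNReal.ofReal c⁻¹ * eVariationOn (fun t => c * h t) S) := by
        gcongr
        exact h1
    _ = _ := by
        rw [← mul_assoc, ← ENNReal.ofReal_mul hc.le, mul_inv_cancel₀ hc.ne', ENNReal.ofReal_one,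
          one_mul]

/-! ### The norm of the generator controls the variation of the slopes -/

section

variable {n : ℕ}

lemma measurable_update_prod (i : Fin n) :
    Measurable fun p : Cube n × unitInterval => Function.update p.1 i p.2 :=
  measurable_pi_lambda _ fun j => by
    by_cases h : j = i
    · subst h
      simpa using measurable_snd
    · simp only [Function.update_of_ne h]
      exact (measurable_pi_apply j).comp measurable_fst

/-- Resampling one coordinate independently does not change a product measure. Through this, a
property that holds almost everywhere in the cube holds almost everywhere on almost every line
parallel to an axis. -/
lemma map_update (i : Fin n) :
    ((volume : Measure (Cube n)).prod (volume : Measure unitInterval)).map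
      (fun p => Function.update p.1 i p.2) = volume := by
  have hm := measurable_update_prod (n := n) i
  refine (Measure.pi_eq (μ := fun _ : Fin n => (volume : Measure unitInterval)) ?_).symm
  intro s hs
  rw [Measure.map_apply hm (MeasurableSet.univ_pi hs)]
  have : (fun p : Cube n × unitInterval => Function.update p.1 i p.2) ⁻¹' univ.pi s =
      (univ.pi (Function.update s i univ)) ×ˢ s i := by
    ext p
    simp only [mem_preimage, Set.mem_pi, mem_univ, true_implies, mem_prod]
    constructor
    · intro h
      refine ⟨fun j => ?_, by simpa using h i⟩
      by_cases hj : j = i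
      · subst hj; simp
      · simpa [hj] using h j
    · rintro ⟨h1, h2⟩ j
      by_cases hj : j = i
      · subst hj; simpa using h2
      · simpa [hj] using h1 j
  rw [this, Measure.prod_prod, volume_pi_pi, ← Finset.mul_prod_erase _ _ (Finset.mem_univ i),
    ← Finset.mul_prod_erase Finset.univ (fun j => volume (s j)) (Finset.mem_univ i)]
  rw [Function.update_self, measure_univ, one_mul, mul_comm]
  congr 1
  refine Finset.prod_congr rfl fun j hj => ?_
  rw [Function.update_of_ne (Finset.ne_of_mem_erase hj)]

lemma ae_update {p : Cube n → Prop} (h : ∀ᵐ y, p y) (i : Fin n) :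
    ∀ᵐ x : Cube n, ∀ᵐ t : unitInterval, p (Function.update x i t) := by
  have hm := measurable_update_prod (n := n) i
  rw [← map_update i] at h
  exact Measure.ae_ae_of_ae_prod (ae_of_ae_map hm.aemeasurable h)

lemma Rect.measurableSet_toSet (C : Rect n) : MeasurableSet C.toSet := by
  have : C.toSet = ⋂ i, ((fun x : Cube n => (x i : ℝ)) ⁻¹' Ici (C.lo i) ∩
      ((fun x : Cube n => (x i : ℝ)) ⁻¹' Iio (C.hi i) ∪ {_x | C.hi i = 1})) := by
    ext x
    simp only [toSet, mem_iInter]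
    rfl
  rw [this]
  have hm : ∀ i, Measurable fun x : Cube n => (x i : ℝ) := fun i =>
    measurable_subtype_coe.comp (measurable_pi_apply i)
  exact MeasurableSet.iInter fun i => (hm i measurableSet_Ici).inter
    ((hm i measurableSet_Iio).union (MeasurableSet.const _))

lemma Rect.toSet_ae_eq (C : Rect n) : C.toSet =ᵐ[volume] emb ⁻¹' C.openBox := by
  have h1 : ∀ᵐ x : Cube n, ∀ i, (x i : ℝ) ≠ C.lo i ∧ (x i : ℝ) ≠ C.hi i := by
    rw [ae_all_iff]
    intro i
    have key : ∀ c : ℝ, ∀ᵐ x : Cube n, (x i : ℝ) ≠ c := by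
      intro c
      by_cases hc : c ∈ unitInterval
      · filter_upwards [Measure.ae_eval_ne
          (μ := fun _ : Fin n => (volume : Measure unitInterval)) i ⟨c, hc⟩] with x hx hxc
        exact hx (Subtype.ext hxc)
      · exact ae_of_all _ fun x hx => hc (hx ▸ (x i).2)
    exact (key _).and (key _)
  filter_upwards [h1] with x hx
  apply propext
  constructor
  · intro hxC i
    refine ⟨lt_of_le_of_ne (hxC i).1 (hx i).1.symm, ?_⟩
    rcases (hxC i).2 with h2 | h2
    · exact h2
    · exact lt_of_le_of_ne (h2 ▸ (x i).2.2) (hx i).2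
  · exact fun h => Rect.mem_toSet_of_emb h

/-- The indicator of a rectangle, normalised so that its norm in `BV` is at most one. -/
def bump (C : Rect n) (y : Cube n) : ℝ := C.toSet.indicator (fun _ => 1 / 3) y

lemma measurable_bump (C : Rect n) : Measurable (bump C) :=
  measurable_const.indicator C.measurableSet_toSet

lemma bump_nonneg (C : Rect n) (y : Cube n) : 0 ≤ bump C y :=
  indicator_nonneg (fun _ _ => by norm_num) _

lemma bump_le (C : Rect n) (y : Cube n) : bump C y ≤ 1 / 3 :=
  indicator_le_self' (fun _ _ => by norm_num) _

lemma integrable_bump (C : Rect n) : Integrable (bump C) :=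
  Integrable.of_bound (measurable_bump C).aestronglyMeasurable (1 / 3) (ae_of_all _ fun y => by
    rw [Real.norm_of_nonneg (bump_nonneg C y)]
    exact bump_le C y)

/-- The `L¹` norm is at most `1 / 3`, and a line parallel to an axis sees at most two jumps of
height `1 / 3`. -/
lemma bvNorm_bump_le (C : Rect n) : bvNorm (bump C) ≤ 1 := by
  classical
  have h1 : ∫⁻ x, ‖bump C x‖ₑ ≤ ENNReal.ofReal (1 / 3) := by
    calc ∫⁻ x, ‖bump C x‖ₑ ≤ ∫⁻ _x : Cube n, ENNReal.ofReal (1 / 3) := by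
          refine lintegral_mono fun x => ?_
          rw [Real.enorm_of_nonneg (bump_nonneg C x)]
          exact ENNReal.ofReal_le_ofReal (bump_le C x)
      _ = ENNReal.ofReal (1 / 3) := by simp
  have h2 : totalVariation (bump C) ≤ ENNReal.ofReal (2 / 3) := by
    refine iSup_le fun i => ?_
    let side : unitInterval → Prop := fun t => C.lo i ≤ (t : ℝ) ∧ ((t : ℝ) < C.hi i ∨ C.hi i = 1)
    let A : Set (Cube n) := {x | ∀ j, j ≠ i → C.lo j ≤ (x j : ℝ) ∧ ((x j : ℝ) < C.hi j ∨ C.hi j = 1)}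
    have hA : MeasurableSet A := by
      have : A = ⋂ j, ⋂ (_ : j ≠ i), ((fun x : Cube n => (x j : ℝ)) ⁻¹' Ici (C.lo j) ∩
          ((fun x : Cube n => (x j : ℝ)) ⁻¹' Iio (C.hi j) ∪ {_x | C.hi j = 1})) := by
        ext x
        simp only [mem_iInter]
        rfl
      rw [this]
      have hm : ∀ i, Measurable fun x : Cube n => (x i : ℝ) := fun i =>
        measurable_subtype_coe.comp (measurable_pi_apply i)
      exact MeasurableSet.iInter fun j => MeasurableSet.iInter fun _ => (hm j measurableSet_Ici).inter
        ((hm j measurableSet_Iio).union (MeasurableSet.const _))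
    set c : ℝ≥0∞ := eVariationOn (fun t : unitInterval => if side t then (1 / 3 : ℝ) else 0) univ
      with hc
    have hline : ∀ x, lineVariation i (bump C) x = A.indicator (fun _ => c) x := by
      intro x
      have hmem : ∀ t : unitInterval, Function.update x i t ∈ C.toSet ↔ x ∈ A ∧ side t := by
        intro t
        constructor
        · intro h
          refine ⟨fun j hj => ?_, by simpa using h i⟩
          simpa [hj] using h j
        · rintro ⟨h3, h4⟩ j
          by_cases hj : j = i
          · subst hj; simpa using h4
          · simpa [hj] using h3 j hj
      by_cases hx : x ∈ A
      · rw [indicator_of_mem hx, lineVariation, hc]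
        congr 1
        ext t
        simp only [bump, indicator_apply, hmem, hx, true_and]
      · rw [indicator_of_notMem hx, lineVariation]
        refine eVariationOn.constant_on ?_
        rintro _ ⟨s, -, rfl⟩ _ ⟨t, -, rfl⟩
        simp only [bump, indicator_apply, hmem, hx, false_and, if_false]
    have hcle : c ≤ ENNReal.ofReal (2 / 3) := by
      refine eVariationOn_le_of_majorant (G := fun t : unitInterval =>
        (if C.lo i ≤ (t : ℝ) then (1 / 3 : ℝ) else 0) +
          if (t : ℝ) < C.hi i ∨ C.hi i = 1 then 0 else 1 / 3) ?_ ?_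
      · intro s _ t _ hst
        have hst' : (s : ℝ) ≤ t := hst
        simp only [side]
        by_cases hs1 : C.lo i ≤ (s : ℝ)
        · have ht1 : C.lo i ≤ (t : ℝ) := hs1.trans hst'
          by_cases hh : C.hi i = 1
          · simp [hs1, ht1, hh]
          · by_cases ht2 : (t : ℝ) < C.hi i
            · have hs2 : (s : ℝ) < C.hi i := hst'.trans_lt ht2
              simp [hs1, ht1, hs2, ht2]
            · by_cases hs2 : (s : ℝ) < C.hi i
              · simp [hs1, ht1, hs2, ht2, hh]
              · simp [hs1, ht1, hs2, ht2, hh]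
        · have hs2 : (s : ℝ) < C.hi i := (not_le.1 hs1).trans (C.lo_lt_hi i)
          by_cases ht1 : C.lo i ≤ (t : ℝ)
          · by_cases ht2 : (t : ℝ) < C.hi i ∨ C.hi i = 1
            · simp [hs1, ht1, hs2, ht2]
            · simp [hs1, ht1, hs2, ht2]
          · have ht2 : (t : ℝ) < C.hi i := (not_le.1 ht1).trans (C.lo_lt_hi i)
            simp [hs1, ht1, hs2, ht2]
      · intro s _ t _
        split_ifs <;> norm_num
    have hlm : lineVariation i (bump C) = A.indicator fun _ => c := funext hline
    have hle : dirVariation i (bump C) ≤ ∫⁻ x, lineVariation i (bump C) x := by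
      refine iInf_le_of_le (bump C) (iInf_le_of_le Filter.EventuallyEq.rfl (iInf_le _ ?_))
      rw [hlm]
      exact (measurable_const.indicator hA).aemeasurable
    refine hle.trans ?_
    rw [hlm, lintegral_indicator hA, setLIntegral_const]
    calc c * volume A ≤ c * 1 := by
          gcongr
          exact prob_le_one
      _ ≤ _ := by rwa [mul_one]
  calc bvNorm (bump C) ≤ ENNReal.ofReal (1 / 3) + ENNReal.ofReal (2 / 3) := add_le_add h1 h2
    _ = 1 := by
      rw [← ENNReal.ofReal_add (by norm_num) (by norm_num)]
      norm_num

lemma varLE_indicator_Ioo {a b c : ℝ} (hab : a < b) (hc : 0 ≤ c) :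
    VarLE ((Ioo a b).indicator fun _ => c) (2 * c) := by
  refine ⟨fun t => (if a < t then c else 0) + if t < b then 0 else c,
    ⟨fun s t hst => ?_, fun s t hst => ?_⟩, fun s t => ?_⟩
  · have h1 : (if a < s then c else 0) ≤ if a < t then c else 0 := by
      split_ifs with h1 h2 <;> first | exact absurd (h1.trans_le hst) h2 | simp [hc]
    have h2 : (if s < b then 0 else c) ≤ if t < b then 0 else c := by
      split_ifs with h1 h2 h2 <;> first | exact absurd (hst.trans_lt h2) h1 | simp [hc]
    exact add_le_add h1 h2
  · simp only [indicator_apply, mem_Ioo]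
    by_cases hs1 : a < s
    · have ht1 : a < t := hs1.trans_le hst
      by_cases ht2 : t < b
      · simp [hs1, ht1, ht2, hst.trans_lt ht2]
      · by_cases hs2 : s < b <;> simp [hs1, ht1, ht2, hs2, abs_of_nonneg hc]
    · have hs2 : s < b := (not_lt.1 hs1).trans_lt hab
      by_cases ht1 : a < t
      · by_cases ht2 : t < b <;> simp [hs1, hs2, ht1, ht2, abs_of_nonneg hc, hc]
      · have ht2 : t < b := (not_lt.1 ht1).trans_lt hab
        simp [hs1, hs2, ht1, ht2]
  · dsimp only
    split_ifs <;> linarith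

/-- The densities of the images of the sides of `C` under the branches of `f`. -/
lemma JablonskiMap.exists_density {f : JablonskiMap n} (hf : f.IsC2Monotone)
    (hγ : ∀ i, 0 < f.expansion i) (hm : Measurable f.toFun) {C : Rect n}
    (hC : ∃ B ∈ f.part.parts, C.toSet ⊆ B.toSet) :
    ∃ θ : Fin n → ℝ → ℝ, (∀ i, IsDensity (θ i)) ∧ (∀ i, Integrable (θ i)) ∧
      (∀ i, ∫ t, θ i t = C.hi i - C.lo i) ∧
      (∀ i, ∀ t ∈ Ioo (C.lo i) (C.hi i), θ i (f.br C i t) = f.slope C i t) ∧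
      ((volume : Measure (Cube n)).restrict C.toSet).map f.toFun =
        volume.withDensity fun x => ENNReal.ofReal (∏ i, θ i (x i)) := by
  let ρ : Fin n → ℝ → ℝ := fun i => (Ioo (C.lo i) (C.hi i)).indicator fun _ => 1
  have hρ : ∀ i, IsDensity (ρ i) := fun i =>
    ⟨fun t => indicator_nonneg (fun _ _ => zero_le_one) _,
      measurable_const.indicator measurableSet_Ioo, fun t ht => indicator_of_notMem (fun h => ht
        ⟨(C.lo_nonneg i).trans h.1.le, h.2.le.trans (C.hi_le_one i)⟩) _⟩
  have hρi : ∀ i, Integrable (ρ i) := fun i => by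
    rw [integrable_indicator_iff measurableSet_Ioo]
    exact integrableOn_const (by simp)
  have hρden : ∀ i, den (ρ i) = (volume : Measure ℝ).restrict (Ioo (C.lo i) (C.hi i)) := by
    intro i
    have h1 : den (fun _ => 1) = (volume : Measure ℝ) := by
      simp [den]
    rw [← den_restrict measurableSet_Ioo, h1]
  have hρv : ∀ i, ∃ v, VarLE (ρ i) v := fun i =>
    ⟨_, varLE_indicator_Ioo (C.lo_lt_hi i) zero_le_one⟩
  have hex : ∀ i, ∃ θ, IsDensity θ ∧ Integrable θ ∧ (den (ρ i)).map (f.br C i) = den θ ∧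
      ∀ t ∈ Icc (C.lo i) (C.hi i), θ (f.br C i t) = ρ i t * f.slope C i t := by
    intro i
    obtain ⟨hb, hle, hpos, H, hH, hlip⟩ := f.exists_branch hf hC i (hγ i)
    obtain ⟨v, hv⟩ := hρv i
    obtain ⟨θ, h1, h2, h3, h4, -⟩ := hb.push (hρ i)
      (fun t ht => indicator_of_notMem (fun h => ht (Ioo_subset_Icc_self h)) _)
      (hv.mul_lipschitz (hρ i) hb.gnonneg hle hH hlip)
    exact ⟨θ, h1, h1.integrable h2, h3, h4⟩
  choose θ hθ hθi hθmap hθeq using hex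
  have hbrm : ∀ i, Measurable (f.br C i) := fun i => (f.exists_branch hf hC i (hγ i)).1.meas
  refine ⟨θ, hθ, hθi, fun i => ?_, fun i t ht => ?_, ?_⟩
  · have h1 := den_real_univ (hθ i) (hθi i)
    rw [← hθmap, Measure.real, Measure.map_apply (hbrm i) MeasurableSet.univ, preimage_univ,
      hρden, Measure.restrict_apply MeasurableSet.univ, univ_inter, Real.volume_Ioo,
      ENNReal.toReal_ofReal (sub_nonneg.2 (C.lo_lt_hi i).le)] at h1
    exact h1.symm
  · rw [hθeq i t (Ioo_subset_Icc_self ht)]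
    simp only [ρ]
    rw [indicator_of_mem ht, one_mul]
  · have hΦm : Measurable fun (x : Fin n → ℝ) i => f.br C i (x i) :=
      measurable_pi_lambda _ fun i => (hbrm i).comp (measurable_pi_apply i)
    have e1 : (volume : Measure (Cube n)).restrict C.toSet =
        volume.restrict (emb ⁻¹' C.openBox) := Measure.restrict_congr_set C.toSet_ae_eq
    have e2 : (((volume : Measure (Cube n)).restrict C.toSet).map f.toFun).map emb =
        (volume : Measure (Fin n → ℝ)).withDensity fun x => ENNReal.ofReal (∏ i, θ i (x i)) := by
      have hfin : ∀ i, IsFiniteMeasure (den (ρ i)) := fun i => isFiniteMeasure_den (hρi i)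
      have hfin2 : ∀ i, IsFiniteMeasure ((den (ρ i)).map (f.br C i)) := fun i => by
        rw [hθmap]; exact isFiniteMeasure_den (hθi i)
      rw [← pi_den hθ hθi]
      have h2 : (fun i => den (θ i)) = fun i => (den (ρ i)).map (f.br C i) :=
        funext fun i => (hθmap i).symm
      rw [h2, ← Measure.pi_map_pi fun i => (hbrm i).aemeasurable]
      have h3 : Measure.pi (fun i => den (ρ i)) = (volume : Measure (Fin n → ℝ)).restrict
          C.openBox := by
        rw [C.openBox_eq, volume_pi, Measure.restrict_pi_pi]
        congr 1
        exact funext fun i => hρden i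
      have h4 : (volume : Measure (Fin n → ℝ)).restrict C.openBox =
          ((volume : Measure (Cube n)).restrict (emb ⁻¹' C.openBox)).map emb := by
        rw [← Measure.restrict_map measurable_emb C.measurableSet_openBox, map_emb,
          Measure.restrict_restrict C.measurableSet_openBox, inter_eq_left.2 C.openBox_subset]
      rw [h3, h4, e1, Measure.map_map measurable_emb hm, Measure.map_map hΦm measurable_emb]
      apply Measure.map_congr
      filter_upwards [ae_restrict_mem (measurable_emb C.measurableSet_openBox)] with x hx
      ext i
      exact f.toFun_eq_br hC (Rect.mem_toSet_of_emb hx) i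
    ext E hE
    have hE' : MeasurableSet (emb '' E) := measurableEmbedding_emb.measurableSet_image.2 hE
    have h5 : ((volume : Measure (Cube n)).restrict C.toSet).map f.toFun E =
        (((volume : Measure (Cube n)).restrict C.toSet).map f.toFun).map emb (emb '' E) := by
      rw [Measure.map_apply measurable_emb hE', preimage_image_eq _ emb_injective]
    have h6 : emb '' E ⊆ unitCube n := by
      rintro _ ⟨x, -, rfl⟩
      exact emb_mem x
    rw [h5, e2, withDensity_apply _ hE', withDensity_apply _ hE]
    have h7 : (volume : Measure (Fin n → ℝ)).restrict (emb '' E) =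
        ((volume : Measure (Cube n)).restrict E).map emb := by
      have : E = emb ⁻¹' (emb '' E) := (preimage_image_eq _ emb_injective).symm
      conv_rhs => rw [this]
      rw [← Measure.restrict_map measurable_emb hE', map_emb, Measure.restrict_restrict hE',
        inter_eq_left.2 h6]
    rw [h7, measurableEmbedding_emb.lintegral_map]
    rfl

/-- The transfer operator on the normalised indicator of a rectangle. -/
lemma transfer_bump {f : Cube n → Cube n} {C : Rect n} {θ : Fin n → ℝ → ℝ}
    (hθ : ∀ i, IsDensity (θ i))
    (h : ((volume : Measure (Cube n)).restrict C.toSet).map f =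
        volume.withDensity fun x => ENNReal.ofReal (∏ i, θ i (x i))) :
    transfer f (bump C) =ᵐ[volume] fun x => 1 / 3 * ∏ i, θ i (x i) := by
  have hpm : Measurable fun x : Cube n => ∏ i, θ i (x i) :=
    Finset.measurable_prod _ fun i _ => (hθ i).meas.comp
      (measurable_subtype_coe.comp (measurable_pi_apply i))
  have e1 : ((volume : Measure (Cube n)).withDensity fun y => ENNReal.ofReal (bump C y)).map f =
      volume.withDensity fun x => ENNReal.ofReal (1 / 3 * ∏ i, θ i (x i)) := by
    have h1 : (fun y => ENNReal.ofReal (bump C y)) =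
        C.toSet.indicator fun _ => ENNReal.ofReal (1 / 3) := by
      ext y
      by_cases hy : y ∈ C.toSet <;> simp [bump, hy]
    have h2 : (fun x : Cube n => ENNReal.ofReal (1 / 3 * ∏ i, θ i (x i))) =
        ENNReal.ofReal (1 / 3) • fun x : Cube n => ENNReal.ofReal (∏ i, θ i (x i)) := by
      ext x
      rw [ENNReal.ofReal_mul (by norm_num), Pi.smul_apply, smul_eq_mul]
    rw [h1, withDensity_indicator C.measurableSet_toSet, withDensity_const, Measure.map_smul, h,
      h2, withDensity_smul _ hpm.ennreal_ofReal]
  have e2 : ((volume : Measure (Cube n)).withDensity fun y => ENNReal.ofReal (-bump C y)).map f =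
      0 := by
    have h1 : (fun y => ENNReal.ofReal (-bump C y)) = 0 := by
      ext y
      exact ENNReal.ofReal_of_nonpos (by linarith [bump_nonneg C y])
    rw [h1, withDensity_zero, Measure.map_zero]
  have e3 := Measure.rnDeriv_withDensity (volume : Measure (Cube n))
    ((hpm.const_mul (1 / 3)).ennreal_ofReal)
  have e4 := Measure.rnDeriv_zero (volume : Measure (Cube n))
  filter_upwards [e3, e4] with x h3 h4
  rw [transfer, e1, e2, h3, h4, Pi.zero_apply, ENNReal.toReal_zero, sub_zero,
    ENNReal.toReal_ofReal]
  exact mul_nonneg (by norm_num) (Finset.prod_nonneg fun i _ => (hθ i).nonneg _)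

end

/-! ### Lower bound for the `BV` norm of the transfer operator by the variation of `1/|φ'|` -/

section

variable {n : ℕ}

/-- By injectivity and the intermediate value theorem, `φ` maps every small interval onto a set
containing a nondegenerate interval of `[0,1]`. This has positive length, so it meets the set `S` of
full measure. -/
lemma IsBranch.subset_closure {a b : ℝ} {φ g : ℝ → ℝ} (h : IsBranch a b φ g) {S : Set unitInterval}
    (hS : ∀ᵐ τ : unitInterval, τ ∈ S) :
    Ioo a b ⊆ closure {t | t ∈ Ioo a b ∧ ∃ τ ∈ S, (τ : ℝ) = φ t} := by
  intro t ht
  rw [mem_closure_iff]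
  intro O hO htO
  obtain ⟨ε, hε, hball⟩ := Metric.isOpen_iff.1 (hO.inter isOpen_Ioo) t ⟨htO, ht⟩
  set u := t + ε / 2 with hu
  have hIcc : Icc t u ⊆ O ∩ Ioo a b := fun y hy => hball (by
    rw [Metric.mem_ball, Real.dist_eq, abs_lt]
    constructor <;> linarith [hy.1, hy.2])
  have htu : t < u := by rw [hu]; linarith
  have hsub : Icc t u ⊆ Icc a b := fun y hy => Ioo_subset_Icc_self (hIcc hy).2
  have hcont := h.continuousOn.mono hsub
  have hne : φ t ≠ φ u := fun heq => htu.ne (h.injOn (hsub (left_mem_Icc.2 htu.le))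
    (hsub (right_mem_Icc.2 htu.le)) heq)
  have hivt := intermediate_value_uIcc (by rwa [uIcc_of_le htu.le])
  have h01 : uIcc (φ t) (φ u) ⊆ Icc 0 1 := (ordConnected_Icc.uIcc_subset
    (h.maps (hsub (left_mem_Icc.2 htu.le))) (h.maps (hsub (right_mem_Icc.2 htu.le))))
  have hpos : 0 < volume (((↑) : unitInterval → ℝ) ⁻¹' uIcc (φ t) (φ u)) := by
    have hmp : (volume : Measure unitInterval).map ((↑) : unitInterval → ℝ) =
        (volume : Measure ℝ).restrict (Icc 0 1) := map_comap_subtype_coe measurableSet_Icc _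
    rw [← Measure.map_apply measurable_subtype_coe measurableSet_uIcc, hmp,
      Measure.restrict_apply measurableSet_uIcc, inter_eq_left.2 h01, uIcc, Real.volume_Icc,
      ENNReal.ofReal_pos, sub_pos]
    exact inf_lt_sup.2 hne
  obtain ⟨τ, hτ1, hτ2⟩ := ((frequently_ae_mem_iff.2 hpos.ne').and_eventually hS).exists
  obtain ⟨y, hy, hyτ⟩ := hivt hτ1
  rw [uIcc_of_le htu.le] at hy
  exact ⟨y, (hIcc hy).1, (hIcc hy).2, τ, hτ2, hyτ.symm⟩

lemma lintegral_unitInterval_eq {θ : ℝ → ℝ} (hθ : IsDensity θ) (hi : Integrable θ) :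
    ∫⁻ t : unitInterval, ENNReal.ofReal (θ t) = ENNReal.ofReal (∫ t, θ t) := by
  have h1 : ∫⁻ t : unitInterval, ENNReal.ofReal (θ t) = ∫⁻ t in Icc (0 : ℝ) 1,
      ENNReal.ofReal (θ t) := by
    rw [← map_comap_subtype_coe measurableSet_Icc,
      (MeasurableEmbedding.subtype_coe measurableSet_Icc).lintegral_map]
    rfl
  rw [h1, ofReal_integral_eq_lintegral_ofReal hi (ae_of_all _ hθ.nonneg),
    setLIntegral_eq_of_support_subset]
  intro t ht
  by_contra hc
  exact ht (by simp [hθ.supp t hc])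

lemma lintegral_prod_cube {u : Fin n → unitInterval → ℝ≥0∞} (hu : ∀ i, Measurable (u i)) :
    ∫⁻ x : Cube n, ∏ i, u i (x i) = ∏ i, ∫⁻ t, u i t := by
  have hind := ProbabilityTheory.iIndepFun_pi (μ := fun _ : Fin n => (volume : Measure unitInterval))
    fun i => (hu i).aemeasurable
  rw [volume_pi, ProbabilityTheory.lintegral_prod_eq_prod_lintegral_of_indepFun _ _ hind
    fun i => (hu i).comp (measurable_pi_apply i)]
  refine Finset.prod_congr rfl fun i _ => ?_
  exact (measurePreserving_eval (fun _ : Fin n => (volume : Measure unitInterval)) i).lintegral_comp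
    (hu i)

/-- The operator is tested on the normalised indicator of `C`. The image is almost everywhere `1 /
3` times a product of one-dimensional densities, and the `i`-th of these, composed with the branch,
is the slope. Hence on almost every line in direction `i` any representative varies at least as much
as the slope, times the product of the other factors. The integral of that product is the product of
the other side lengths, at least `s ^ n` because `s ≤ 1`. -/
lemma ofReal_mul_variation_slope_le_bvOpNorm {f : JablonskiMap n} (hf : f.IsC2Monotone)
    (hγ : ∀ i, 0 < f.expansion i) (hm : Measurable f.toFun) {C : Rect n}
    (hC : ∃ B ∈ f.part.parts, C.toSet ⊆ B.toSet) {s : ℝ} (hs : 0 < s) (hs1 : s ≤ 1)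
    (hCs : ∀ i, s ≤ C.hi i - C.lo i) (i : Fin n) :
    ENNReal.ofReal (s ^ n / 3) * eVariationOn (f.slope C i) (ratIoo (C.lo i) (C.hi i)) ≤
      bvOpNorm (transfer f.toFun) := by
  classical
  obtain ⟨θ, hθ, hθi, hθint, hθeq, hmap⟩ := f.exists_density hf hγ hm hC
  have hT := transfer_bump hθ hmap
  obtain ⟨hb, -, -, H, hH, hlip⟩ := f.exists_branch hf hC i (hγ i)
  have hslope : Continuous (f.slope C i) :=
    (LipschitzWith.of_dist_le_mul (K := ⟨H, hH⟩) fun x y => hlip y x).continuous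
  set V := eVariationOn (f.slope C i) (ratIoo (C.lo i) (C.hi i)) with hV
  have h1 : dirVariation i (transfer f.toFun (bump C)) ≤ bvOpNorm (transfer f.toFun) :=
    ((le_iSup (fun i => dirVariation i (transfer f.toFun (bump C))) i).trans
      le_add_self).trans (le_iSup_of_le (bump C) (le_iSup_of_le (integrable_bump C)
        (le_iSup (fun _ => bvNorm (transfer f.toFun (bump C))) (bvNorm_bump_le C))))
  refine le_trans ?_ h1
  refine le_iInf fun g => le_iInf fun hg => le_iInf fun _ => ?_
  let cx : Cube n → ℝ := fun x => 1 / 3 * ∏ j ∈ Finset.univ.erase i, θ j (x j)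
  have hcx0 : ∀ x, 0 ≤ cx x := fun x =>
    mul_nonneg (by norm_num) (Finset.prod_nonneg fun j _ => (hθ j).nonneg _)
  have hline : ∀ᵐ x, ENNReal.ofReal (cx x) * V ≤ lineVariation i g x := by
    filter_upwards [ae_update (hg.trans hT) i] with x hx
    set G : unitInterval → ℝ := fun τ => g (Function.update x i τ) with hG
    -- The points of the side whose images hit places where the representative `g` agrees with the
    -- product formula on this line. They are dense, which suffices because the slope is continuous.
    set Y := {t | t ∈ Ioo (C.lo i) (C.hi i) ∧
      ∃ τ ∈ {τ : unitInterval | G τ = 1 / 3 * ∏ j, θ j (Function.update x i τ j)},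
        (τ : ℝ) = f.br C i t} with hY
    have hYd := hb.subset_closure (S := {τ : unitInterval |
      G τ = 1 / 3 * ∏ j, θ j (Function.update x i τ j)}) hx
    let Φ : ℝ → unitInterval := fun t => projIcc 0 1 zero_le_one (f.br C i t)
    have hYsub : Y ⊆ Icc (C.lo i) (C.hi i) := fun t ht => Ioo_subset_Icc_self ht.1
    have hΦ : eVariationOn (G ∘ Φ) Y ≤ eVariationOn G univ := by
      rcases hb.mono with h | h
      · exact eVariationOn.comp_le_of_monotoneOn G Φ (fun s hs t ht hst =>
          monotone_projIcc _ (h (hYsub hs) (hYsub ht) hst)) (mapsTo_univ _ _)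
      · exact eVariationOn.comp_le_of_antitoneOn G Φ (fun s hs t ht hst =>
          monotone_projIcc _ (h (hYsub hs) (hYsub ht) hst)) (mapsTo_univ _ _)
    have hcongr : eVariationOn (G ∘ Φ) Y = eVariationOn (fun t => cx x * f.slope C i t) Y := by
      refine eVariationOn.congr ?_
      rintro t ⟨ht, τ, hτ, hτt⟩
      have h2 : Φ t = τ := by
        simp only [Φ]
        rw [← hτt]
        exact projIcc_val _ _
      have h4 : G τ = 1 / 3 * ∏ j, θ j (Function.update x i τ j) := hτ
      rw [Function.comp, h2, h4]
      dsimp only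
      rw [← hθeq i t ht, ← hτt, ← Finset.mul_prod_erase _ _
        (Finset.mem_univ i)]
      simp only [cx, Function.update_self]
      have h3 : ∏ j ∈ Finset.univ.erase i, θ j (Function.update x i τ j) =
          ∏ j ∈ Finset.univ.erase i, θ j (x j) := Finset.prod_congr rfl fun j hj => by
        rw [Function.update_of_ne (Finset.ne_of_mem_erase hj)]
      rw [h3]
      ring
    calc ENNReal.ofReal (cx x) * V
        ≤ eVariationOn (fun t => cx x * f.slope C i t) (ratIoo (C.lo i) (C.hi i)) :=
          ofReal_mul_eVariationOn_le (hcx0 x)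
      _ ≤ eVariationOn (fun t => cx x * f.slope C i t) (Ioo (C.lo i) (C.hi i)) :=
          eVariationOn.mono _ inter_subset_left
      _ ≤ eVariationOn (fun t => cx x * f.slope C i t) Y :=
          eVariationOn_Ioo_le_of_dense (hslope.const_mul _).continuousOn hYd
      _ = eVariationOn (G ∘ Φ) Y := hcongr.symm
      _ ≤ _ := hΦ
  refine le_trans ?_ (lintegral_mono_ae hline)
  have hθm : ∀ j, Measurable fun x : Cube n => θ j (x j) := fun j =>
    (hθ j).meas.comp (measurable_subtype_coe.comp (measurable_pi_apply j))
  have hcm : Measurable fun x => ENNReal.ofReal (cx x) :=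
    ((Finset.measurable_prod _ fun j _ => hθm j).const_mul (1 / 3)).ennreal_ofReal
  rw [lintegral_mul_const _ hcm]
  gcongr
  have h2 : (fun x => ENNReal.ofReal (cx x)) = fun x => ENNReal.ofReal (1 / 3) *
      ∏ j, (if j = i then (fun _ => 1) else fun t : unitInterval => ENNReal.ofReal (θ j t)) (x j) := by
    ext x
    simp only [cx]
    rw [ENNReal.ofReal_mul (by norm_num), ENNReal.ofReal_prod_of_nonneg
      fun j _ => (hθ j).nonneg _, ← Finset.mul_prod_erase _ _ (Finset.mem_univ i), if_pos rfl,
      one_mul]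
    congr 1
    refine Finset.prod_congr rfl fun j hj => ?_
    rw [if_neg (Finset.ne_of_mem_erase hj)]
  have hmj : ∀ j, Measurable
      (if j = i then (fun _ => 1) else fun t : unitInterval => ENNReal.ofReal (θ j t)) := by
    intro j
    split_ifs
    · exact measurable_const
    · exact ((hθ j).meas.comp measurable_subtype_coe).ennreal_ofReal
  have hmj' : ∀ j, Measurable fun x : Cube n =>
      (if j = i then (fun _ => 1) else fun t : unitInterval => ENNReal.ofReal (θ j t)) (x j) :=
    fun j => (hmj j).comp (measurable_pi_apply j)
  rw [h2, lintegral_const_mul _ (Finset.measurable_prod _ fun j _ => hmj' j),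
    lintegral_prod_cube hmj]
  rw [div_eq_inv_mul, ENNReal.ofReal_mul (by norm_num), one_div]
  gcongr
  rw [ENNReal.ofReal_pow hs.le]
  calc ENNReal.ofReal s ^ n = ∏ _j : Fin n, ENNReal.ofReal s := by simp
    _ ≤ _ := by
      refine Finset.prod_le_prod' fun j _ => ?_
      split_ifs with hj
      · simpa using hs1
      · rw [lintegral_unitInterval_eq (hθ j) (hθi j), hθint]
        exact ENNReal.ofReal_le_ofReal (hCs j)

end

/-! ### Measurable control of a single map -/

section

variable {Ω : Type*} {n : ℕ}

/-- The hypotheses on a random Jabłoński map that are used below, with the common grid `Q`. -/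
structure Expanding [MeasurableSpace Ω] (P : Measure Ω) (σ : Ω ≃ᵐ Ω) (f : Ω → JablonskiMap n)
    (Q : RectPartition n) : Prop where
  one_le : 1 ≤ n
  ergodic : Ergodic σ P
  refines : ∀ ω, Q.Refines (f ω).part
  smooth : ∀ ω, (f ω).IsC2Monotone
  measurable : Measurable (skewProduct σ f)
  nonsingular : ∀ ω, Measure.QuasiMeasurePreserving (f ω).toFun volume volume
  pos : ∀ᵐ ω ∂P, ∀ i, 0 < (f ω).expansion i
  integrable : Integrable (fun ω => ⨅ i, Real.log ((f ω).expansion i)) P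
  integral_pos : 0 < ∫ ω, ⨅ i, Real.log ((f ω).expansion i) ∂P
  bounded : ∀ ω, generatorNorm f ω < ∞
  logIntegrable : LogIntegrable P f

lemma isOpen_cyl {lo hi : ℕ → ℝ} {φ : ℕ → ℝ → ℝ} (N : ℕ)
    (h : ∀ k < N, ContinuousOn (φ k) (Ioo (lo k) (hi k))) : IsOpen (cyl lo hi φ N) := by
  induction N generalizing lo hi φ with
  | zero => exact isOpen_univ
  | succ N ih =>
    exact (h 0 (by omega)).isOpen_inter_preimage isOpen_Ioo
      (ih (lo := fun k => lo (k + 1)) (hi := fun k => hi (k + 1)) (φ := fun k => φ (k + 1))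
        fun k hk => h (k + 1) (by omega))

lemma measurable_toFun [MeasurableSpace Ω] {σ : Ω → Ω} {f : Ω → JablonskiMap n}
    (hF : Measurable (skewProduct σ f)) (ω : Ω) : Measurable (f ω).toFun :=
  measurable_cyc hF 1 ω

lemma measurable_toFun_apply [MeasurableSpace Ω] {σ : Ω → Ω} {f : Ω → JablonskiMap n}
    (hF : Measurable (skewProduct σ f)) (x : Cube n) (i : Fin n) :
    Measurable fun ω => ((f ω).toFun x i : ℝ) :=
  measurable_subtype_coe.comp ((measurable_pi_apply i).comp
    (measurable_snd.comp (hF.comp measurable_prodMk_right)))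

/-- The components come with no measurability in `ω`, but the values of `f_ω` at fixed points do. At
an interior point the derivative is a limit of difference quotients of such values, taken along the
line through the corner of `C`. -/
lemma measurable_slope [MeasurableSpace Ω] {σ : Ω → Ω} {f : Ω → JablonskiMap n}
    (hF : Measurable (skewProduct σ f)) (hsm : ∀ ω, (f ω).IsC2Monotone) {C : Rect n}
    (hC : ∀ ω, ∃ B ∈ (f ω).part.parts, C.toSet ⊆ B.toSet) (i : Fin n) {t : ℝ}
    (ht : t ∈ Ioo (C.lo i) (C.hi i)) : Measurable fun ω => (f ω).slope C i t := by
  set d : Ω → ℝ := fun ω => derivWithin ((f ω).comp ((f ω).host C) i)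
    (Icc (((f ω).host C).lo i) (((f ω).host C).hi i)) t with hd
  have hslope : ∀ ω, (f ω).slope C i t = 1 / |d ω| := fun ω => by
    rw [JablonskiMap.slope, min_eq_right ht.2.le, max_eq_right ht.1.le]
  let pt : ℝ → Cube n := fun r => Function.update C.corner i (projIcc 0 1 zero_le_one r)
  have hpt : ∀ r ∈ Ioo (C.lo i) (C.hi i), pt r ∈ C.toSet ∧ (pt r i : ℝ) = r := by
    intro r hr
    have hr01 : r ∈ Icc (0 : ℝ) 1 :=
      ⟨(C.lo_nonneg i).trans hr.1.le, hr.2.le.trans (C.hi_le_one i)⟩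
    have h1 : (pt r i : ℝ) = r := by
      simp only [pt, Function.update_self]
      rw [projIcc_of_mem _ hr01]
    refine ⟨fun j => ?_, h1⟩
    by_cases hj : j = i
    · subst hj
      rw [h1]
      exact ⟨hr.1.le, Or.inl hr.2⟩
    · simp only [pt, Function.update_of_ne hj]
      exact C.corner_mem j
  have heq : ∀ ω, ∀ r ∈ Ioo (C.lo i) (C.hi i),
      ((f ω).toFun (pt r) i : ℝ) = (f ω).comp ((f ω).host C) i r := by
    intro ω r hr
    rw [JablonskiMap.toFun_eq_br (hC ω) (hpt r hr).1, (hpt r hr).2, JablonskiMap.br,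
      if_pos (Ioo_subset_Icc_self hr)]
  have hdm : Measurable d := by
    refine measurable_of_tendsto_metrizable (f := fun m : ℕ => fun ω =>
      (1 / ((m : ℝ) + 1))⁻¹ * (((f ω).toFun (pt (t + 1 / ((m : ℝ) + 1))) i : ℝ) -
        (f ω).toFun (pt t) i)) (fun m => ?_) ?_
    · exact ((measurable_toFun_apply hF _ i).sub (measurable_toFun_apply hF _ i)).const_mul _
    rw [tendsto_pi_nhds]
    intro ω
    obtain ⟨h1, h2⟩ := JablonskiMap.host_spec (hC ω)
    obtain ⟨hb1, hb2⟩ := Rect.bounds_of_subset h2 i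
    have hnhds : Icc (((f ω).host C).lo i) (((f ω).host C).hi i) ∈ 𝓝 t :=
      Icc_mem_nhds (hb1.trans_lt ht.1) (ht.2.trans_le hb2)
    have hda : HasDerivAt ((f ω).comp ((f ω).host C) i) (d ω) t :=
      ((((hsm ω _ h1 i).1.differentiableOn (by norm_num)) t (mem_of_mem_nhds hnhds)
        ).hasDerivWithinAt).hasDerivAt hnhds
    have hlim := hasDerivAt_iff_tendsto_slope_zero.1 hda
    have hz : Tendsto (fun m : ℕ => 1 / ((m : ℝ) + 1)) atTop (𝓝[≠] 0) := by
      refine tendsto_nhdsWithin_iff.2 ⟨tendsto_one_div_add_atTop_nhds_zero_nat,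
        Eventually.of_forall fun m => ?_⟩
      have : (0 : ℝ) < 1 / ((m : ℝ) + 1) := by positivity
      exact this.ne'
    refine (hlim.comp hz).congr' ?_
    have hlt : Tendsto (fun m : ℕ => t + 1 / ((m : ℝ) + 1)) atTop (𝓝 (t + 0)) :=
      tendsto_const_nhds.add tendsto_one_div_add_atTop_nhds_zero_nat
    rw [add_zero] at hlt
    filter_upwards [hlt.eventually (isOpen_Ioo.mem_nhds ht)] with m hm
    simp only [Function.comp]
    rw [heq ω _ hm, heq ω _ ht, smul_eq_mul]
  simp only [hslope]
  exact measurable_const.div (continuous_abs.measurable.comp hdm)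

lemma RectPartition.exists_min_side (Q : RectPartition n) :
    ∃ s : ℝ, 0 < s ∧ s ≤ 1 ∧ ∀ C ∈ Q.parts, ∀ i, s ≤ C.hi i - C.lo i := by
  by_cases hn : Nonempty (Fin n)
  · obtain ⟨C0, hC0⟩ := Q.parts_nonempty
    obtain ⟨p, hp, hmin⟩ := Finset.exists_min_image (Q.parts ×ˢ Finset.univ)
      (fun p : Rect n × Fin n => p.1.hi p.2 - p.1.lo p.2)
      ⟨(C0, hn.some), Finset.mem_product.2 ⟨hC0, Finset.mem_univ _⟩⟩
    refine ⟨p.1.hi p.2 - p.1.lo p.2, sub_pos.2 (p.1.lo_lt_hi _), ?_, fun C hC i =>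
      hmin (C, i) (Finset.mem_product.2 ⟨hC, Finset.mem_univ _⟩)⟩
    linarith [p.1.hi_le_one p.2, p.1.lo_nonneg p.2]
  · exact ⟨1, one_pos, le_rfl, fun C _ i => (hn ⟨i⟩).elim⟩

variable [MeasurableSpace Ω] {P : Measure Ω} {σ : Ω ≃ᵐ Ω} {f : Ω → JablonskiMap n}
  {Q : RectPartition n}

lemma exp_iInf_log_le {f : JablonskiMap n} (h : ∀ i, 0 < f.expansion i) (i : Fin n) :
    1 / f.expansion i ≤ Real.exp (-⨅ i, Real.log (f.expansion i)) := by
  rw [Real.exp_neg, one_div]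
  refine inv_anti₀ (Real.exp_pos _) ?_
  calc Real.exp (⨅ i, Real.log (f.expansion i)) ≤ Real.exp (Real.log (f.expansion i)) :=
        Real.exp_le_exp.2 (ciInf_le (finite_range _).bddBelow i)
    _ = _ := Real.exp_log (h i)

lemma le_exp_posLog (x : ℝ) : x ≤ Real.exp (Real.posLog x) := by
  rcases le_or_gt x 0 with h | h
  · exact h.trans (Real.exp_pos _).le
  · calc x = Real.exp (Real.log x) := (Real.exp_log h).symm
      _ ≤ _ := Real.exp_le_exp.2 (le_max_right _ _)

/-- Integrable bounds for the expansion and for the growth of families of densities in one step. -/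
lemma Expanding.exists_rates [IsProbabilityMeasure P] (h : Expanding P σ f Q) :
    ∃ m ℓ : Ω → ℝ, Measurable m ∧ Integrable m P ∧ 0 < ∫ ω, m ω ∂P ∧
      Measurable ℓ ∧ Integrable ℓ P ∧ (∀ ω, 0 ≤ ℓ ω) ∧ ∀ᵐ ω ∂P,
        (∀ C ∈ Q.parts, ∀ i, IsBranch (C.lo i) (C.hi i) ((f ω).br C i) ((f ω).slope C i) ∧
          (∀ t, (f ω).slope C i t ≤ Real.exp (-m ω)) ∧
          ∃ H, 0 ≤ H ∧ ∀ s t, |(f ω).slope C i t - (f ω).slope C i s| ≤ H * |t - s|) ∧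
        ∀ (μ : Measure (Cube n)) (z : ℝ), Fam (μ.map emb) z →
          Fam ((μ.map (f ω).toFun).map emb) (Real.exp (ℓ ω) * z) := by
  classical
  obtain ⟨s, hs, hs1, hsQ⟩ := Q.exists_min_side
  obtain ⟨m, hmm, hmeq⟩ := h.integrable.1
  replace hmm := hmm.measurable
  -- One number that dominates the variations of all slopes. The variation is taken over rational
  -- points to be measurable in `ω`.
  set V : Ω → ℝ≥0∞ := fun ω => ∑ p ∈ Q.parts ×ˢ Finset.univ,
    eVariationOn ((f ω).slope p.1 p.2) (ratIoo (p.1.lo p.2) (p.1.hi p.2)) with hV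
  have hVm : Measurable V := Finset.measurable_fun_sum _ fun p hp =>
    measurable_eVariationOn (countable_ratIoo _ _) fun t ht =>
      measurable_slope h.measurable h.smooth (fun ω => h.refines ω _ (Finset.mem_product.1 hp).1)
        _ ht.1
  set D : Ω → ℝ := fun ω => (V ω).toReal with hD
  have hDm : Measurable D := hVm.ennreal_toReal
  set a : ℝ := s ^ n / 3 with ha
  have ha0 : 0 < a := by positivity
  set b : ℝ := (Q.parts ×ˢ (Finset.univ : Finset (Fin n))).card / a with hb
  have hVle : ∀ᵐ ω ∂P, V ω ≤ ENNReal.ofReal b * generatorNorm f ω := by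
    filter_upwards [h.pos] with ω hω
    have h1 : ∀ p ∈ Q.parts ×ˢ (Finset.univ : Finset (Fin n)),
        eVariationOn ((f ω).slope p.1 p.2) (ratIoo (p.1.lo p.2) (p.1.hi p.2)) ≤
          ENNReal.ofReal a⁻¹ * generatorNorm f ω := by
      intro p hp
      have hpQ := (Finset.mem_product.1 hp).1
      have h2 := ofReal_mul_variation_slope_le_bvOpNorm (h.smooth ω) hω
        (measurable_toFun h.measurable ω) (h.refines ω _ hpQ) hs hs1 (hsQ _ hpQ) p.2
      calc eVariationOn ((f ω).slope p.1 p.2) (ratIoo (p.1.lo p.2) (p.1.hi p.2))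
          = ENNReal.ofReal a⁻¹ * (ENNReal.ofReal a *
            eVariationOn ((f ω).slope p.1 p.2) (ratIoo (p.1.lo p.2) (p.1.hi p.2))) := by
            rw [← mul_assoc, ← ENNReal.ofReal_mul (by positivity), inv_mul_cancel₀ ha0.ne',
              ENNReal.ofReal_one, one_mul]
        _ ≤ _ := by
            gcongr
            exact h2
    refine (Finset.sum_le_sum h1).trans ?_
    rw [Finset.sum_const, nsmul_eq_mul, ← mul_assoc, hb, div_eq_mul_inv,
      ENNReal.ofReal_mul (by positivity), ENNReal.ofReal_natCast]
  have hDle : ∀ᵐ ω ∂P, V ω ≠ ∞ ∧ D ω ≤ b * (generatorNorm f ω).toReal := by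
    filter_upwards [hVle] with ω hω
    have hfin : ENNReal.ofReal b * generatorNorm f ω ≠ ∞ :=
      ENNReal.mul_ne_top ENNReal.ofReal_ne_top (h.bounded ω).ne
    refine ⟨ne_top_of_le_ne_top hfin hω, ?_⟩
    have := ENNReal.toReal_mono hfin hω
    rwa [ENNReal.toReal_mul, ENNReal.toReal_ofReal (by positivity)] at this
  have hlogD : Integrable (fun ω => Real.posLog (D ω)) P := by
    have hmeas : Measurable fun ω => Real.posLog (D ω) :=
      measurable_const.max (Real.measurable_log.comp hDm)
    refine ⟨hmeas.aestronglyMeasurable, ?_⟩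
    rw [hasFiniteIntegral_iff_ofReal (ae_of_all _ fun ω => Real.posLog_nonneg)]
    calc ∫⁻ ω, ENNReal.ofReal (Real.posLog (D ω)) ∂P
        ≤ ∫⁻ ω, (ENNReal.ofReal (Real.posLog b) +
          ENNReal.ofReal (Real.posLog (generatorNorm f ω).toReal)) ∂P := by
          refine lintegral_mono_ae ?_
          filter_upwards [hDle] with ω hω
          rw [← ENNReal.ofReal_add Real.posLog_nonneg Real.posLog_nonneg]
          refine ENNReal.ofReal_le_ofReal ?_
          exact (Real.posLog_le_posLog ENNReal.toReal_nonneg hω.2).trans Real.posLog_mul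
      _ < ∞ := by
          rw [lintegral_add_left measurable_const, lintegral_const, measure_univ, mul_one]
          exact ENNReal.add_lt_top.2 ⟨ENNReal.ofReal_lt_top, h.logIntegrable⟩
  have hmi : Integrable m P := h.integrable.congr hmeq
  -- The one-step factor is `(3 + 2 / s) * (exp (-m) + D)`. Both terms of the sum are at most `exp
  -- (|m| + log⁺ D)`, whence the summand `log 2`.
  set c : ℝ := Real.posLog (3 + 2 / s) + Real.log 2 with hc
  refine ⟨m, fun ω => c + |m ω| + Real.posLog (D ω), hmm, hmi, ?_, ?_, ?_, ?_, ?_⟩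
  · rw [← integral_congr_ae hmeq]
    exact h.integral_pos
  · exact ((measurable_const.add (continuous_abs.measurable.comp hmm))).add
      (measurable_const.max (Real.measurable_log.comp hDm))
  · exact ((integrable_const _).add hmi.abs).add hlogD
  · intro ω
    have := Real.log_nonneg one_le_two
    have h2 : 0 ≤ Real.posLog (3 + 2 / s) := Real.posLog_nonneg
    have h3 : 0 ≤ Real.posLog (D ω) := Real.posLog_nonneg
    positivity
  · filter_upwards [hmeq, h.pos, hDle] with ω hmω hω hDω
    have hbr : ∀ C ∈ Q.parts, ∀ i,
        IsBranch (C.lo i) (C.hi i) ((f ω).br C i) ((f ω).slope C i) ∧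
          (∀ t, (f ω).slope C i t ≤ Real.exp (-m ω)) ∧
          ∃ H, 0 ≤ H ∧ ∀ s t, |(f ω).slope C i t - (f ω).slope C i s| ≤ H * |t - s| := by
      intro C hC i
      obtain ⟨h1, h2, -, h3⟩ := (f ω).exists_branch (h.smooth ω) (h.refines ω _ hC) i (hω i)
      refine ⟨h1, fun t => (h2 t).trans ?_, h3⟩
      rw [← hmω]
      exact exp_iInf_log_le hω i
    refine ⟨hbr, fun μ z hμ => ?_⟩
    have hz : 0 ≤ z := by
      refine le_trans ?_ (hμ.real_univ_le h.one_le)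
      exact ENNReal.toReal_nonneg
    have hDvar : ∀ C ∈ Q.parts, ∀ i, VarLE ((f ω).slope C i) (D ω) := by
      intro C hC i
      have hle : eVariationOn ((f ω).slope C i) (ratIoo (C.lo i) (C.hi i)) ≤ V ω :=
        Finset.single_le_sum_of_canonicallyOrdered (f := fun p : Rect n × Fin n =>
          eVariationOn ((f ω).slope p.1 p.2) (ratIoo (p.1.lo p.2) (p.1.hi p.2)))
          (i := (C, i)) (Finset.mem_product.2 ⟨hC, Finset.mem_univ i⟩)
      obtain ⟨-, -, H, hH, hlip⟩ := hbr C hC i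
      have hcont : Continuous ((f ω).slope C i) :=
        (LipschitzWith.of_dist_le_mul (K := ⟨H, hH⟩) fun x y => hlip y x).continuous
      refine (VarLE.of_eVariationOn (C.lo_lt_hi i) hcont.continuousOn (fun t => ?_)
        (ne_top_of_le_ne_top hDω.1 hle)).mono (ENNReal.toReal_mono hDω.1 hle)
      have hlh := (C.lo_lt_hi i).le
      have : max (C.lo i) (min (C.hi i) (max (C.lo i) (min (C.hi i) t))) =
          max (C.lo i) (min (C.hi i) t) := by
        rw [min_eq_right (max_le hlh (min_le_left _ _)), max_eq_right (le_max_left _ _)]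
      rw [JablonskiMap.slope, JablonskiMap.slope, this]
    have hD0 : 0 ≤ D ω := ENNReal.toReal_nonneg
    have key := hμ.map_toFun h.one_le h.measurable h.nonsingular h.refines hs hsQ
      (fun C hC i => (hbr C hC i).1) (Real.exp_pos _).le hD0 (fun C hC i => (hbr C hC i).2.1) hDvar
    refine Fam.mono key ?_
    refine mul_le_mul_of_nonneg_right ?_ hz
    have e1 : 3 + 2 / s ≤ Real.exp (Real.posLog (3 + 2 / s)) := le_exp_posLog _
    have e2 : Real.exp (-m ω) ≤ Real.exp (|m ω| + Real.posLog (D ω)) :=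
      Real.exp_le_exp.2 (by
        have h3 : 0 ≤ Real.posLog (D ω) := Real.posLog_nonneg
        linarith [neg_abs_le (m ω)])
    have e3 : D ω ≤ Real.exp (|m ω| + Real.posLog (D ω)) :=
      (le_exp_posLog _).trans (Real.exp_le_exp.2 (by linarith [abs_nonneg (m ω)]))
    calc (3 + 2 / s) * (Real.exp (-m ω) + D ω)
        ≤ Real.exp (Real.posLog (3 + 2 / s)) *
          (2 * Real.exp (|m ω| + Real.posLog (D ω))) := by
          refine mul_le_mul e1 (by linarith) ?_ (Real.exp_pos _).le
          exact add_nonneg (Real.exp_pos _).le ENNReal.toReal_nonneg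
      _ = Real.exp (c + |m ω| + Real.posLog (D ω)) := by
          rw [hc, Real.exp_add, Real.exp_add, Real.exp_add, Real.exp_add,
            Real.exp_log two_pos]
          ring

end

/-! ### Contraction over long blocks -/

section

variable {Ω : Type*} {n : ℕ} [MeasurableSpace Ω] {P : Measure Ω}

lemma integrable_birkhoffSum {T : Ω → Ω} (hT : MeasurePreserving T P P) {u : Ω → ℝ}
    (hu : Integrable u P) (N : ℕ) : Integrable (birkhoffSum T u N) P := by
  have : birkhoffSum T u N = ∑ k ∈ Finset.range N, u ∘ T^[k] := by
    ext ω
    simp [birkhoffSum]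
  rw [this]
  exact integrable_finsetSum' _ fun k _ => (hT.iterate k).integrable_comp_of_integrable hu

lemma integral_birkhoffSum {T : Ω → Ω} (hT : MeasurePreserving T P P) {u : Ω → ℝ}
    (hu : Integrable u P) (N : ℕ) : ∫ ω, birkhoffSum T u N ω ∂P = N * ∫ ω, u ω ∂P := by
  simp only [birkhoffSum]
  rw [integral_finsetSum _ fun k _ => (show Integrable (fun ω => u (T^[k] ω)) P from
    (hT.iterate k).integrable_comp_of_integrable hu)]
  have : ∀ k ∈ Finset.range N, ∫ ω, u (T^[k] ω) ∂P = ∫ ω, u ω ∂P := fun k _ => by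
    have h := hT.iterate k
    conv_rhs => rw [← h.map_eq]
    rw [integral_map h.measurable.aemeasurable (by rw [h.map_eq]; exact hu.1)]
  rw [Finset.sum_congr rfl this, Finset.sum_const, Finset.card_range, nsmul_eq_mul]

lemma measurable_birkhoffSum {T : Ω → Ω} (hT : Measurable T) {u : Ω → ℝ}
    (hu : Measurable u) (N : ℕ) : Measurable (birkhoffSum T u N) :=
  Finset.measurable_fun_sum _ fun k _ => hu.comp (hT.iterate k)

lemma ae_iterate {T : Ω → Ω} (hT : MeasurePreserving T P P) {p : Ω → Prop}
    (h : ∀ᵐ ω ∂P, p ω) : ∀ᵐ ω ∂P, ∀ k, p (T^[k] ω) :=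
  ae_all_iff.2 fun k => (hT.iterate k).quasiMeasurePreserving.ae h

variable {σ : Ω ≃ᵐ Ω} {f : Ω → JablonskiMap n} {Q : RectPartition n}

lemma map_cyc_add {T : Ω → Ω} (hF : Measurable (skewProduct T f)) (s t : ℕ) (ω : Ω)
    (μ : Measure (Cube n)) :
    μ.map (cyc T f (s + t) ω) = (μ.map (cyc T f t ω)).map (cyc T f s (T^[t] ω)) := by
  rw [Measure.map_map (measurable_cyc hF s _) (measurable_cyc hF t _)]
  congr 1
  ext1 x
  exact cyc_add s t ω x

lemma Fam.map_cyc_of_step {T : Ω → Ω} (hF : Measurable (skewProduct T f)) {ℓ : Ω → ℝ} {ω : Ω}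
    (h : ∀ k, ∀ (μ : Measure (Cube n)) (z : ℝ), Fam (μ.map emb) z →
      Fam ((μ.map (f (T^[k] ω)).toFun).map emb) (Real.exp (ℓ (T^[k] ω)) * z))
    (N : ℕ) {μ : Measure (Cube n)} {z : ℝ} (hμ : Fam (μ.map emb) z) :
    Fam ((μ.map (cyc T f N ω)).map emb) (Real.exp (birkhoffSum T ℓ N ω) * z) := by
  induction N with
  | zero =>
    have : cyc T f 0 ω = id := rfl
    simpa [this] using hμ
  | succ N ih =>
    rw [add_comm, map_cyc_add hF, add_comm 1 N, birkhoffSum_succ, add_comm (birkhoffSum T ℓ N ω),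
      Real.exp_add, mul_assoc]
    exact h N _ _ ih

/-- The set of points whose orbit passes through the rectangles `w 0, …, w (N-1)`. -/
def cylSet (T : Ω → Ω) (f : Ω → JablonskiMap n) {N : ℕ} (w : Fin N → Rect n) (ω : Ω) :
    Set (Cube n) :=
  {x | ∀ k, emb (cyc T f k ω x) ∈ (w k).openBox}

lemma measurable_volume_cylSet {T : Ω → Ω} (hF : Measurable (skewProduct T f)) {N : ℕ}
    (w : Fin N → Rect n) : Measurable fun ω => volume (cylSet T f w ω) := by
  refine measurable_measure_prodMk_left (ν := (volume : Measure (Cube n)))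
    (s := {p : Ω × Cube n | ∀ k : Fin N, emb ((skewProduct T f)^[k] p).2 ∈ (w k).openBox}) ?_
  rw [ofPred_forall]
  exact MeasurableSet.iInter fun k =>
    (measurable_emb.comp (measurable_snd.comp (hF.iterate k))) (w k).measurableSet_openBox

lemma volume_pi_side {Ω : Type*} {f : Ω → JablonskiMap n} {T : Ω → Ω}
    (hQ : ∀ ω, Q.Refines (f ω).part) {N : ℕ} (hN : 1 ≤ N) (ω : Ω)
    {W : ℕ → Rect n} (hW : ∀ k, W k ∈ Q.parts)
    (hm : ∀ i, ∀ k < N, Measurable ((f (T^[k] ω)).br (W k) i)) :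
    volume (univ.pi (side T f N ω W)) = volume (cylSet T f (fun k : Fin N => W k) ω) := by
  have hsub : univ.pi (side T f N ω W) ⊆ unitCube n := by
    intro y hy
    obtain ⟨M, rfl⟩ : ∃ M, N = M + 1 := ⟨N - 1, by omega⟩
    exact Rect.openBox_subset _ fun i => (hy i (mem_univ i)).1
  have hms : MeasurableSet (univ.pi (side T f N ω W)) :=
    MeasurableSet.univ_pi fun i => measurableSet_cyl N (hm i)
  rw [← volume_emb_preimage hms hsub]
  congr 1
  ext x
  refine (mem_cylinder_iff hQ N ω W hW x).symm.trans ?_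
  exact ⟨fun h k => h k k.2, fun h k hk => h ⟨k, hk⟩⟩

/-- The length `N` is chosen so that the mean expansion over a block beats the cutting factor: `N ∫
m > log 3`. The constants of the block estimate may fail to be integrable, so it is used only on the
set `G κ` where they are bounded by `κ`; elsewhere the one-step rates `ℓ` are multiplied along the
block. As `κ` grows, the sets `G κ` exhaust almost all of `Ω`, and dominated convergence brings the
mean of the logarithmic rate down to `log 3 - N ∫ m < 0`. -/
lemma Expanding.exists_block [IsProbabilityMeasure P] (h : Expanding P σ f Q) :
    ∃ N : ℕ, 1 ≤ N ∧ ∃ K : ℝ, 0 ≤ K ∧ ∃ u : Ω → ℝ, Measurable u ∧ Integrable u P ∧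
      ∫ ω, u ω ∂P < 0 ∧ ∀ᵐ ω ∂P, ∀ (μ : Measure (Cube n)) (z : ℝ), μ univ = 1 →
        Fam (μ.map emb) z →
          Fam ((μ.map (cyc σ f N ω)).map emb) (Real.exp (u ω) * z + K) := by
  classical
  obtain ⟨m, ℓ, hmm, hmi, hmpos, hℓm, hℓi, hℓ0, hstep⟩ := h.exists_rates
  have hmp := h.ergodic.toMeasurePreserving
  have hall := ae_iterate hmp hstep
  obtain ⟨N, hN⟩ : ∃ N : ℕ, Real.log 3 < N * ∫ ω, m ω ∂P := by
    obtain ⟨N, hN⟩ := exists_nat_gt (Real.log 3 / ∫ ω, m ω ∂P)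
    exact ⟨N, by rwa [div_lt_iff₀ hmpos] at hN⟩
  have hN1 : 1 ≤ N := by
    by_contra! h0
    obtain rfl : N = 0 := by omega
    have := Real.log_nonneg (show (1 : ℝ) ≤ 3 by norm_num)
    norm_num at hN
    linarith
  -- the sets on which all the constants are controlled
  let G : ℕ → Set Ω := fun κ => {ω |
    (∀ k ∈ Finset.range N, Real.exp (-m (σ^[k] ω)) ≤ κ) ∧
    (∀ k ∈ Finset.range N, ∀ C ∈ Q.parts, ∀ i, ∀ s ∈ ratIoo (C.lo i) (C.hi i),
      ∀ t ∈ ratIoo (C.lo i) (C.hi i),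
      |(f (σ^[k] ω)).slope C i t - (f (σ^[k] ω)).slope C i s| ≤ κ * |t - s|) ∧
    ∀ w : Fin N → Q.parts, volume (cylSet σ f (fun k => (w k).1) ω) = 0 ∨
      ENNReal.ofReal (1 / κ) ≤ volume (cylSet σ f (fun k => (w k).1) ω)}
  have hσk : ∀ k, Measurable (σ^[k]) := fun k => σ.measurable.iterate k
  have hG : ∀ κ, MeasurableSet (G κ) := by
    intro κ
    have e1 : MeasurableSet {ω | ∀ k ∈ Finset.range N, Real.exp (-m (σ^[k] ω)) ≤ κ} := by
      rw [ofPred_forall]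
      refine MeasurableSet.iInter fun k => ?_
      rw [ofPred_forall]
      exact MeasurableSet.iInter fun _ => measurableSet_le
        (Real.measurable_exp.comp (hmm.comp (hσk k)).neg) measurable_const
    have e2 : MeasurableSet {ω | ∀ k ∈ Finset.range N, ∀ C ∈ Q.parts, ∀ i,
        ∀ s ∈ ratIoo (C.lo i) (C.hi i), ∀ t ∈ ratIoo (C.lo i) (C.hi i),
        |(f (σ^[k] ω)).slope C i t - (f (σ^[k] ω)).slope C i s| ≤ κ * |t - s|} := by
      rw [ofPred_forall]
      refine MeasurableSet.iInter fun k => ?_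
      rw [ofPred_forall]
      refine MeasurableSet.iInter fun _ => ?_
      have : {ω | ∀ C ∈ Q.parts, ∀ i, ∀ s ∈ ratIoo (C.lo i) (C.hi i),
          ∀ t ∈ ratIoo (C.lo i) (C.hi i),
          |(f (σ^[k] ω)).slope C i t - (f (σ^[k] ω)).slope C i s| ≤ κ * |t - s|} =
          ⋂ C ∈ Q.parts, ⋂ i, ⋂ s ∈ ratIoo (C.lo i) (C.hi i), ⋂ t ∈ ratIoo (C.lo i) (C.hi i),
            {ω | |(f (σ^[k] ω)).slope C i t - (f (σ^[k] ω)).slope C i s| ≤ κ * |t - s|} := by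
        ext ω
        simp only [mem_iInter]
        rfl
      rw [this]
      refine Q.parts.measurableSet_biInter fun C hC => MeasurableSet.iInter fun i =>
        MeasurableSet.biInter (countable_ratIoo _ _) fun s hs =>
        MeasurableSet.biInter (countable_ratIoo _ _) fun t ht => measurableSet_le ?_
          measurable_const
      have hms : ∀ t ∈ ratIoo (C.lo i) (C.hi i), Measurable fun ω =>
          (f (σ^[k] ω)).slope C i t := fun t ht =>
        (measurable_slope h.measurable h.smooth (fun ω => h.refines ω _ hC) i ht.1).comp (hσk k)
      exact continuous_abs.measurable.comp ((hms t ht).sub (hms s hs))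
    have e3 : MeasurableSet {ω | ∀ w : Fin N → Q.parts,
        volume (cylSet σ f (fun k => (w k).1) ω) = 0 ∨
          ENNReal.ofReal (1 / κ) ≤ volume (cylSet σ f (fun k => (w k).1) ω)} := by
      rw [ofPred_forall]
      refine MeasurableSet.iInter fun w => ?_
      have hmv := measurable_volume_cylSet h.measurable fun k => (w k).1
      exact (hmv (measurableSet_singleton 0)).union (measurableSet_le measurable_const hmv)
    exact e1.inter (e2.inter e3)
  have hGev : ∀ᵐ ω ∂P, ∀ᶠ κ in atTop, ω ∈ G κ := by
    filter_upwards [hall] with ω hω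
    refine ((Finset.eventually_all _).2 fun k hk => ?_).and
      (((Finset.eventually_all _).2 fun k hk => (Finset.eventually_all _).2 fun C hC =>
        eventually_all.2 fun i => ?_).and (eventually_all.2 fun w => ?_))
    · filter_upwards [eventually_ge_atTop ⌈Real.exp (-m (σ^[k] ω))⌉₊] with κ hκ
      exact (Nat.le_ceil _).trans (by exact_mod_cast hκ)
    · obtain ⟨-, -, H, hH, hlip⟩ := (hω k).1 C hC i
      filter_upwards [eventually_ge_atTop ⌈H⌉₊] with κ hκ
      intro s _ t _
      refine (hlip s t).trans (mul_le_mul_of_nonneg_right ?_ (abs_nonneg _))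
      exact (Nat.le_ceil _).trans (by exact_mod_cast hκ)
    · by_cases h0 : volume (cylSet σ f (fun k => (w k).1) ω) = 0
      · exact Eventually.of_forall fun κ => Or.inl h0
      · have hfin : volume (cylSet σ f (fun k => (w k).1) ω) ≠ ∞ := measure_ne_top _ _
        have hpos := ENNReal.toReal_pos h0 hfin
        filter_upwards [eventually_ge_atTop
          ⌈1 / (volume (cylSet σ f (fun k => (w k).1) ω)).toReal⌉₊, eventually_ge_atTop 1]
          with κ hκ hκ1
        right
        rw [ENNReal.ofReal_le_iff_le_toReal hfin]
        have hκ1' : (0 : ℝ) < κ := by exact_mod_cast hκ1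
        rw [div_le_comm₀ hκ1' hpos]
        exact (Nat.le_ceil _).trans (by exact_mod_cast hκ)
  let S := birkhoffSum σ m N
  let SL := birkhoffSum σ ℓ N
  have hSm : Measurable S := measurable_birkhoffSum σ.measurable hmm N
  have hSLm : Measurable SL := measurable_birkhoffSum σ.measurable hℓm N
  have hSi : Integrable S P := integrable_birkhoffSum hmp hmi N
  have hSLi : Integrable SL P := integrable_birkhoffSum hmp hℓi N
  -- The logarithmic rate of the estimate in force: long block on `G κ`, product of single steps off
  -- it. Both choices are integrable, which provides the dominating function.
  let u : ℕ → Ω → ℝ := fun κ => (G κ).piecewise (fun ω => Real.log 3 - S ω) SL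
  have hum : ∀ κ, Measurable (u κ) := fun κ =>
    Measurable.piecewise (hG κ) (measurable_const.sub hSm) hSLm
  have hbd : ∀ κ, ∀ᵐ ω ∂P, ‖u κ ω‖ ≤ |Real.log 3 - S ω| + |SL ω| := by
    intro κ
    refine ae_of_all _ fun ω => ?_
    by_cases hω : ω ∈ G κ
    · simp only [u, piecewise_eq_of_mem _ _ _ hω, Real.norm_eq_abs]
      linarith [abs_nonneg (SL ω)]
    · simp only [u, piecewise_eq_of_notMem _ _ _ hω, Real.norm_eq_abs]
      linarith [abs_nonneg (Real.log 3 - S ω)]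
  have hbi : Integrable (fun ω => |Real.log 3 - S ω| + |SL ω|) P :=
    ((integrable_const _).sub hSi).abs.add hSLi.abs
  have hlim : Tendsto (fun κ => ∫ ω, u κ ω ∂P) atTop (𝓝 (∫ ω, (Real.log 3 - S ω) ∂P)) := by
    refine tendsto_integral_of_dominated_convergence _ (fun κ => (hum κ).aestronglyMeasurable)
      hbi hbd ?_
    filter_upwards [hGev] with ω hω
    refine tendsto_const_nhds.congr' ?_
    filter_upwards [hω] with κ hκ
    simp only [u, piecewise_eq_of_mem _ _ _ hκ]
  have hneg : ∫ ω, (Real.log 3 - S ω) ∂P < 0 := by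
    rw [integral_sub (integrable_const _) hSi, integral_birkhoffSum hmp hmi]
    simpa using hN
  obtain ⟨κ, hκneg, hκ1⟩ := ((hlim.eventually_lt_const hneg).and (eventually_ge_atTop 1)).exists
  have hκr : (1 : ℝ) ≤ κ := by exact_mod_cast hκ1
  refine ⟨N, hN1, κ ^ N * (2 / (1 / κ)) + N * κ ^ N, by positivity, u κ, hum κ,
    hbi.mono' (hum κ).aestronglyMeasurable (hbd κ), hκneg, ?_⟩
  filter_upwards [hall] with ω hω μ z hμ1 hμ
  by_cases hωG : ω ∈ G κ
  · have hprod : ∏ k ∈ Finset.range N, Real.exp (-m (σ^[k] ω)) = Real.exp (-S ω) := by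
      rw [← Real.exp_sum, Finset.sum_neg_distrib]
      rfl
    have hprodle : Real.exp (-S ω) ≤ κ ^ N := by
      rw [← hprod]
      calc ∏ k ∈ Finset.range N, Real.exp (-m (σ^[k] ω)) ≤ ∏ _k ∈ Finset.range N, (κ : ℝ) :=
            Finset.prod_le_prod (fun _ _ => (Real.exp_pos _).le) hωG.1
        _ = _ := by simp
    have key := hμ.map_cyc_block h.measurable h.nonsingular h.refines hN1 (ω := ω)
      (g := fun k C i => (f (σ^[k] ω)).slope C i) (Λ := fun k => Real.exp (-m (σ^[k] ω)))
      (κ := κ) (η := 1 / κ) hκr (by positivity)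
      (fun k _ C hC i => ((hω k).1 C hC i).1) (fun k _ => (Real.exp_pos _).le)
      (fun k _ C hC i => ((hω k).1 C hC i).2.1) (fun k hk => hωG.1 k (Finset.mem_range.2 hk))
      ?_ ?_
    · refine Fam.mono key ?_
      have h1 : μ.real univ = 1 := by rw [Measure.real, hμ1, ENNReal.toReal_one]
      have h2 : 3 * Real.exp (-S ω) = Real.exp (u κ ω) := by
        simp only [u, piecewise_eq_of_mem _ _ _ hωG]
        rw [sub_eq_add_neg, Real.exp_add, Real.exp_log three_pos]
      rw [hprod, h1, mul_one, h2]
      gcongr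
    · intro k hk C hC i s t
      obtain ⟨-, -, H, hH, hlip⟩ := (hω k).1 C hC i
      have hcont : Continuous ((f (σ^[k] ω)).slope C i) :=
        (LipschitzWith.of_dist_le_mul (K := ⟨H, hH⟩) fun x y => hlip y x).continuous
      refine lipschitz_of_rat (C.lo_lt_hi i) hcont.continuousOn (fun t => ?_) (by positivity)
        (hωG.2.1 k (Finset.mem_range.2 hk) C hC i) s t
      have hlh := (C.lo_lt_hi i).le
      rw [JablonskiMap.slope, JablonskiMap.slope,
        min_eq_right (max_le hlh (min_le_left (C.hi i) t)),
        max_eq_right (le_max_left (C.lo i) (min (C.hi i) t))]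
    · intro W hW hne
      -- A nonempty cylinder is open and has positive volume. On `G κ` a volume is zero or at least
      -- `1 / κ`, so the second alternative holds.
      have hopen : IsOpen (univ.pi (side σ f N ω W)) := isOpen_set_pi finite_univ fun i _ =>
        isOpen_cyl N fun k _ => ((hω k).1 _ (hW k) i).1.continuousOn.mono Ioo_subset_Icc_self
      have hpos := hopen.measure_pos volume hne
      rw [volume_pi_side h.refines hN1 ω hW
        fun i k _ => ((hω k).1 _ (hW k) i).1.meas] at hpos ⊢
      exact (hωG.2.2 fun k => ⟨W k, hW k⟩).resolve_left hpos.ne'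
  · have key := Fam.map_cyc_of_step h.measurable (fun k => (hω k).2) N hμ
    refine Fam.mono key ?_
    have : u κ ω = SL ω := by simp only [u, piecewise_eq_of_notMem _ _ _ hωG]
    rw [this]
    have h3 : 0 ≤ κ ^ N * (2 / (1 / (κ : ℝ))) + N * κ ^ N := by positivity
    simp only [SL]
    linarith

end

/-! ### A maximal ergodic lemma, and tightness of the backward products -/

section

variable {Ω : Type*} {n : ℕ} [MeasurableSpace Ω] {P : Measure Ω}

/-- If `∫ u < 0`, the Birkhoff sums of `u` are bounded above on a set of positive measure. -/
lemma exists_birkhoffSum_le [IsProbabilityMeasure P] {T : Ω → Ω} (hT : MeasurePreserving T P P)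
    {u : Ω → ℝ} (hum : Measurable u) (hu : Integrable u P) (hneg : ∫ ω, u ω ∂P < 0) :
    ∃ b : ℝ, 0 < P {ω | ∀ k, birkhoffSum T u k ω ≤ b} := by
  -- The maximum of `0` and the first `k` Birkhoff sums, generated by its recursion.
  let M : ℕ → Ω → ℝ := fun k => Nat.rec (fun _ => 0) (fun _ m ω => max 0 (u ω + m (T ω))) k
  have hM0 : ∀ ω, M 0 ω = 0 := fun _ => rfl
  have hMs : ∀ k ω, M (k + 1) ω = max 0 (u ω + M k (T ω)) := fun _ _ => rfl
  have hMnn : ∀ k ω, 0 ≤ M k ω := by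
    rintro (_ | k) ω
    · exact le_rfl
    · exact le_max_left _ _
  have hMm : ∀ k, Measurable (M k) := by
    intro k
    induction k with
    | zero => exact measurable_const
    | succ k ih => exact measurable_const.max (hum.add (ih.comp hT.measurable))
  have hMi : ∀ k, Integrable (M k) P := by
    intro k
    induction k with
    | zero => exact integrable_zero _ _ _
    | succ k ih =>
      exact (integrable_zero _ _ _).sup (hu.add (hT.integrable_comp_of_integrable ih))
  have hmono : ∀ k ω, M k ω ≤ M (k + 1) ω := by
    intro k
    induction k with
    | zero => exact fun ω => hMnn 1 ω
    | succ k ih =>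
      intro ω
      rw [hMs, hMs (k + 1)]
      exact max_le_max le_rfl (add_le_add_right (ih _) _)
  have hmono' : ∀ ω, Monotone fun k => M k ω := fun ω => monotone_nat_of_le_succ fun k => hmono k ω
  have hS : ∀ k ω, birkhoffSum T u k ω ≤ M k ω := by
    intro k
    induction k with
    | zero => intro ω; simp [hM0]
    | succ k ih =>
      intro ω
      rw [birkhoffSum_succ', hMs]
      exact (add_le_add_right (ih _) _).trans (le_max_right _ _)
  by_contra! hcon
  have h0 : ∀ b : ℕ, ∀ᵐ ω ∂P, ∃ k, (b : ℝ) < M k ω := by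
    intro b
    have h1 : P {ω | ∀ k, birkhoffSum T u k ω ≤ b} = 0 := le_antisymm (hcon b) zero_le
    filter_upwards [measure_eq_zero_iff_ae_notMem.1 h1] with ω hω
    by_contra! h2
    exact hω fun k => (hS k ω).trans (h2 k)
  have htop : ∀ᵐ ω ∂P, Tendsto (fun k => M k ω) atTop atTop := by
    filter_upwards [ae_all_iff.2 h0] with ω hω
    refine tendsto_atTop_atTop_of_monotone (hmono' ω) fun b => ?_
    obtain ⟨k, hk⟩ := hω ⌈b⌉₊
    exact ⟨k, (Nat.le_ceil b).trans hk.le⟩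
  have htopT : ∀ᵐ ω ∂P, Tendsto (fun k => M k (T ω)) atTop atTop :=
    hT.quasiMeasurePreserving.ae htop
  have hMTm : ∀ k, Measurable fun ω => M k (T ω) := fun k => (hMm k).comp hT.measurable
  have hMTi : ∀ k, Integrable (fun ω => M k (T ω)) P := fun k =>
    hT.integrable_comp_of_integrable (hMi k)
  -- If the sums were almost surely unbounded, the truncation at `0` in the recursion would
  -- eventually disappear and `M (k + 1) - M k ∘ T` would converge to `u`, dominated by `|u|`. By
  -- invariance its integral is that of `M (k + 1) - M k ≥ 0`, which contradicts `∫ u < 0`.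
  have hlim : Tendsto (fun k => ∫ ω, (M (k + 1) ω - M k (T ω)) ∂P) atTop (𝓝 (∫ ω, u ω ∂P)) := by
    refine tendsto_integral_of_dominated_convergence (fun ω => |u ω|)
      (fun k => ((hMm (k + 1)).sub (hMTm k)).aestronglyMeasurable) hu.abs
      (fun k => ae_of_all _ fun ω => ?_) ?_
    · rw [hMs, Real.norm_eq_abs, abs_le]
      have h1 := hMnn k (T ω)
      constructor
      · linarith [neg_abs_le (u ω), le_max_right 0 (u ω + M k (T ω))]
      · rw [sub_le_iff_le_add]
        exact max_le (by positivity) (by linarith [le_abs_self (u ω)])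
    · filter_upwards [htopT] with ω hω
      refine tendsto_const_nhds.congr' ?_
      filter_upwards [hω.eventually_ge_atTop (-u ω)] with k hk
      rw [hMs, max_eq_right (by linarith)]
      ring
  have hge : 0 ≤ ∫ ω, u ω ∂P := by
    refine ge_of_tendsto' hlim fun k => ?_
    have h1 : ∫ ω, M k (T ω) ∂P = ∫ ω, M k ω ∂P := by
      conv_rhs => rw [← hT.map_eq]
      rw [integral_map hT.measurable.aemeasurable (by rw [hT.map_eq]; exact (hMi k).1)]
    rw [integral_sub (hMi (k + 1)) (hMTi k), h1, sub_nonneg]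
    exact integral_mono (hMi k) (hMi (k + 1)) (hmono k)
  linarith

variable {σ : Ω ≃ᵐ Ω} {f : Ω → JablonskiMap n} {Q : RectPartition n}

lemma map_cyc_univ {T : Ω → Ω} (hF : Measurable (skewProduct T f)) (k : ℕ) (ω : Ω)
    (μ : Measure (Cube n)) : μ.map (cyc T f k ω) univ = μ univ := by
  rw [Measure.map_apply (measurable_cyc hF k ω) MeasurableSet.univ, preimage_univ]

/-- The block estimates are composed backwards from the arrival point. The maximal lemma for
`σ^{-N}` and the rate raised by a small `ε` gives a set of arrival points whose backward sums are at
most `b - ε j` for all `j` at once. The initial variation is then damped exponentially, uniformly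
over this set, and the additive constants form a convergent geometric series. -/
lemma Expanding.tight [IsProbabilityMeasure P] (h : Expanding P σ f Q) :
    ∃ N : ℕ, 1 ≤ N ∧ ∃ ε b K : ℝ, 0 < ε ∧ 0 ≤ K ∧ ∃ S : Set Ω, MeasurableSet S ∧ 0 < P S ∧
      ∀ (j : ℕ) (ω : Ω), σ^[j * N] ω ∈ S → ∀ (μ : Measure (Cube n)) (z : ℝ), μ univ = 1 →
        Fam (μ.map emb) z →
          Fam ((μ.map (cyc σ f (j * N) ω)).map emb) (Real.exp (b - ε * j) * z + K) := by
  obtain ⟨N, hN, K, hK, u, hum, hui, huneg, hblock⟩ := h.exists_block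
  have hmp := h.ergodic.toMeasurePreserving
  set T : Ω → Ω := σ.symm^[N] with hTdef
  have hT : MeasurePreserving T P P := (MeasurePreserving.symm σ hmp).iterate N
  set ε : ℝ := -(∫ ω, u ω ∂P) / 2 with hε
  have hεpos : 0 < ε := by rw [hε]; linarith
  set u' : Ω → ℝ := fun ω => u (T ω) + ε with hu'
  have hucomp : Integrable (fun ω => u (T ω)) P := hT.integrable_comp_of_integrable hui
  have hint : ∫ ω, u' ω ∂P = (∫ ω, u ω ∂P) / 2 := by
    have h1 : ∫ ω, u (T ω) ∂P = ∫ ω, u ω ∂P := by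
      conv_rhs => rw [← hT.map_eq]
      rw [integral_map hT.measurable.aemeasurable (by rw [hT.map_eq]; exact hui.1)]
    rw [integral_add hucomp (integrable_const _), h1, integral_const, hε]
    simp
    ring
  obtain ⟨b, hb⟩ := exists_birkhoffSum_le hT ((hum.comp hT.measurable).add_const ε)
    (hucomp.add (integrable_const ε)) (show ∫ ω, u' ω ∂P < 0 by rw [hint]; linarith)
  have hblockT := ae_iterate hT hblock
  -- The second set removes a measurable null set that contains every `ω` for which the block
  -- estimate fails somewhere on the backward orbit. The estimate thus holds for every `ω` arriving
  -- in `S`, not merely almost every one.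
  set S := {ω | ∀ k, birkhoffSum T u' k ω ≤ b} ∩ (toMeasurable P {ω | ¬ ∀ k,
    ∀ (μ : Measure (Cube n)) (z : ℝ), μ univ = 1 → Fam (μ.map emb) z →
      Fam ((μ.map (cyc σ f N (T^[k] ω))).map emb) (Real.exp (u (T^[k] ω)) * z + K)})ᶜ with hS
  have hσT : ∀ ω, σ^[N] (T ω) = ω := fun ω =>
    (show Function.LeftInverse σ σ.symm from σ.apply_symm_apply).iterate N ω
  have hTσ : ∀ ω, T (σ^[N] ω) = ω := fun ω =>
    (show Function.LeftInverse σ.symm σ from σ.symm_apply_apply).iterate N ω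
  have hbS : ∀ (k : ℕ) (ω : Ω), birkhoffSum T (fun ω => u (T ω)) k ω =
      birkhoffSum T u' k ω - ε * k := by
    intro k ω
    simp only [birkhoffSum, hu', Finset.sum_add_distrib, Finset.sum_const, Finset.card_range,
      nsmul_eq_mul]
    ring
  refine ⟨N, hN, ε, b, K * (Real.exp b * (1 - Real.exp (-ε))⁻¹), hεpos, ?_, S, ?_, ?_, ?_⟩
  · have : Real.exp (-ε) < 1 := Real.exp_lt_one_iff.2 (by linarith)
    have h2 : 0 < 1 - Real.exp (-ε) := by linarith
    positivity
  · refine MeasurableSet.inter ?_ (measurableSet_toMeasurable _ _).compl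
    rw [ofPred_forall]
    exact MeasurableSet.iInter fun k => measurableSet_le
      (measurable_birkhoffSum hT.measurable ((hum.comp hT.measurable).add_const ε) k)
      measurable_const
  · rw [hS, measure_inter_conull (by rw [compl_compl, measure_toMeasurable]; exact hblockT)]
    exact hb
  -- The earliest block is applied first and the induction hypothesis handles the remaining `j`, so
  -- a constant `K` created `i` blocks before arrival is multiplied by the rates of just those `i`
  -- blocks.
  · have hmain : ∀ (j : ℕ) (ω : Ω), (∀ k, ∀ (μ : Measure (Cube n)) (z : ℝ), μ univ = 1 →
        Fam (μ.map emb) z → Fam ((μ.map (cyc σ f N (T^[k] ω))).map emb)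
          (Real.exp (u (T^[k] ω)) * z + K)) → ∀ (μ : Measure (Cube n)) (z : ℝ), μ univ = 1 →
        Fam (μ.map emb) z → Fam ((μ.map (cyc σ f (j * N) (T^[j] ω))).map emb)
          (Real.exp (birkhoffSum T (fun ω => u (T ω)) j ω) * z +
            K * ∑ i ∈ Finset.range j, Real.exp (birkhoffSum T (fun ω => u (T ω)) i ω)) := by
      intro j ω hω
      induction j with
      | zero =>
        intro μ z _ hμ
        have : cyc σ f (0 * N) (T^[0] ω) = id := by rw [zero_mul]; rfl
        rw [this, Measure.map_id]
        simpa using hμ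
      | succ j ih =>
        intro μ z hμ1 hμ
        have h1 := hω (j + 1) μ z hμ1 hμ
        have h2 := ih _ _ (by rw [map_cyc_univ h.measurable, hμ1]) h1
        have h3 : T^[j] ω = σ^[N] (T^[j + 1] ω) := by
          rw [Function.iterate_succ_apply', hσT]
        rw [add_mul, one_mul, map_cyc_add h.measurable, ← h3]
        refine Fam.mono h2 (le_of_eq ?_)
        rw [Finset.sum_range_succ, birkhoffSum_succ, Real.exp_add,
          ← Function.iterate_succ_apply' T]
        ring
    intro j ω hω μ z hμ1 hμ
    set ω' := σ^[j * N] ω with hω'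
    have hback : ω = T^[j] ω' := by
      have h1 : σ^[j * N] = (σ^[N])^[j] := by rw [mul_comm, Function.iterate_mul]
      rw [hω', h1]
      exact ((show Function.LeftInverse T (σ^[N]) from hTσ).iterate j ω).symm
    have hgood := hω.2
    have hgood' : ∀ k, ∀ (μ : Measure (Cube n)) (z : ℝ), μ univ = 1 →
        Fam (μ.map emb) z → Fam ((μ.map (cyc σ f N (T^[k] ω'))).map emb)
          (Real.exp (u (T^[k] ω')) * z + K) := by
      by_contra hc
      exact hgood (subset_toMeasurable _ _ hc)
    have key := hmain j ω' hgood' μ z hμ1 hμ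
    rw [← hback] at key
    have hz : 0 ≤ z := ENNReal.toReal_nonneg.trans (hμ.real_univ_le h.one_le)
    have hle : ∀ k : ℕ, birkhoffSum T (fun ω => u (T ω)) k ω' ≤ b - ε * k := fun k => by
      rw [hbS]
      linarith [hω.1 k]
    refine Fam.mono key (add_le_add ?_ ?_)
    · exact mul_le_mul_of_nonneg_right (Real.exp_le_exp.2 (hle j)) hz
    · refine mul_le_mul_of_nonneg_left ?_ hK
      calc ∑ i ∈ Finset.range j, Real.exp (birkhoffSum T (fun ω => u (T ω)) i ω')
          ≤ ∑ i ∈ Finset.range j, Real.exp b * Real.exp (-ε) ^ i := by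
            refine Finset.sum_le_sum fun i _ => ?_
            rw [← Real.exp_nat_mul, ← Real.exp_add]
            refine Real.exp_le_exp.2 ((hle i).trans (le_of_eq ?_))
            ring
        _ = Real.exp b * ∑ i ∈ Finset.range j, Real.exp (-ε) ^ i := by rw [Finset.mul_sum]
        _ ≤ _ := by
            refine mul_le_mul_of_nonneg_left ?_ (Real.exp_pos _).le
            have h1 : Real.exp (-ε) < 1 := Real.exp_lt_one_iff.2 (by linarith)
            rw [← tsum_geometric_of_lt_one (Real.exp_pos _).le h1]
            exact (summable_geometric_of_lt_one (Real.exp_pos _).le h1).sum_le_tsum _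
              fun i _ => by positivity

end

/-! ### Density cubes -/

section

variable {n : ℕ}

lemma gridBox_subset_unitCube {K : ℕ} (k : Fin n → Fin K) :
    gridBox K (fun i => (k i : ℕ)) ⊆ unitCube n := by
  intro x hx i _
  have hK : (0 : ℝ) < K := by exact_mod_cast (Nat.zero_le _).trans_lt (k i).2
  have h := hx i (mem_univ i)
  refine ⟨(div_nonneg (Nat.cast_nonneg _) hK.le).trans h.1.le, h.2.le.trans ?_⟩
  rw [div_le_one hK]
  exact_mod_cast (k i).2

lemma volume_gridBox {K : ℕ} (hK : 0 < K) (k : Fin n → ℕ) :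
    volume (gridBox K k) = ENNReal.ofReal (((K : ℝ) ^ n)⁻¹) := by
  have hK' : (0 : ℝ) < K := by exact_mod_cast hK
  rw [gridBox, Real.volume_pi_Ioo]
  have : ∀ i : Fin n, ENNReal.ofReal (((k i : ℝ) + 1) / K - (k i : ℝ) / K) =
      ENNReal.ofReal ((K : ℝ)⁻¹) := fun i => by
    congr 1
    field_simp
    ring
  rw [Finset.prod_congr rfl fun i _ => this i, Finset.prod_const, Finset.card_univ,
    Fintype.card_fin, ← ENNReal.ofReal_pow (by positivity), inv_pow]

/-- The uniform distribution on a cube of the regular grid. -/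
lemma exists_measure_gridBox {K : ℕ} (k : Fin n → Fin K) (hK : 0 < K) :
    ∃ μ : Measure (Cube n), μ univ = 1 ∧ Fam (μ.map emb) (2 * K) ∧
      ∀ B, MeasurableSet B → μ B =
        ENNReal.ofReal ((K : ℝ) ^ n) * volume (emb ⁻¹' gridBox K (fun i => (k i : ℕ)) ∩ B) := by
  classical
  have hK' : (0 : ℝ) < K := by exact_mod_cast hK
  set U := gridBox K (fun i => (k i : ℕ)) with hU
  have hUm : MeasurableSet U := measurableSet_gridBox _ _
  have hUs : U ⊆ unitCube n := gridBox_subset_unitCube k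
  let ρ : Fin n → ℝ → ℝ := fun i =>
    (Ioo ((k i : ℕ) / (K : ℝ)) (((k i : ℕ) + 1) / (K : ℝ))).indicator fun _ => (K : ℝ)
  have hlt : ∀ i, ((k i : ℕ) : ℝ) / K < ((k i : ℕ) + 1) / K := fun i => by
    gcongr
    linarith
  have hρ : ∀ i, IsDensity (ρ i) := fun i =>
    ⟨fun t => indicator_nonneg (fun _ _ => hK'.le) _,
      measurable_const.indicator measurableSet_Ioo, fun t ht => indicator_of_notMem (fun h => by
        refine ht ⟨(div_nonneg (Nat.cast_nonneg _) hK'.le).trans h.1.le, h.2.le.trans ?_⟩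
        rw [div_le_one hK']
        exact_mod_cast (k i).2) _⟩
  have hv : ∀ i, VarLE (ρ i) (2 * K) := fun i => varLE_indicator_Ioo (hlt i) hK'.le
  have hi : ∀ i, Integrable (ρ i) := fun i => (hρ i).integrable (hv i)
  have hmass : ∀ i, (den (ρ i)).real univ = 1 := fun i => by
    rw [den_real_univ (hρ i) (hi i), integral_indicator measurableSet_Ioo, setIntegral_const,
      Measure.real, Real.volume_Ioo, ENNReal.toReal_ofReal (by linarith [hlt i]), smul_eq_mul]
    field_simp
    ring
  have hpi : Measure.pi (fun i => den (ρ i)) =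
      ENNReal.ofReal ((K : ℝ) ^ n) • (volume : Measure (Fin n → ℝ)).restrict U := by
    rw [pi_den hρ hi]
    have : (fun x : Fin n → ℝ => ENNReal.ofReal (∏ i, ρ i (x i))) =
        U.indicator fun _ => ENNReal.ofReal ((K : ℝ) ^ n) := by
      ext x
      by_cases hx : x ∈ U
      · rw [indicator_of_mem hx]
        congr 1
        calc ∏ i, ρ i (x i) = ∏ _i : Fin n, (K : ℝ) :=
              Finset.prod_congr rfl fun i _ => indicator_of_mem (hx i (mem_univ i)) _
          _ = _ := by simp
      · rw [indicator_of_notMem hx]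
        have : ∃ i, x i ∉ Ioo ((k i : ℕ) / (K : ℝ)) (((k i : ℕ) + 1) / (K : ℝ)) := by
          by_contra! hc
          exact hx fun i _ => hc i
        obtain ⟨i, hi⟩ := this
        rw [Finset.prod_eq_zero (Finset.mem_univ i) (indicator_of_notMem hi _),
          ENNReal.ofReal_zero]
    rw [this, withDensity_indicator hUm, withDensity_const]
  have hmap : (ENNReal.ofReal ((K : ℝ) ^ n) •
      (volume : Measure (Cube n)).restrict (emb ⁻¹' U)).map emb =
      Measure.pi (fun i => den (ρ i)) := by
    rw [hpi, Measure.map_smul, ← Measure.restrict_map measurable_emb hUm, map_emb,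
      Measure.restrict_restrict hUm, inter_eq_left.2 hUs]
  refine ⟨ENNReal.ofReal ((K : ℝ) ^ n) • (volume : Measure (Cube n)).restrict (emb ⁻¹' U),
    ?_, ?_, fun B hB => ?_⟩
  · rw [Measure.smul_apply, Measure.restrict_apply MeasurableSet.univ, univ_inter,
      volume_emb_preimage hUm hUs, hU, volume_gridBox hK, smul_eq_mul,
      ← ENNReal.ofReal_mul (by positivity), mul_inv_cancel₀ (by positivity), ENNReal.ofReal_one]
  · rw [hmap]
    refine ⟨Unit, inferInstance, fun _ i => den (ρ i), fun _ _ => 2 * K,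
      fun _ i => ⟨ρ i, hρ i, hv i, rfl⟩, by simp, fun i => ?_⟩
    simp [hmass]
  · rw [Measure.smul_apply, Measure.restrict_apply hB, smul_eq_mul, inter_comm]

/-- A set of positive measure nearly fills a cube of some regular grid. -/
lemma exists_gridBox_diff_le {B : Set (Cube n)} (hB : MeasurableSet B) (hpos : volume B ≠ 0)
    {ε : ℝ} (hε : 0 < ε) :
    ∃ K : ℕ, 0 < K ∧ ∃ k : Fin n → Fin K,
      volume (emb ⁻¹' gridBox K (fun i => (k i : ℕ)) ∩ Bᶜ) ≤ ENNReal.ofReal (ε / (K : ℝ) ^ n) := by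
  set S : Set (Fin n → ℝ) := emb '' B with hS
  have hSm : MeasurableSet S := measurableEmbedding_emb.measurableSet_image.2 hB
  have hSu : S ⊆ unitCube n := by
    rintro _ ⟨x, -, rfl⟩
    exact emb_mem x
  have hSv : volume S = volume B := by
    rw [← volume_emb_preimage hSm hSu, preimage_image_eq _ emb_injective]
  have hae := IsUnifLocDoublingMeasure.ae_tendsto_measure_inter_div
    (volume : Measure (Fin n → ℝ)) S 1
  -- Points with a coordinate `1` are discarded, so that rounding down always gives one of the `j +
  -- 1` indices of the grid.
  have hne1 : ∀ᵐ x : Fin n → ℝ ∂volume.restrict S, ∀ i, x i ≠ 1 := by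
    rw [ae_all_iff]
    intro i
    exact ae_restrict_of_ae (Measure.ae_eval_ne (μ := fun _ : Fin n => (volume : Measure ℝ)) i 1)
  have hSr : (volume : Measure (Fin n → ℝ)).restrict S ≠ 0 := by
    rw [Ne, Measure.restrict_eq_zero, hSv]
    exact hpos
  have : NeBot (ae ((volume : Measure (Fin n → ℝ)).restrict S)) := ae_neBot.2 hSr
  obtain ⟨x, hx, hx1, hxS⟩ := (hae.and (hne1.and (ae_restrict_mem hSm))).exists
  have hx01 : ∀ i, 0 ≤ x i ∧ x i < 1 := fun i =>
    ⟨(hSu hxS i (mem_univ i)).1, lt_of_le_of_ne (hSu hxS i (mem_univ i)).2 (hx1 i)⟩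
  -- The centre of the grid cube of mesh `1 / (j + 1)` around `x`. In the sup metric the closed cube
  -- is the ball of radius `δ j`, so Lebesgue's density theorem for balls that merely contain `x`
  -- applies.
  let w : ℕ → Fin n → ℝ := fun j i => (⌊x i * (j + 1)⌋₊ + 1 / 2) / (j + 1)
  let δ : ℕ → ℝ := fun j => 1 / 2 * (1 / ((j : ℝ) + 1))
  have hδpos : ∀ j, 0 < δ j := fun j => by positivity
  have hδ : Tendsto δ atTop (𝓝[>] 0) := by
    refine tendsto_nhdsWithin_iff.2 ⟨?_, Eventually.of_forall hδpos⟩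
    have := (tendsto_one_div_add_atTop_nhds_zero_nat (𝕜 := ℝ)).const_mul (1 / 2)
    rwa [mul_zero] at this
  have hmem : ∀ j, x ∈ Metric.closedBall (w j) (1 * δ j) := by
    intro j
    rw [one_mul, Metric.mem_closedBall, dist_pi_le_iff (hδpos j).le]
    intro i
    have hj : (0 : ℝ) < j + 1 := by positivity
    have h1 := Nat.floor_le (mul_nonneg (hx01 i).1 hj.le)
    have h2 := Nat.lt_floor_add_one (x i * ((j : ℝ) + 1))
    rw [Real.dist_eq, abs_le]
    simp only [w, δ]
    constructor
    · rw [← sub_nonneg]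
      have : x i - ((⌊x i * ((j : ℝ) + 1)⌋₊ : ℝ) + 1 / 2) / (j + 1) - -(1 / 2 * (1 / ((j : ℝ) + 1)))
        = (x i * (j + 1) - ⌊x i * ((j : ℝ) + 1)⌋₊) / (j + 1) := by
          field_simp
          ring
      rw [this]
      exact div_nonneg (by linarith) hj.le
    · rw [← sub_nonneg]
      have : 1 / 2 * (1 / ((j : ℝ) + 1)) - (x i - ((⌊x i * ((j : ℝ) + 1)⌋₊ : ℝ) + 1 / 2) / (j + 1))
        = (⌊x i * ((j : ℝ) + 1)⌋₊ + 1 - x i * (j + 1)) / (j + 1) := by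
          field_simp
          ring
      rw [this]
      exact div_nonneg (by linarith) hj.le
  have hlim := hx w δ hδ (Eventually.of_forall hmem)
  set e : ℝ := min ε (1 / 2) with he
  have he0 : 0 < e := lt_min hε (by norm_num)
  have he1 : e < 1 := (min_le_right _ _).trans_lt (by norm_num)
  obtain ⟨j, hj⟩ := (hlim.eventually_const_le (u := ENNReal.ofReal (1 - e)) (by
    rw [ENNReal.ofReal_lt_one]; linarith)).exists
  have hfl : ∀ i, ⌊x i * ((j : ℝ) + 1)⌋₊ < j + 1 := fun i => by
    rw [Nat.floor_lt (mul_nonneg (hx01 i).1 (by positivity))]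
    push_cast
    exact mul_lt_of_lt_one_left (by positivity) (hx01 i).2
  refine ⟨j + 1, by omega, fun i => ⟨⌊x i * ((j : ℝ) + 1)⌋₊, hfl i⟩, ?_⟩
  set k : Fin n → Fin (j + 1) := fun i => ⟨⌊x i * ((j : ℝ) + 1)⌋₊, hfl i⟩ with hk
  set U := gridBox (j + 1) (fun i => (k i : ℕ)) with hU
  have hUm : MeasurableSet U := measurableSet_gridBox _ _
  have hUs : U ⊆ unitCube n := gridBox_subset_unitCube k
  have hUball : U ⊆ Metric.closedBall (w j) (δ j) := by
    intro y hy
    rw [Metric.mem_closedBall, dist_pi_le_iff (hδpos j).le]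
    intro i
    have h1 := hy i (mem_univ i)
    simp only [hk] at h1
    push_cast at h1
    have hj : (0 : ℝ) < j + 1 := by positivity
    have e1 : w j i - δ j = (⌊x i * ((j : ℝ) + 1)⌋₊ : ℝ) / (j + 1) := by
      simp only [w, δ]; field_simp; ring
    have e2 : w j i + δ j = ((⌊x i * ((j : ℝ) + 1)⌋₊ : ℝ) + 1) / (j + 1) := by
      simp only [w, δ]; field_simp; ring
    rw [Real.dist_eq, abs_le]
    constructor <;> linarith [h1.1, h1.2]
  have hball : volume (Metric.closedBall (w j) (δ j)) =
      ENNReal.ofReal ((((j : ℝ) + 1) ^ n)⁻¹) := by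
    rw [Real.volume_pi_closedBall _ (hδpos j).le, Fintype.card_fin, ← inv_pow]
    congr 2
    simp only [δ]
    field_simp
  have hballfin : volume (Metric.closedBall (w j) (δ j)) ≠ ∞ := by rw [hball]; simp
  have hball0 : volume (Metric.closedBall (w j) (δ j)) ≠ 0 := by
    rw [hball, Ne, ENNReal.ofReal_eq_zero, not_le]
    positivity
  rw [ENNReal.le_div_iff_mul_le (Or.inl hball0) (Or.inl hballfin)] at hj
  have hmeasB : emb ⁻¹' U ∩ Bᶜ = emb ⁻¹' (U \ S) := by
    ext y
    simp only [mem_inter_iff, mem_preimage, mem_compl_iff, Set.mem_sdiff, hS,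
      emb_injective.mem_set_image]
  rw [hmeasB, volume_emb_preimage (hUm.diff hSm) (sdiff_subset.trans hUs)]
  calc volume (U \ S) ≤ volume (Metric.closedBall (w j) (δ j) \ S) :=
        measure_mono (sdiff_subset_sdiff_left hUball)
    _ = volume (Metric.closedBall (w j) (δ j)) -
        volume (S ∩ Metric.closedBall (w j) (δ j)) := by
        rw [← measure_sdiff inter_subset_right
          (hSm.inter Metric.isClosed_closedBall.measurableSet).nullMeasurableSet
          (ne_top_of_le_ne_top hballfin (measure_mono inter_subset_right))]
        congr 1
        ext y
        simp only [Set.mem_sdiff, mem_inter_iff]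
        tauto
    _ ≤ volume (Metric.closedBall (w j) (δ j)) - ENNReal.ofReal (1 - e) *
        volume (Metric.closedBall (w j) (δ j)) := by gcongr
    _ ≤ ENNReal.ofReal (ε / ((j + 1 : ℕ) : ℝ) ^ n) := by
        rw [hball, ← ENNReal.ofReal_mul (by linarith), ← ENNReal.ofReal_sub _ (by
          have : (0 : ℝ) ≤ 1 - e := by linarith
          positivity)]
        refine ENNReal.ofReal_le_ofReal ?_
        push_cast
        rw [div_eq_mul_inv]
        have h1 : 0 ≤ (((j : ℝ) + 1) ^ n)⁻¹ := by positivity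
        have h2 : e ≤ ε := min_le_left _ _
        nlinarith

end

/-! ### Invariant sets contain open boxes -/

section

variable {Ω : Type*} {n : ℕ} [MeasurableSpace Ω] {P : Measure Ω} {σ : Ω ≃ᵐ Ω}
  {f : Ω → JablonskiMap n} {Q : RectPartition n}

/-- The fibre of `A` over `ω`. -/
def fibre (A : Set (Ω × Cube n)) (ω : Ω) : Set (Cube n) := {x | (ω, x) ∈ A}

lemma measurableSet_fibre {A : Set (Ω × Cube n)} (hA : MeasurableSet A) (ω : Ω) :
    MeasurableSet (fibre A ω) := measurable_prodMk_left hA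

lemma preimage_cyc_fibre {Ω : Type*} {f : Ω → JablonskiMap n} {T : Ω → Ω}
    {A : Set (Ω × Cube n)} (hA : skewProduct T f ⁻¹' A = A) (k : ℕ) (ω : Ω) : cyc T f k ω ⁻¹' fibre A (T^[k] ω) = fibre A ω := by
  have h : (skewProduct T f)^[k] ⁻¹' A = A := by
    induction k with
    | zero => rfl
    | succ k ih => rw [Function.iterate_succ, preimage_comp, ih, hA]
  ext x
  have h2 : (skewProduct T f)^[k] (ω, x) ∈ A ↔ (ω, x) ∈ A := by
    conv_rhs => rw [← h]
    rfl
  rw [iterate_skewProduct] at h2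
  exact h2

/-- Almost all fibres of an invariant set of positive measure have positive measure. -/
lemma Expanding.ae_fibre_ne_zero [IsProbabilityMeasure P] (h : Expanding P σ f Q)
    {A : Set (Ω × Cube n)} (hA : MeasurableSet A) (hinv : skewProduct σ f ⁻¹' A = A)
    (hpos : P.prod volume A ≠ 0) : ∀ᵐ ω ∂P, volume (fibre A ω) ≠ 0 := by
  have hm : Measurable fun ω => volume (fibre A ω) := measurable_measure_prodMk_left hA
  set Z : Set Ω := {ω | volume (fibre A ω) ≠ 0} with hZ
  have hZm : MeasurableSet Z := (hm (measurableSet_singleton 0)).compl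
  -- The fibre over `ω` is the preimage of the fibre over `σ ω`; by nonsingularity it is null if the
  -- latter is. Ergodicity then decides.
  have hsub : Z ⊆ σ ⁻¹' Z := by
    intro ω hω h0
    refine hω ?_
    have h1 := preimage_cyc_fibre hinv 1 ω
    rw [← h1]
    exact (quasiMeasurePreserving_cyc h.nonsingular 1 ω).preimage_null h0
  rcases h.ergodic.ae_empty_or_univ_of_ae_le_preimage hZm.nullMeasurableSet
    (Eventually.of_forall hsub) with h1 | h1
  · exfalso
    apply hpos
    rw [Measure.measure_prod_null hA]
    filter_upwards [h1] with ω hω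
    by_contra hc
    exact (hω.mp hc : ω ∈ (∅ : Set Ω))
  · filter_upwards [h1] with ω hω
    exact hω.mpr trivial

/-- Over a set of positive measure, every invariant set of positive measure contains, up to a null
set, one of finitely many open cubes. -/
lemma Expanding.exists_openBox [IsProbabilityMeasure P] (h : Expanding P σ f Q) :
    ∃ S : Set Ω, MeasurableSet S ∧ 0 < P S ∧ ∃ K : ℕ, 0 < K ∧
      ∀ A : Set (Ω × Cube n), MeasurableSet A → skewProduct σ f ⁻¹' A = A →
        P.prod volume A ≠ 0 → ∀ᵐ ω ∂P, ω ∈ S → ∃ k : Fin n → Fin K,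
          volume (emb ⁻¹' gridBox K (fun i => (k i : ℕ)) ∩ (fibre A ω)ᶜ) = 0 := by
  obtain ⟨N, hN, ε, b, K', hε, hK', S, hS, hSpos, htight⟩ := h.tight
  -- The mesh depends only on `1 + K'`, the variation left after a long time, and not on the
  -- invariant set.
  obtain ⟨K, hK⟩ := exists_nat_gt (2 * (((n : ℝ) + 1) * (1 + K')))
  have hK0 : 0 < K := by
    have : (0 : ℝ) < K := lt_of_le_of_lt (by positivity) hK
    exact_mod_cast this
  refine ⟨S, hS, hSpos, K, hK0, fun A hA hinv hpos => ?_⟩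
  have hσk : ∀ k, MeasurePreserving (σ^[k]) P P := fun k => h.ergodic.toMeasurePreserving.iterate k
  let V : (L : ℕ) → (Fin n → ℕ) → Ω → ℝ≥0∞ := fun L k ω =>
    volume (emb ⁻¹' gridBox L k ∩ (fibre A ω)ᶜ)
  have hVm : ∀ L k, Measurable (V L k) := by
    intro L k
    have hms : MeasurableSet {p : Ω × Cube n | emb p.2 ∈ gridBox L k ∧ p ∉ A} :=
      ((measurable_emb.comp measurable_snd) (measurableSet_gridBox L k)).inter hA.compl
    exact measurable_measure_prodMk_left hms
  -- for most `ω`, the fibre almost fills one of finitely many cubes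
  let E : ℕ → ℕ → Set Ω := fun p L => ⋃ l ∈ Finset.Icc 1 L, ⋃ k : Fin n → Fin l,
    {ω | V l (fun i => k i) ω ≤ ENNReal.ofReal ((1 / 2) ^ p / (l : ℝ) ^ n)}
  have hEm : ∀ p L, MeasurableSet (E p L) := fun p L =>
    Finset.measurableSet_biUnion _ fun l _ => MeasurableSet.iUnion fun k =>
      measurableSet_le (hVm _ _) measurable_const
  have hEmono : ∀ p, Monotone (E p) := fun p L L' hL =>
    biUnion_subset_biUnion_left fun l hl => by
      simp only [Finset.coe_Icc, mem_Icc] at hl ⊢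
      exact ⟨hl.1, hl.2.trans hL⟩
  have hEfull : ∀ p, ∀ᵐ ω ∂P, ω ∈ ⋃ L, E p L := by
    intro p
    filter_upwards [h.ae_fibre_ne_zero hA hinv hpos] with ω hω
    obtain ⟨l, hl, k, hk⟩ := exists_gridBox_diff_le (measurableSet_fibre hA ω) hω
      (show (0 : ℝ) < (1 / 2) ^ p by positivity)
    refine mem_iUnion.2 ⟨l, mem_biUnion (x := l) ?_ (mem_iUnion.2 ⟨k, hk⟩)⟩
    exact Finset.mem_Icc.2 ⟨hl, le_rfl⟩
  have hEex : ∀ p : ℕ, ∃ L, P (E p L)ᶜ ≤ ENNReal.ofReal ((1 / 2) ^ p) := by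
    intro p
    have h1 : Tendsto (fun L => P (E p L)ᶜ) atTop (𝓝 (P (⋂ L, (E p L)ᶜ))) :=
      tendsto_measure_iInter_atTop (fun L => (hEm p L).compl.nullMeasurableSet)
        (fun L L' hL => compl_subset_compl.2 (hEmono p hL)) ⟨0, measure_ne_top _ _⟩
    have h2 : P (⋂ L, (E p L)ᶜ) = 0 := by
      rw [← compl_iUnion]
      exact hEfull p
    rw [h2] at h1
    exact (h1.eventually_le_const (ENNReal.ofReal_pos.2 (by positivity))).exists
  choose L hL using hEex
  -- At stage `p` the starting cubes have mesh at least `1 / L p` and so variation at most `2 * L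
  -- p`. Going back `j p` blocks reduces this to at most `1` on arrival in `S`.
  have hjex : ∀ p : ℕ, ∃ j : ℕ, Real.exp (b - ε * j) * (2 * L p) ≤ 1 := by
    intro p
    have h1 : Tendsto (fun j : ℕ => Real.exp (b - ε * j) * (2 * L p)) atTop
        (𝓝 (0 * (2 * L p))) := by
      refine Tendsto.mul_const _ (Real.tendsto_exp_atBot.comp ?_)
      refine tendsto_const_nhds.add_atBot (tendsto_neg_atTop_atBot.comp ?_)
      exact tendsto_natCast_atTop_atTop.const_mul_atTop hε
    rw [zero_mul] at h1
    exact (h1.eventually_le_const one_pos).exists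
  choose j hj using hjex
  -- The arrival points whose `p`-th starting point has no sufficiently filled cube of mesh at least
  -- `1 / L p`. Their measures are summable by invariance, so Borel–Cantelli leaves only finitely
  -- many bad stages almost surely.
  let B : ℕ → Set Ω := fun p => (σ.symm^[j p * N]) ⁻¹' (E p (L p))ᶜ
  have hBsum : ∑' p, P (B p) ≠ ∞ := by
    have hle : ∀ p, P (B p) ≤ ENNReal.ofReal ((1 / 2) ^ p) := fun p => by
      have hmp := (MeasurePreserving.symm σ h.ergodic.toMeasurePreserving).iterate (j p * N)
      rw [hmp.measure_preimage (hEm _ _).compl.nullMeasurableSet]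
      exact hL p
    refine ne_top_of_le_ne_top ?_ (ENNReal.tsum_le_tsum hle)
    exact (summable_geometric_of_lt_one (by norm_num) (by norm_num)).tsum_ofReal_ne_top
  filter_upwards [ae_eventually_notMem hBsum] with ω hω hωS
  have hbox : ∀ᶠ p in atTop, ∃ k : Fin n → Fin K, V K (fun i => k i) ω ≤
      ENNReal.ofReal (2 ^ n * ((n + 1) * (1 / 2) ^ p)) := by
    filter_upwards [hω] with p hp
    set ω' := σ.symm^[j p * N] ω with hω'
    have hback : σ^[j p * N] ω' = ω :=
      (show Function.LeftInverse σ σ.symm from σ.apply_symm_apply).iterate (j p * N) ω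
    have hp' : ω' ∈ E p (L p) := not_not.1 hp
    obtain ⟨l, hl, k, hk⟩ : ∃ l ∈ Finset.Icc 1 (L p), ∃ k : Fin n → Fin l,
        V l (fun i => k i) ω' ≤ ENNReal.ofReal ((1 / 2) ^ p / (l : ℝ) ^ n) := by
      have h1 : ∃ l ∈ Finset.Icc 1 (L p), ∃ k : Fin n → Fin l, ω' ∈
          {ω | V l (fun i => k i) ω ≤ ENNReal.ofReal ((1 / 2) ^ p / (l : ℝ) ^ n)} := by
        simpa only [E, mem_iUnion, exists_prop] using hp'
      exact h1
    rw [Finset.mem_Icc] at hl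
    have hl0 : (0 : ℝ) < l := by exact_mod_cast hl.1
    obtain ⟨μ, hμ1, hμ, hμB⟩ := exists_measure_gridBox k hl.1
    have hfam := htight (j p) ω' (by rw [hback]; exact hωS) μ _ hμ1 hμ
    have hz : Real.exp (b - ε * (j p : ℕ)) * (2 * l) + K' ≤ 1 + K' := by
      refine add_le_add_left (le_trans ?_ (hj p)) K'
      have : (l : ℝ) ≤ L p := by exact_mod_cast hl.2
      gcongr
    replace hfam := Fam.mono hfam hz
    have hcm := measurable_cyc h.measurable (j p * N) ω'
    set μ' := μ.map (cyc σ f (j p * N) ω') with hμ'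
    have hmA := measurableSet_fibre hA
    have hμ'A : μ' (fibre A ω)ᶜ ≤ ENNReal.ofReal ((1 / 2) ^ p) := by
      rw [hμ', Measure.map_apply hcm (hmA ω).compl, preimage_compl]
      have := preimage_cyc_fibre hinv (j p * N) ω'
      rw [hback] at this
      rw [this, hμB _ (hmA ω').compl]
      calc ENNReal.ofReal ((l : ℝ) ^ n) * V l (fun i => k i) ω'
          ≤ ENNReal.ofReal ((l : ℝ) ^ n) * ENNReal.ofReal ((1 / 2) ^ p / (l : ℝ) ^ n) := by
            gcongr
        _ = ENNReal.ofReal ((1 / 2) ^ p) := by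
            rw [← ENNReal.ofReal_mul (by positivity), mul_div_cancel₀ _ (by positivity)]
    have hEim : MeasurableSet (emb '' (fibre A ω)ᶜ) :=
      measurableEmbedding_emb.measurableSet_image.2 (hmA ω).compl
    obtain ⟨k', hk'⟩ := hfam.exists_gridBox h.one_le
      (by rw [Measure.map_apply measurable_emb MeasurableSet.univ, preimage_univ, hμ',
        map_cyc_univ h.measurable, hμ1])
      (show (0 : ℝ) < (1 / 2) ^ p by positivity) hEim
      (by rw [Measure.map_apply measurable_emb hEim, preimage_image_eq _ emb_injective]
          exact hμ'A) hK
    refine ⟨k', le_trans (le_of_eq ?_) hk'⟩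
    rw [← volume_emb_preimage ((measurableSet_gridBox _ _).inter hEim)
      (inter_subset_left.trans (gridBox_subset_unitCube k')), preimage_inter,
      preimage_image_eq _ emb_injective]
  -- There are finitely many cubes of mesh `1 / K`, so one of them serves infinitely many stages;
  -- the part of it outside the fibre is then smaller than every error bound.
  obtain ⟨k, hk⟩ : ∃ k : Fin n → Fin K, ∃ᶠ p in atTop, V K (fun i => k i) ω ≤
      ENNReal.ofReal (2 ^ n * ((n + 1) * (1 / 2) ^ p)) := by
    by_contra! hc
    obtain ⟨p, hp1, k, hp2⟩ := ((eventually_all.2 hc).and hbox).exists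
    exact (hp1 k).not_ge hp2
  refine ⟨k, ?_⟩
  have hlim : Tendsto (fun p : ℕ => ENNReal.ofReal (2 ^ n * ((n + 1) * (1 / 2) ^ p))) atTop
      (𝓝 0) := by
    rw [← ENNReal.ofReal_zero]
    refine ENNReal.tendsto_ofReal ?_
    have := ((tendsto_pow_atTop_nhds_zero_of_lt_one (r := (1 / 2 : ℝ)) (by norm_num)
      (by norm_num)).const_mul ((n : ℝ) + 1)).const_mul (2 ^ n)
    simpa using this
  exact le_antisymm (ge_of_tendsto_of_frequently hlim hk) zero_le

end

/-! ### Growth of boxes -/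

section

variable {n : ℕ}

/-- The volume of a rectangle. -/
def Rect.vol (R : Rect n) : ℝ := ∏ i, (R.hi i - R.lo i)

lemma Rect.vol_pos (R : Rect n) : 0 < R.vol :=
  Finset.prod_pos fun i _ => sub_pos.2 (R.lo_lt_hi i)

lemma Rect.vol_le_one (R : Rect n) : R.vol ≤ 1 :=
  Finset.prod_le_one (fun i _ => sub_nonneg.2 (R.lo_lt_hi i).le) fun i _ => by
    linarith [R.lo_nonneg i, R.hi_le_one i]

lemma Rect.isOpen_openBox (R : Rect n) : IsOpen R.openBox := by
  rw [R.openBox_eq]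
  exact isOpen_set_pi finite_univ fun _ _ => isOpen_Ioo

/-- The image of a rectangle under an affine-like branch contains a rectangle that is larger by the
factor `γ`, up to null sets. -/
lemma JablonskiMap.exists_image {f : JablonskiMap n} (hf : f.IsC2Monotone)
    (hγ : ∀ i, 0 < f.expansion i) (hm : Measurable f.toFun) {R : Rect n}
    (hR : ∃ B ∈ f.part.parts, R.toSet ⊆ B.toSet) :
    ∃ R' : Rect n, f.totalExpansion * R.vol ≤ R'.vol ∧ ∀ N, MeasurableSet N →
      volume (R.toSet ∩ f.toFun ⁻¹' N) = 0 → volume (R'.toSet ∩ N) = 0 := by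
  have hbr := fun i => f.exists_branch hf hR i (hγ i)
  have hloI : ∀ i, R.lo i ∈ Icc (R.lo i) (R.hi i) := fun i => left_mem_Icc.2 (R.lo_lt_hi i).le
  have hhiI : ∀ i, R.hi i ∈ Icc (R.lo i) (R.hi i) := fun i => right_mem_Icc.2 (R.lo_lt_hi i).le
  have hne : ∀ i, f.br R i (R.lo i) ≠ f.br R i (R.hi i) := fun i heq =>
    (R.lo_lt_hi i).ne ((hbr i).1.injOn (hloI i) (hhiI i) heq)
  let R' : Rect n :=
    { lo := fun i => min (f.br R i (R.lo i)) (f.br R i (R.hi i))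
      hi := fun i => max (f.br R i (R.lo i)) (f.br R i (R.hi i))
      lo_nonneg := fun i => le_min ((hbr i).1.maps (hloI i)).1 ((hbr i).1.maps (hhiI i)).1
      lo_lt_hi := fun i => min_lt_max.2 (hne i)
      hi_le_one := fun i => max_le ((hbr i).1.maps (hloI i)).2 ((hbr i).1.maps (hhiI i)).2 }
  have himg : ∀ i, ∀ y ∈ Ioo (R'.lo i) (R'.hi i), ∃ t ∈ Ioo (R.lo i) (R.hi i), f.br R i t = y := by
    intro i y hy
    have hcont : ContinuousOn (f.br R i) (uIcc (R.lo i) (R.hi i)) := by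
      rw [uIcc_of_le (R.lo_lt_hi i).le]
      exact (hbr i).1.continuousOn
    obtain ⟨t, ht, rfl⟩ := intermediate_value_uIcc hcont (Ioo_subset_Icc_self hy)
    rw [uIcc_of_le (R.lo_lt_hi i).le] at ht
    refine ⟨t, ⟨lt_of_le_of_ne ht.1 ?_, lt_of_le_of_ne ht.2 ?_⟩, rfl⟩
    · rintro rfl
      rcases lt_or_gt_of_ne (hne i) with h | h
      · exact hy.1.ne (min_eq_left h.le)
      · exact hy.2.ne (max_eq_left h.le).symm
    · rintro rfl
      rcases lt_or_gt_of_ne (hne i) with h | h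
      · exact hy.2.ne (max_eq_right h.le).symm
      · exact hy.1.ne (min_eq_right h.le)
  refine ⟨R', ?_, fun N hN h0 => ?_⟩
  · rw [JablonskiMap.totalExpansion, Rect.vol, Rect.vol, ← Finset.prod_mul_distrib]
    refine Finset.prod_le_prod (fun i _ => mul_nonneg (hγ i).le
      (sub_nonneg.2 (R.lo_lt_hi i).le)) fun i _ => ?_
    obtain ⟨φ', hφ'⟩ := (hbr i).1.deriv
    obtain ⟨ξ, hξ, hξeq⟩ := exists_hasDerivAt_eq_slope (f.br R i) φ' (R.lo_lt_hi i)
      (hbr i).1.continuousOn fun t ht => (hφ' t (Ioo_subset_Icc_self ht)).1.hasDerivAt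
        (Icc_mem_nhds ht.1 ht.2)
    have hlen : 0 < R.hi i - R.lo i := sub_pos.2 (R.lo_lt_hi i)
    have hd : f.br R i (R.hi i) - f.br R i (R.lo i) = φ' ξ * (R.hi i - R.lo i) := by
      rw [hξeq]
      field_simp
    have h1 := (hφ' ξ (Ioo_subset_Icc_self hξ)).2
    have h2 := (hbr i).2.1 ξ
    have h3 : f.expansion i ≤ |φ' ξ| := by
      have h4 : 1 ≤ 1 / f.expansion i * |φ' ξ| := by
        calc 1 = f.slope R i ξ * |φ' ξ| := h1.symm
          _ ≤ _ := mul_le_mul_of_nonneg_right h2 (abs_nonneg _)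
      rw [div_mul_eq_mul_div, one_mul, le_div_iff₀ (hγ i), one_mul] at h4
      exact h4
    calc f.expansion i * (R.hi i - R.lo i) ≤ |φ' ξ| * (R.hi i - R.lo i) := by gcongr
      _ = |f.br R i (R.hi i) - f.br R i (R.lo i)| := by rw [hd, abs_mul, abs_of_pos hlen]
      _ = R'.hi i - R'.lo i := by
        simp only [R']
        rw [max_sub_min_eq_abs']
        exact abs_sub_comm _ _
  -- The image of Lebesgue measure on `R` has a strictly positive density on the open image box. A
  -- set that is null for the image measure is therefore Lebesgue-null there.
  · obtain ⟨θ, hθ, -, -, hθeq, hmap⟩ := f.exists_density hf hγ hm hR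
    have h1 : ((volume : Measure (Cube n)).restrict R.toSet).map f.toFun N = 0 := by
      rw [Measure.map_apply hm hN, Measure.restrict_apply (hm hN), inter_comm]
      exact h0
    have hpm : Measurable fun x : Cube n => ENNReal.ofReal (∏ i, θ i (x i)) :=
      (Finset.measurable_prod _ fun i _ => (hθ i).meas.comp
        (measurable_subtype_coe.comp (measurable_pi_apply i))).ennreal_ofReal
    rw [hmap, withDensity_apply_eq_zero hpm] at h1
    have h2 : (R'.toSet ∩ N : Set (Cube n)) =ᵐ[volume] (emb ⁻¹' R'.openBox ∩ N : Set (Cube n)) :=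
      R'.toSet_ae_eq.inter (ae_eq_refl _)
    rw [measure_congr h2]
    refine measure_mono_null ?_ h1
    rintro x ⟨hx, hxN⟩
    refine ⟨?_, hxN⟩
    have hpos : 0 < ∏ i, θ i (x i) := Finset.prod_pos fun i _ => by
      obtain ⟨t, ht, hty⟩ := himg i (x i) (hx i)
      rw [← hty, hθeq i t ht]
      exact (hbr i).2.2.1 t
    exact (ENNReal.ofReal_pos.2 hpos).ne'

/-- The number of rectangles of the partition that meet `R`. -/
def RectPartition.meetCount (Pt : RectPartition n) (R : Rect n) : ℕ :=
  {B : Rect n | B ∈ Pt.parts ∧ (R.openBox ∩ B.openBox).Nonempty}.ncard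

lemma RectPartition.meetCount_le_card (Pt : RectPartition n) (R : Rect n) :
    Pt.meetCount R ≤ Pt.parts.card := by
  rw [meetCount, ← Set.ncard_coe_finset]
  exact Set.ncard_le_ncard (fun B hB => hB.1) Pt.parts.finite_toSet

/-- The largest piece of a rectangle cut by a partition. -/
lemma RectPartition.exists_piece (Pt : RectPartition n) (R : Rect n) :
    ∃ R₁ : Rect n, (∃ B ∈ Pt.parts, R₁.toSet ⊆ B.toSet) ∧ R₁.toSet ⊆ R.toSet ∧
      R.vol ≤ Pt.meetCount R * R₁.vol := by
  classical
  set F := Pt.parts.filter fun B => (R.openBox ∩ B.openBox).Nonempty with hF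
  have hcard : F.card = Pt.meetCount R := by
    rw [meetCount, ← Set.ncard_coe_finset]
    congr 1
    ext B
    simp [hF]
  have hvol := Pt.volume_eq_sum R.measurableSet_openBox R.openBox_subset
  have hpiece : ∀ B ∈ F, ∃ R₁ : Rect n, R₁.toSet ⊆ B.toSet ∧ R₁.toSet ⊆ R.toSet ∧
      volume (R.openBox ∩ B.openBox) = ENNReal.ofReal R₁.vol := by
    intro B hB
    obtain ⟨y, hyR, hyB⟩ := (Finset.mem_filter.1 hB).2
    let R₁ : Rect n :=
      { lo := fun i => max (R.lo i) (B.lo i)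
        hi := fun i => min (R.hi i) (B.hi i)
        lo_nonneg := fun i => (R.lo_nonneg i).trans (le_max_left _ _)
        lo_lt_hi := fun i => (max_lt (hyR i).1 (hyB i).1).trans (lt_min (hyR i).2 (hyB i).2)
        hi_le_one := fun i => (min_le_left _ _).trans (R.hi_le_one i) }
    refine ⟨R₁, fun x hx i => ⟨(le_max_right _ _).trans (hx i).1, ?_⟩,
      fun x hx i => ⟨(le_max_left _ _).trans (hx i).1, ?_⟩, ?_⟩
    · rcases (hx i).2 with h | h
      · exact Or.inl (h.trans_le (min_le_right _ _))
      · exact Or.inr (le_antisymm (B.hi_le_one i) (h.ge.trans (min_le_right _ _)))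
    · rcases (hx i).2 with h | h
      · exact Or.inl (h.trans_le (min_le_left _ _))
      · exact Or.inr (le_antisymm (R.hi_le_one i) (h.ge.trans (min_le_left _ _)))
    · rw [Rect.vol, ← R₁.volume_openBox]
      congr 1
      ext y
      constructor
      · rintro ⟨h1, h2⟩ i
        exact ⟨max_lt (h1 i).1 (h2 i).1, lt_min (h1 i).2 (h2 i).2⟩
      · exact fun h => ⟨fun i => ⟨(le_max_left _ _).trans_lt (h i).1,
          (h i).2.trans_le (min_le_left _ _)⟩, fun i => ⟨(le_max_right _ _).trans_lt (h i).1,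
          (h i).2.trans_le (min_le_right _ _)⟩⟩
  have hsum : ENNReal.ofReal R.vol = ∑ B ∈ F, volume (R.openBox ∩ B.openBox) := by
    rw [Rect.vol, ← R.volume_openBox, hvol, hF, Finset.sum_filter_of_ne]
    intro B _ hB
    by_contra hc
    rw [not_nonempty_iff_eq_empty] at hc
    exact hB (by rw [hc, measure_empty])
  have hFne : F.Nonempty := by
    rw [Finset.nonempty_iff_ne_empty]
    intro h0
    rw [h0, Finset.sum_empty, ENNReal.ofReal_eq_zero] at hsum
    linarith [R.vol_pos]
  obtain ⟨B, hB, hmax⟩ := Finset.exists_max_image F (fun B => volume (R.openBox ∩ B.openBox)) hFne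
  obtain ⟨R₁, h1, h2, h3⟩ := hpiece B hB
  refine ⟨R₁, ⟨B, (Finset.mem_filter.1 hB).1, h1⟩, h2, ?_⟩
  have h4 : ENNReal.ofReal R.vol ≤ F.card • ENNReal.ofReal R₁.vol := by
    rw [hsum, ← h3]
    exact Finset.sum_le_card_nsmul _ _ _ hmax
  rw [nsmul_eq_mul, ← ENNReal.ofReal_natCast, ← ENNReal.ofReal_mul (Nat.cast_nonneg _),
    ENNReal.ofReal_le_ofReal_iff (mul_nonneg (Nat.cast_nonneg _) R₁.vol_pos.le), hcard] at h4
  exact h4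

lemma RectPartition.hyperplaneCount_le (Pt : RectPartition n) (d : Fin n) (z : ℝ) :
    Pt.hyperplaneCount d z ≤ Pt.maxHyperplaneCount := by
  have hle : ∀ d z, Pt.hyperplaneCount d z ≤ Pt.parts.card := fun d z => by
    rw [hyperplaneCount, ← Set.ncard_coe_finset]
    exact Set.ncard_le_ncard (fun B hB => hB.1) Pt.parts.finite_toSet
  have hne : Nonempty (Fin n) := ⟨d⟩
  refine (le_ciSup (f := fun z => Pt.hyperplaneCount d z) ?_ z).trans
    (le_ciSup (f := fun d => ⨆ z, Pt.hyperplaneCount d z) ?_ d)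
  · exact ⟨Pt.parts.card, by rintro _ ⟨z, rfl⟩; exact hle d z⟩
  · exact ⟨Pt.parts.card, by rintro _ ⟨d, rfl⟩; exact ciSup_le fun z => hle d z⟩

/-- A rectangle without crossing points of a grid meets few rectangles of the grid. -/
lemma RectPartition.IsGrid.meetCount_le {Pt : RectPartition n} (hg : Pt.IsGrid) (R : Rect n)
    (hR : ∀ v ∈ Pt.crossingPoints, v ∉ R.openBox) : Pt.meetCount R ≤ Pt.maxHyperplaneCount := by
  obtain ⟨r, a, ha, hparts⟩ := hg
  -- Some side of `R` contains no subdivision point in its interior. Otherwise one such point in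
  -- each direction would give the coordinates of a vertex inside `R`; in a grid every combination
  -- of subdivision points is a vertex, so this would be a crossing point.
  obtain ⟨i, hi⟩ : ∃ i, ∀ B ∈ Pt.parts, B.lo i ∉ Ioo (R.lo i) (R.hi i) ∧
      B.hi i ∉ Ioo (R.lo i) (R.hi i) := by
    by_contra! hc
    have hk : ∀ i, ∃ k, k < r i ∧ a i k ∈ Ioo (R.lo i) (R.hi i) := by
      intro i
      obtain ⟨B, hB, h⟩ := hc i
      obtain ⟨s, hs⟩ := (hparts B).1 hB
      by_cases h1 : B.lo i ∈ Ioo (R.lo i) (R.hi i)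
      · exact ⟨s i, (hs i).1, (hs i).2.1 ▸ h1⟩
      · have h2 := h h1
        rw [(hs i).2.2] at h2
        -- The index `s i + 1` is not the last one, because `a i (r i) = 1` cannot lie strictly
        -- inside a side of `R`.
        refine ⟨s i + 1, lt_of_le_of_ne (hs i).1 fun h3 => ?_, h2⟩
        rw [h3, (ha i).2.1] at h2
        exact (h2.2.trans_le (R.hi_le_one i)).false
    choose k hk hka using hk
    have h01 : ∀ i, a i (k i) ∈ Ioo (0 : ℝ) 1 := fun i =>
      ⟨(R.lo_nonneg i).trans_lt (hka i).1, (hka i).2.trans_le (R.hi_le_one i)⟩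
    have hle : ∀ i j, j + k i + 1 ≤ r i → a i (k i + 1) ≤ a i (j + k i + 1) := by
      intro i j
      induction j with
      | zero => intro _; rw [zero_add]
      | succ j ih =>
        intro hj
        refine (ih (by omega)).trans ?_
        have := (ha i).2.2 (j + k i + 1) (by omega)
        rw [show j + 1 + k i + 1 = j + k i + 1 + 1 by ring]
        exact this.le
    let B : Rect n :=
      { lo := fun i => a i (k i)
        hi := fun i => a i (k i + 1)
        lo_nonneg := fun i => (h01 i).1.le
        lo_lt_hi := fun i => (ha i).2.2 _ (hk i)
        hi_le_one := fun i => by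
          have := hle i (r i - (k i + 1)) (by have := hk i; omega)
          rw [show r i - (k i + 1) + k i + 1 = r i by have := hk i; omega, (ha i).2.1] at this
          exact this }
    exact hR (fun i => a i (k i)) ⟨⟨B, (hparts B).2 ⟨k, fun i => ⟨hk i, rfl, rfl⟩⟩,
      fun i => Or.inl rfl⟩, h01⟩ hka
  refine le_trans ?_ (Pt.hyperplaneCount_le i ((R.lo i + R.hi i) / 2))
  have hlt := R.lo_lt_hi i
  refine Set.ncard_le_ncard ?_ (Pt.parts.finite_toSet.subset fun B hB => hB.1)
  rintro B ⟨hB, y, hyR, hyB⟩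
  -- Rectangles that meet `R` span its whole `i`-th side, so the common point can be moved to the
  -- hyperplane through the midpoint of that side.
  refine ⟨hB, Function.update y i ((R.lo i + R.hi i) / 2), by simp, fun j => ?_⟩
  by_cases hj : j = i
  · subst hj
    rw [Function.update_self]
    have h1 := (hi B hB).1
    have h2 := (hi B hB).2
    have h3 : B.lo j ≤ R.lo j := by
      by_contra! hc
      exact h1 ⟨hc, (hyB j).1.trans (hyR j).2⟩
    have h4 : R.hi j ≤ B.hi j := by
      by_contra! hc
      exact h2 ⟨(hyR j).1.trans (hyB j).2, hc⟩
    constructor <;> linarith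
  · rw [Function.update_of_ne hj]
    exact hyB j

lemma RectPartition.finite_crossingPoints (Pt : RectPartition n) : Pt.crossingPoints.Finite := by
  have h : (⋃ B ∈ Pt.parts, B.vertices).Finite := by
    refine Pt.parts.finite_toSet.biUnion fun B _ => ?_
    have : B.vertices = univ.pi fun i => {B.lo i, B.hi i} := by
      ext v
      exact ⟨fun h i _ => h i, fun h i => h i (mem_univ i)⟩
    rw [this]
    exact Set.Finite.pi fun i => Set.toFinite _
  refine h.subset ?_
  rintro v ⟨⟨B, hB, hv⟩, -⟩
  exact mem_biUnion hB hv

end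

/-! ### Counting disjoint invariant sets -/

section

variable {Ω : Type*} {n : ℕ} [MeasurableSpace Ω] {P : Measure Ω}

/-- Birkhoff sums of functions with positive integral are almost surely unbounded above. -/
lemma ae_exists_lt_birkhoffSum [IsProbabilityMeasure P] {T : Ω → Ω} (hT : Ergodic T P) {u : Ω → ℝ}
    (hu : Integrable u P) (hpos : 0 < ∫ ω, u ω ∂P) :
    ∀ᵐ ω ∂P, ∀ C : ℕ, ∃ k, (C : ℝ) < birkhoffSum T u k ω := by
  have hmp := hT.toMeasurePreserving
  obtain ⟨v, hvm, huv⟩ := hu.1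
  replace hvm := hvm.measurable
  have hvi : Integrable v P := hu.congr huv
  have hiv : ∫ ω, v ω ∂P = ∫ ω, u ω ∂P := integral_congr_ae huv.symm
  set δ := (∫ ω, u ω ∂P) / 2 with hδ
  have hδpos : 0 < δ := by positivity
  -- The maximal lemma for `δ - v` gives a set of positive measure on which the sums of `v` are at
  -- least `k δ - b`. Unboundedness is inherited along backward orbits, so ergodicity makes it
  -- almost sure.
  have hneg : ∫ ω, (δ - v ω) ∂P < 0 := by
    rw [integral_sub (integrable_const _) hvi, hiv, integral_const, hδ]
    simp only [probReal_univ, smul_eq_mul, one_mul]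
    linarith
  obtain ⟨b, hb⟩ := exists_birkhoffSum_le hmp (measurable_const.sub hvm)
    ((integrable_const δ).sub hvi) hneg
  have hsum : ∀ k ω, birkhoffSum T (fun ω => δ - v ω) k ω = k * δ - birkhoffSum T v k ω := by
    intro k ω
    simp [birkhoffSum, Finset.sum_sub_distrib]
  set Z : Set Ω := {ω | ∀ C : ℕ, ∃ k, (C : ℝ) < birkhoffSum T v k ω} with hZ
  have hZm : MeasurableSet Z := by
    rw [hZ, ofPred_forall]
    refine MeasurableSet.iInter fun C => ?_
    rw [ofPred_exists]
    exact MeasurableSet.iUnion fun k => measurableSet_lt measurable_const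
      (measurable_birkhoffSum hmp.measurable hvm k)
  have hpre : T ⁻¹' Z ⊆ Z := by
    intro ω hω C
    obtain ⟨D, hD⟩ := exists_nat_gt ((C : ℝ) - v ω)
    obtain ⟨k, hk⟩ := hω D
    refine ⟨k + 1, ?_⟩
    rw [birkhoffSum_succ']
    linarith
  have hsub : {ω | ∀ k, birkhoffSum T (fun ω => δ - v ω) k ω ≤ b} ⊆ Z := by
    intro ω hω C
    obtain ⟨k, hk⟩ := exists_nat_gt ((C + b) / δ)
    refine ⟨k, ?_⟩
    rw [div_lt_iff₀ hδpos] at hk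
    have := hω k
    rw [hsum] at this
    linarith
  have hZ1 : ∀ᵐ ω ∂P, ω ∈ Z := by
    rcases hT.ae_empty_or_univ_of_preimage_ae_le hZm.nullMeasurableSet
      (Eventually.of_forall hpre) with h1 | h1
    · exfalso
      have h2 : P Z = 0 := by rw [measure_congr h1, measure_empty]
      exact (hb.trans_le (measure_mono hsub)).ne' h2
    · filter_upwards [h1] with ω hω
      exact hω.mpr trivial
  filter_upwards [hZ1, ae_iterate hmp huv] with ω hω heq C
  obtain ⟨k, hk⟩ := hω C
  refine ⟨k, hk.trans_eq ?_⟩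
  exact Finset.sum_congr rfl fun j _ => (heq j).symm

variable {σ : Ω ≃ᵐ Ω} {f : Ω → JablonskiMap n} {Q : RectPartition n}

/-- `R` is a rectangle that lies in a rectangle of the partition at `ω` and, up to a null set, in
the fibre of `A` over `ω`. -/
def Inside (f : Ω → JablonskiMap n) (A : Set (Ω × Cube n)) (ω : Ω) (R : Rect n) : Prop :=
  (∃ B ∈ (f ω).part.parts, R.toSet ⊆ B.toSet) ∧ volume (R.toSet ∩ (fibre A ω)ᶜ) = 0

/-- One step of the volume argument. Each box is mapped forward, gaining `log γ`, and replaced by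
the largest piece that the next partition leaves of the image, losing the logarithm of the number of
rectangles met. The loss is `log M`, except for at most `c` boxes containing a crossing point, for
which it is at most `log q`. -/
lemma Inside.grow {T : Ω → Ω} (hF : Measurable (skewProduct T f)) (hsm : ∀ ω, (f ω).IsC2Monotone)
    (hgrid : ∀ ω, (f ω).part.IsGrid) {r : ℕ} {A : Fin r → Set (Ω × Cube n)}
    (hA : ∀ i, MeasurableSet (A i)) (hinv : ∀ i, skewProduct T f ⁻¹' A i = A i)
    (hd : Pairwise fun i j => Disjoint (A i) (A j)) {ω : Ω} (hγ : ∀ i, 0 < (f ω).expansion i)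
    {M c q : ℝ} (hM1 : 1 ≤ M) (hMq : M ≤ q) (hM : (complexity T f ω : ℝ) ≤ M)
    (hc : (numCrossing T f ω : ℝ) ≤ c) (hq : (numRects f (T ω) : ℝ) ≤ q)
    {R : Fin r → Rect n} (hR : ∀ i, Inside f (A i) ω (R i)) :
    ∃ R₁ : Fin r → Rect n, (∀ i, Inside f (A i) (T ω) (R₁ i)) ∧
      ∑ i, Real.log (R i).vol + (r * (Real.log (f ω).totalExpansion - Real.log M) -
        c * (Real.log q - Real.log M)) ≤ ∑ i, Real.log (R₁ i).vol := by
  classical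
  have hfm : Measurable (f ω).toFun := measurable_toFun hF ω
  choose R' hvol hR' using fun i => (f ω).exists_image (hsm ω) hγ hfm (hR i).1
  have hAm : ∀ i ω, MeasurableSet (fibre (A i) ω) := fun i ω => measurableSet_fibre (hA i) ω
  have hin : ∀ i, volume ((R' i).toSet ∩ (fibre (A i) (T ω))ᶜ) = 0 := by
    intro i
    refine hR' i _ (hAm i _).compl ?_
    rw [preimage_compl]
    have : (f ω).toFun ⁻¹' fibre (A i) (T ω) = fibre (A i) ω := preimage_cyc_fibre (hinv i) 1 ω
    rw [this]
    exact (hR i).2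
  -- Up to null sets the boxes lie in disjoint fibres, so their open intersections are null; being
  -- open, they are empty.
  have hdisj : ∀ i j, i ≠ j → Disjoint (R' i).openBox (R' j).openBox := by
    intro i j hij
    rw [Set.disjoint_iff_inter_eq_empty]
    by_contra hne
    have hpos := ((R' i).isOpen_openBox.inter (R' j).isOpen_openBox).measure_pos volume
      (nonempty_iff_ne_empty.2 hne)
    rw [← volume_emb_preimage ((R' i).measurableSet_openBox.inter (R' j).measurableSet_openBox)
      (inter_subset_left.trans (R' i).openBox_subset)] at hpos
    refine hpos.ne' (measure_mono_null ?_ (measure_union_null (hin i) (hin j)))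
    rintro x ⟨h1, h2⟩
    by_cases hx : x ∈ fibre (A i) (T ω)
    · exact Or.inr ⟨Rect.mem_toSet_of_emb h2, fun h3 => Set.disjoint_left.1 (hd hij) hx h3⟩
    · exact Or.inl ⟨Rect.mem_toSet_of_emb h1, hx⟩
  choose R₁ h1 h2 h3 using fun i => (f (T ω)).part.exists_piece (R' i)
  refine ⟨R₁, fun i => ⟨h1 i, measure_mono_null (inter_subset_inter_left _ (h2 i)) (hin i)⟩, ?_⟩
  set N : Fin r → ℕ := fun i => (f (T ω)).part.meetCount (R' i) with hN
  have hNpos : ∀ i, (0 : ℝ) < N i := fun i => by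
    rcases Nat.eq_zero_or_pos (N i) with h0 | h0
    · have := h3 i
      simp only [hN] at h0
      rw [h0, Nat.cast_zero, zero_mul] at this
      exact absurd (R' i).vol_pos this.not_gt
    · exact_mod_cast h0
  have hγtot : 0 < (f ω).totalExpansion := Finset.prod_pos fun i _ => hγ i
  have hMpos : 0 < M := by linarith
  have hlogMq : Real.log M ≤ Real.log q := Real.log_le_log hMpos hMq
  -- The boxes that contain a crossing point. Since boxes are disjoint, choosing one such point in
  -- each is injective, and there are at most `c` of them.
  set X : Finset (Fin r) := Finset.univ.filter fun i =>
    ∃ v ∈ (f (T ω)).part.crossingPoints, v ∈ (R' i).openBox with hX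
  have hXc : (X.card : ℝ) ≤ c := by
    refine le_trans ?_ hc
    have hex : ∀ i : X, ∃ v ∈ (f (T ω)).part.crossingPoints, v ∈ (R' i).openBox := fun i =>
      (Finset.mem_filter.1 i.2).2
    choose v hv hvR using hex
    have hinj : Function.Injective v := by
      intro i j hij
      by_contra hne
      have hne' : (i : Fin r) ≠ j := fun h => hne (Subtype.ext h)
      exact Set.disjoint_left.1 (hdisj i j hne') (hvR i) (hij ▸ hvR j)
    have h4 : (range v).ncard ≤ numCrossing T f ω :=
      Set.ncard_le_ncard (range_subset_iff.2 hv) (f (T ω)).part.finite_crossingPoints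
    have h5 : (range v).ncard = X.card := by
      rw [← Nat.card_coe_set_eq, Nat.card_range_of_injective hinj, Nat.card_eq_fintype_card,
        Fintype.card_coe]
    rw [h5] at h4
    exact_mod_cast h4
  have hlogN : ∀ i, Real.log (N i) ≤ Real.log M +
      if i ∈ X then Real.log q - Real.log M else 0 := by
    intro i
    split_ifs with hi
    · rw [add_sub_cancel]
      refine Real.log_le_log (hNpos i) (le_trans ?_ hq)
      exact_mod_cast (f (T ω)).part.meetCount_le_card _
    · rw [add_zero]
      refine Real.log_le_log (hNpos i) (le_trans ?_ hM)
      have : N i ≤ complexity T f ω := (hgrid (T ω)).meetCount_le _ fun v hv hvR =>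
        hi (Finset.mem_filter.2 ⟨Finset.mem_univ i, v, hv, hvR⟩)
      exact_mod_cast this
  have hstep : ∀ i, Real.log (R i).vol + (Real.log (f ω).totalExpansion - Real.log M) -
      (if i ∈ X then Real.log q - Real.log M else 0) ≤ Real.log (R₁ i).vol := by
    intro i
    have h4 := (hvol i).trans (h3 i)
    have h5 := Real.log_le_log (mul_pos hγtot (R i).vol_pos) h4
    rw [Real.log_mul hγtot.ne' (R i).vol_pos.ne', Real.log_mul (hNpos i).ne'
      (R₁ i).vol_pos.ne'] at h5
    linarith [hlogN i]
  calc ∑ i, Real.log (R i).vol + (r * (Real.log (f ω).totalExpansion - Real.log M) -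
        c * (Real.log q - Real.log M))
      ≤ ∑ i, Real.log (R i).vol + (r * (Real.log (f ω).totalExpansion - Real.log M) -
        X.card * (Real.log q - Real.log M)) := by
        have : (X.card : ℝ) * (Real.log q - Real.log M) ≤ c * (Real.log q - Real.log M) :=
          mul_le_mul_of_nonneg_right hXc (by linarith)
        linarith
    _ = ∑ i, (Real.log (R i).vol + (Real.log (f ω).totalExpansion - Real.log M) -
      (if i ∈ X then Real.log q - Real.log M else 0)) := by
        rw [Finset.sum_sub_distrib, Finset.sum_add_distrib, Finset.sum_ite_mem,
          Finset.univ_inter, Finset.sum_const, Finset.sum_const, Finset.card_univ,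
          Fintype.card_fin, nsmul_eq_mul, nsmul_eq_mul]
        ring
    _ ≤ _ := Finset.sum_le_sum fun i _ => hstep i

/-- The bound for the number of disjoint invariant sets of positive measure. -/
lemma Expanding.card_mul_le [IsProbabilityMeasure P] (h : Expanding P σ f Q)
    (hgrid : ∀ ω, (f ω).part.IsGrid)
    (hlog : Integrable (fun ω => Real.log (f ω).totalExpansion) P)
    {M c q : ℝ} (hM1 : 1 ≤ M) (hMq : M ≤ q)
    (hM : ∀ᵐ ω ∂P, (complexity σ f ω : ℝ) ≤ M) (hc : ∀ᵐ ω ∂P, (numCrossing σ f ω : ℝ) ≤ c)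
    (hq : ∀ᵐ ω ∂P, (numRects f ω : ℝ) ≤ q) {r : ℕ} {A : Fin r → Set (Ω × Cube n)}
    (hA : ∀ i, MeasurableSet (A i)) (hinv : ∀ i, skewProduct σ f ⁻¹' A i = A i)
    (hd : Pairwise fun i j => Disjoint (A i) (A j)) (hpos : ∀ i, P.prod volume (A i) ≠ 0) :
    r * ((∫ ω, Real.log (f ω).totalExpansion ∂P) - Real.log M) ≤
      c * (Real.log q - Real.log M) := by
  by_contra! hcon
  have hmp := h.ergodic.toMeasurePreserving
  -- The guaranteed gain of the sum of log-volumes in one step. If the bound failed, its mean would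
  -- be positive.
  set w : Ω → ℝ := fun ω => r * (Real.log (f ω).totalExpansion - Real.log M) -
    c * (Real.log q - Real.log M) with hw
  have hi1 : Integrable (fun ω => Real.log (f ω).totalExpansion - Real.log M) P :=
    hlog.sub (integrable_const _)
  have hi2 : Integrable (fun ω => r * (Real.log (f ω).totalExpansion - Real.log M)) P :=
    hi1.const_mul _
  have hwi : Integrable w P := hi2.sub (integrable_const _)
  have hwint : 0 < ∫ ω, w ω ∂P := by
    have e1 : ∫ ω, w ω ∂P = r * ((∫ ω, Real.log (f ω).totalExpansion ∂P) - Real.log M) -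
        c * (Real.log q - Real.log M) := by
      simp only [hw]
      rw [integral_sub hi2 (integrable_const _), integral_const_mul,
        integral_sub hlog (integrable_const _), integral_const, integral_const]
      simp
    rw [e1]
    linarith
  obtain ⟨S, hS, hSpos, K, hK, hbox⟩ := h.exists_openBox
  have hbox' : ∀ᵐ ω ∂P, ∀ i, ω ∈ S → ∃ k : Fin n → Fin K,
      volume (emb ⁻¹' gridBox K (fun i => (k i : ℕ)) ∩ (fibre (A i) ω)ᶜ) = 0 :=
    ae_all_iff.2 fun i => hbox (A i) (hA i) (hinv i) (hpos i)
  obtain ⟨ω, hωS, hω1, hω2, hω3, hω4, hω5, hω6⟩ :=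
    ((frequently_ae_mem_iff.2 hSpos.ne').and_eventually
      (hbox'.and ((ae_exists_lt_birkhoffSum h.ergodic hwi hwint).and ((ae_iterate hmp h.pos).and
        ((ae_iterate hmp hM).and ((ae_iterate hmp hc).and (ae_iterate hmp hq))))))).exists
  have hK' : (0 : ℝ) < K := by exact_mod_cast hK
  have hinit : ∀ i, ∃ R : Rect n, Inside f (A i) ω R := by
    intro i
    obtain ⟨k, hk⟩ := hω1 i hωS
    let R : Rect n :=
      { lo := fun i => (k i : ℕ) / (K : ℝ)
        hi := fun i => ((k i : ℕ) + 1) / (K : ℝ)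
        lo_nonneg := fun i => by positivity
        lo_lt_hi := fun i => by
          gcongr
          linarith
        hi_le_one := fun i => by
          rw [div_le_one hK']
          exact_mod_cast (k i).2 }
    have hRbox : R.openBox = gridBox K fun i => (k i : ℕ) := R.openBox_eq
    have hR0 : volume (R.toSet ∩ (fibre (A i) ω)ᶜ) = 0 := by
      have h2 : (R.toSet ∩ (fibre (A i) ω)ᶜ : Set (Cube n)) =ᵐ[volume]
          (emb ⁻¹' R.openBox ∩ (fibre (A i) ω)ᶜ : Set (Cube n)) :=
        R.toSet_ae_eq.inter (ae_eq_refl _)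
      rw [measure_congr h2, hRbox]
      exact hk
    obtain ⟨R₁, h1, h2, -⟩ := (f ω).part.exists_piece R
    exact ⟨R₁, h1, measure_mono_null (inter_subset_inter_left _ h2) hR0⟩
  choose R0 hR0 using hinit
  have hiter : ∀ k : ℕ, ∃ R : Fin r → Rect n, (∀ i, Inside f (A i) (σ^[k] ω) (R i)) ∧
      ∑ i, Real.log (R0 i).vol + birkhoffSum σ w k ω ≤ ∑ i, Real.log (R i).vol := by
    intro k
    induction k with
    | zero => exact ⟨R0, hR0, by simp⟩
    | succ k ih =>
      obtain ⟨R, hR, hsum⟩ := ih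
      have hqk := hω6 (k + 1)
      rw [Function.iterate_succ_apply'] at hqk
      obtain ⟨R₁, hR₁, hsum₁⟩ := Inside.grow h.measurable h.smooth hgrid hA hinv hd (hω3 k) hM1 hMq
        (hω4 k) (hω5 k) hqk hR
      refine ⟨R₁, fun i => ?_, ?_⟩
      · rw [Function.iterate_succ_apply']
        exact hR₁ i
      · rw [birkhoffSum_succ]
        have : w (σ^[k] ω) = r * (Real.log (f (σ^[k] ω)).totalExpansion - Real.log M) -
          c * (Real.log q - Real.log M) := rfl
        linarith
  -- A time at which the accumulated gain exceeds the initial deficit would make a sum of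
  -- log-volumes positive, although no volume exceeds `1`.
  obtain ⟨C, hC⟩ := exists_nat_gt (-∑ i, Real.log (R0 i).vol)
  obtain ⟨k, hk⟩ := hω2 C
  obtain ⟨R, -, hsum⟩ := hiter k
  have : ∑ i, Real.log (R i).vol ≤ 0 := Finset.sum_nonpos fun i _ =>
    Real.log_nonpos (R i).vol_pos.le (R i).vol_le_one
  linarith

end

/-! ### Limits of measures along ultrafilters -/

section

/-- A uniformly absolutely continuous sequence of measures has a limit along every ultrafilter. -/
lemma exists_limit_measure {α : Type*} [MeasurableSpace α] {m : Measure α} {a : ℕ → Measure α}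
    (U : Ultrafilter ℕ) (hU : (U : Filter ℕ) ≤ atTop)
    (h : ∀ E : ℕ → Set α, (∀ k, MeasurableSet (E k)) → Antitone E → m (⋂ k, E k) = 0 →
      ∀ ε : ℝ≥0∞, 0 < ε → ∃ k, ∀ᶠ J in atTop, a J (E k) ≤ ε) :
    ∃ ν : Measure α, ν ≪ m ∧
      ∀ E, MeasurableSet E → Tendsto (fun J => a J E) U (𝓝 (ν E)) := by
  -- Every set function value has a limit along the ultrafilter, because `ℝ≥0∞` is compact. Only
  -- countable additivity of the limit has to be checked.
  have hlimex : ∀ E, ∃ y, Tendsto (fun J => a J E) U (𝓝 y) := fun E =>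
    ⟨_, (U.map fun J => a J E).le_nhds_lim⟩
  choose v hv using hlimex
  have hv0 : v ∅ = 0 := by
    have := hv ∅
    simp only [measure_empty] at this
    exact tendsto_nhds_unique this tendsto_const_nhds
  have hmono : ∀ E E', E ⊆ E' → v E ≤ v E' := fun E E' hE =>
    le_of_tendsto_of_tendsto' (hv E) (hv E') fun J => measure_mono hE
  have hadd : ∀ E E', MeasurableSet E' → Disjoint E E' → v (E ∪ E') = v E + v E' := by
    intro E E' hE' hd
    have h1 := (hv E).add (hv E')
    refine tendsto_nhds_unique ?_ h1
    have := hv (E ∪ E')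
    simpa only [measure_union hd hE'] using this
  have hsmall : ∀ E : ℕ → Set α, (∀ k, MeasurableSet (E k)) → Antitone E → m (⋂ k, E k) = 0 →
      Tendsto (fun k => v (E k)) atTop (𝓝 0) := by
    intro E hE hanti h0
    rw [ENNReal.tendsto_atTop_zero]
    intro ε hε
    obtain ⟨k, hk⟩ := h E hE hanti h0 ε hε
    have h1 : v (E k) ≤ ε := le_of_tendsto (hv (E k)) (hU hk)
    exact ⟨k, fun l hl => (hmono _ _ (hanti hl)).trans h1⟩
  have hsigma : ∀ (E : ℕ → Set α), (∀ k, MeasurableSet (E k)) → Pairwise (Function.onFun Disjoint E) →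
      v (⋃ k, E k) = ∑' k, v (E k) := by
    intro E hE hd
    -- Finite additivity passes to the limit. The tails decrease to the empty set, so uniform
    -- absolute continuity makes their limit values tend to zero.
    have hfin : ∀ K : ℕ, v (⋃ k, E k) = ∑ k ∈ Finset.range K, v (E k) + v (⋃ k, E (k + K)) := by
      intro K
      induction K with
      | zero => simp
      | succ K ih =>
        rw [ih, Finset.sum_range_succ, add_assoc]
        congr 1
        have e1 : ⋃ k, E (k + K) = (⋃ k, E (k + (K + 1))) ∪ E K := by
          ext x
          simp only [mem_iUnion, mem_union]
          constructor
          · rintro ⟨_ | k, hk⟩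
            · right; simpa using hk
            · left; exact ⟨k, by rwa [add_assoc, add_comm 1 K] at hk⟩
          · rintro (⟨k, hk⟩ | hk)
            · exact ⟨k + 1, by rwa [add_assoc, add_comm 1 K]⟩
            · exact ⟨0, by simpa using hk⟩
        rw [e1, hadd _ _ (hE K), add_comm]
        rw [disjoint_iUnion_left]
        exact fun k => hd (by omega)
    have htail : Tendsto (fun K => v (⋃ k, E (k + K))) atTop (𝓝 0) := by
      refine hsmall (fun K => ⋃ k, E (k + K)) (fun K => MeasurableSet.iUnion fun k => hE _) ?_ ?_
      · intro K K' hK x hx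
        obtain ⟨k, hk⟩ := mem_iUnion.1 hx
        exact mem_iUnion.2 ⟨k + (K' - K), by rwa [add_assoc, Nat.sub_add_cancel hK]⟩
      · convert measure_empty (μ := m)
        rw [eq_empty_iff_forall_notMem]
        intro x hx
        obtain ⟨k, hk⟩ := mem_iUnion.1 (mem_iInter.1 hx 0)
        obtain ⟨l, hl⟩ := mem_iUnion.1 (mem_iInter.1 hx (k + 1))
        exact Set.disjoint_left.1 (hd (show k + 0 ≠ l + (k + 1) by omega)) hk hl
    have hlim : Tendsto (fun K => ∑ k ∈ Finset.range K, v (E k) + v (⋃ k, E (k + K))) atTop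
        (𝓝 (∑' k, v (E k) + 0)) := ENNReal.summable.hasSum.tendsto_sum_nat.add htail
    rw [add_zero] at hlim
    refine tendsto_nhds_unique ?_ hlim
    simp only [← hfin]
    exact tendsto_const_nhds
  refine ⟨Measure.ofMeasurable (fun E _ => v E) hv0 fun E hE hd => hsigma E hE hd, ?_, ?_⟩
  · refine Measure.AbsolutelyContinuous.mk fun E hE h0 => ?_
    rw [Measure.ofMeasurable_apply _ hE]
    have := hsmall (fun _ => E) (fun _ => hE) antitone_const (by rwa [iInter_const])
    exact tendsto_nhds_unique tendsto_const_nhds this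
  · intro E hE
    rw [Measure.ofMeasurable_apply _ hE]
    exact hv E

end

/-! ### Existence of an absolutely continuous invariant measure -/

section

variable {Ω : Type*} {n : ℕ} [MeasurableSpace Ω] {P : Measure Ω} {σ : Ω ≃ᵐ Ω}
  {f : Ω → JablonskiMap n} {Q : RectPartition n}

lemma volume_emb_image {B : Set (Cube n)} (hB : MeasurableSet B) :
    volume (emb '' B) = volume B := by
  have hsub : emb '' B ⊆ unitCube n := by
    rintro _ ⟨x, -, rfl⟩
    exact emb_mem x
  rw [← volume_emb_preimage (measurableEmbedding_emb.measurableSet_image.2 hB) hsub,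
    preimage_image_eq _ emb_injective]

lemma fam_volume : Fam ((volume : Measure (Cube n)).map emb) 2 := by
  obtain ⟨μ, h1, h2, h3⟩ := exists_measure_gridBox (n := n) (K := 1) (fun _ => 0) one_pos
  have hU : volume ((emb ⁻¹' gridBox 1 fun i => (((fun _ => 0 : Fin n → Fin 1) i : Fin 1) : ℕ))ᶜ :
      Set (Cube n)) = 0 := by
    rw [prob_compl_eq_zero_iff (measurable_emb (measurableSet_gridBox _ _)),
      volume_emb_preimage (measurableSet_gridBox _ _) (gridBox_subset_unitCube _),
      volume_gridBox one_pos]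
    simp
  have : μ = volume := by
    ext B hB
    rw [h3 B hB, inter_comm, measure_inter_conull hU]
    simp
  rw [this] at h2
  simpa using h2

lemma Expanding.quasiMeasurePreserving [IsProbabilityMeasure P] (h : Expanding P σ f Q) :
    Measure.QuasiMeasurePreserving (skewProduct σ f) (P.prod volume) (P.prod volume) := by
  refine ⟨h.measurable, Measure.AbsolutelyContinuous.mk fun E hE h0 => ?_⟩
  rw [Measure.map_apply h.measurable hE, Measure.measure_prod_null (h.measurable hE)]
  rw [Measure.measure_prod_null hE] at h0
  filter_upwards [h.ergodic.toMeasurePreserving.quasiMeasurePreserving.ae h0] with ω hω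
  exact (h.nonsingular ω).preimage_null hω

/-- Lebesgue measure on every fibre belongs to the class with constant `2`, so its images over
arrival points in `S` have a common constant `Z` and are uniformly absolutely continuous.
Integrating over `ω`, with `P` invariant under the power of `σ`, turns fibre volumes into `P × m`.
-/
lemma Expanding.tight_measure [IsProbabilityMeasure P] (h : Expanding P σ f Q) :
    ∃ N : ℕ, 1 ≤ N ∧ ∃ S : Set Ω, MeasurableSet S ∧ 0 < P S ∧ ∃ Z : ℝ, 0 ≤ Z ∧
      ∀ (i : ℕ) (E : Set (Ω × Cube n)), MeasurableSet E → ∀ L : ℝ, 0 < L →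
        P.prod volume {p | σ^[i * N] p.1 ∈ S ∧ (skewProduct σ f)^[i * N] p ∈ E} ≤
          ENNReal.ofReal (L ^ n) * P.prod volume E + ENNReal.ofReal (n * Z / L) := by
  obtain ⟨N, hN, ε, b, K, hε, hK, S, hS, hSpos, htight⟩ := h.tight
  refine ⟨N, hN, S, hS, hSpos, Real.exp b * 2 + K, by positivity, fun i E hE L hL => ?_⟩
  have hmp := h.ergodic.toMeasurePreserving.iterate (i * N)
  have hm : MeasurableSet {p : Ω × Cube n | σ^[i * N] p.1 ∈ S ∧
      (skewProduct σ f)^[i * N] p ∈ E} :=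
    ((hmp.measurable.comp measurable_fst) hS).inter ((h.measurable.iterate _) hE)
  have hmE : Measurable fun ω => volume (fibre E ω) := measurable_measure_prodMk_left hE
  rw [Measure.prod_apply hm]
  have hpt : ∀ ω, volume (Prod.mk ω ⁻¹' {p : Ω × Cube n | σ^[i * N] p.1 ∈ S ∧
      (skewProduct σ f)^[i * N] p ∈ E}) ≤ ENNReal.ofReal (L ^ n) *
        volume (fibre E (σ^[i * N] ω)) + ENNReal.ofReal (n * (Real.exp b * 2 + K) / L) := by
    intro ω
    by_cases hω : σ^[i * N] ω ∈ S
    · have hfam := htight i ω hω volume 2 measure_univ fam_volume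
      have hz : Real.exp (b - ε * i) * 2 + K ≤ Real.exp b * 2 + K := by
        gcongr
        have : 0 ≤ ε * i := by positivity
        linarith
      have hcm := measurable_cyc h.measurable (i * N) ω
      have hEm := measurableSet_fibre hE (σ^[i * N] ω)
      have hEi := measurableEmbedding_emb.measurableSet_image.2 hEm
      have key := (Fam.mono hfam hz).measure_le
        (by rw [Measure.map_apply measurable_emb MeasurableSet.univ, preimage_univ,
          map_cyc_univ h.measurable, measure_univ]) hL _ hEi
      rw [Measure.map_apply measurable_emb hEi, preimage_image_eq _ emb_injective,
        volume_emb_image hEm, Measure.map_apply hcm hEm] at key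
      refine (measure_mono ?_).trans key
      rintro x ⟨-, hx⟩
      have hx' : (skewProduct σ f)^[i * N] (ω, x) ∈ E := hx
      rw [iterate_skewProduct] at hx'
      exact hx'
    · have : Prod.mk ω ⁻¹' {p : Ω × Cube n | σ^[i * N] p.1 ∈ S ∧
          (skewProduct σ f)^[i * N] p ∈ E} = ∅ := by
        rw [eq_empty_iff_forall_notMem]
        exact fun x hx => hω hx.1
      rw [this, measure_empty]
      exact zero_le
  refine (lintegral_mono hpt).trans ?_
  have hmE' : Measurable fun ω => volume (fibre E (σ^[i * N] ω)) := hmE.comp hmp.measurable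
  rw [lintegral_add_right _ measurable_const, lintegral_const, measure_univ, mul_one,
    lintegral_const_mul _ hmE',
    hmp.lintegral_comp hmE, Measure.prod_apply hE]
  exact le_rfl

end

/-! ### Uniform absolute continuity and the invariant limit of averages -/

section

variable {Ω : Type*} {n : ℕ} [MeasurableSpace Ω] {P : Measure Ω} {σ : Ω ≃ᵐ Ω}
  {f : Ω → JablonskiMap n} {Q : RectPartition n}

/-- The first `l` terms contribute at most `l / (J + 1)` to the Cesàro mean, which tends to zero. -/
lemma eventually_average_le {a : ℕ → ℝ≥0∞} {l : ℕ} {δ ε : ℝ≥0∞} (h1 : ∀ j, a j ≤ 1)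
    (hδ : ∀ j, l ≤ j → a j ≤ δ) (hε : δ < ε) :
    ∀ᶠ J : ℕ in atTop, ((J : ℝ≥0∞) + 1)⁻¹ * ∑ j ∈ Finset.range (J + 1), a j ≤ ε := by
  have hlim : Tendsto (fun J : ℕ => ((J : ℝ≥0∞) + 1)⁻¹ * l + δ) atTop (𝓝 (0 * l + δ)) := by
    refine (ENNReal.Tendsto.mul_const ?_ (Or.inr (ENNReal.natCast_ne_top l))).add
      tendsto_const_nhds
    have := (tendsto_add_atTop_iff_nat 1).2 ENNReal.tendsto_inv_nat_nhds_zero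
    simpa using this
  rw [zero_mul, zero_add] at hlim
  filter_upwards [hlim.eventually_lt_const hε] with J hJ
  refine le_trans ?_ hJ.le
  have hsum : ∑ j ∈ Finset.range (J + 1), a j ≤ l + ((J : ℝ≥0∞) + 1) * δ := by
    calc ∑ j ∈ Finset.range (J + 1), a j
        ≤ ∑ j ∈ Finset.range (J + 1), ((if j < l then 1 else 0) + δ) := by
          refine Finset.sum_le_sum fun j _ => ?_
          split_ifs with hj
          · exact (h1 j).trans le_self_add
          · rw [zero_add]
            exact hδ j (not_lt.1 hj)
      _ = (∑ j ∈ Finset.range (J + 1), if j < l then (1 : ℝ≥0∞) else 0) +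
          ((J : ℝ≥0∞) + 1) * δ := by
          rw [Finset.sum_add_distrib, Finset.sum_const, Finset.card_range, nsmul_eq_mul]
          push_cast
          rfl
      _ ≤ _ := by
          gcongr
          rw [← Finset.sum_filter, Finset.sum_const, nsmul_eq_mul, mul_one]
          have : (Finset.range (J + 1)).filter (· < l) ⊆ Finset.range l := fun j hj =>
            Finset.mem_range.2 (Finset.mem_filter.1 hj).2
          exact_mod_cast (Finset.card_le_card this).trans (Finset.card_range l).le
  have hJ0 : ((J : ℝ≥0∞) + 1) ≠ 0 := by simp
  have hJt : ((J : ℝ≥0∞) + 1) ≠ ∞ := by simp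
  calc ((J : ℝ≥0∞) + 1)⁻¹ * ∑ j ∈ Finset.range (J + 1), a j
      ≤ ((J : ℝ≥0∞) + 1)⁻¹ * (l + ((J : ℝ≥0∞) + 1) * δ) := by gcongr
    _ = _ := by rw [mul_add, ← mul_assoc, ENNReal.inv_mul_cancel hJ0 hJt, one_mul]

/-- The mass of the images of a suitable piece of `P × m` is uniformly absolutely continuous. -/
lemma Expanding.uniform_small [IsProbabilityMeasure P] (h : Expanding P σ f Q) :
    ∃ N : ℕ, 1 ≤ N ∧ ∃ S : Set Ω, MeasurableSet S ∧ 0 < P S ∧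
      ∀ E : ℕ → Set (Ω × Cube n), (∀ k, MeasurableSet (E k)) → Antitone E →
        P.prod volume (⋂ k, E k) = 0 → ∀ ε : ℝ≥0∞, 0 < ε → ∃ k l, ∀ j, l ≤ j →
          P.prod volume {p | p.1 ∈ S ∧ (skewProduct σ f)^[j * N] p ∈ E k} ≤ ε := by
  obtain ⟨N, hN, S, hS, hSpos, Z, hZ, ht⟩ := h.tight_measure
  refine ⟨N, hN, S, hS, hSpos, fun E hE hanti h0 ε hε => ?_⟩
  have hmp : ∀ k, MeasurePreserving (σ^[k]) P P := fun k => h.ergodic.toMeasurePreserving.iterate k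
  have hqm : ∀ k, Measure.QuasiMeasurePreserving ((skewProduct σ f)^[k]) (P.prod volume)
      (P.prod volume) := fun k => h.quasiMeasurePreserving.iterate k
  have hcan : ∀ k ω, (σ.symm)^[k] (σ^[k] ω) = ω := fun k ω =>
    Function.LeftInverse.iterate σ.symm_apply_apply k ω
  have hsymm : ∀ k, Measurable (σ.symm^[k]) := fun k => σ.symm.measurable.iterate k
  -- The estimates hold for orbits arriving in `S`, whereas here orbits start in `S`. The set `W i`
  -- consists of the points that were in `S` exactly `i` blocks earlier. An orbit started in `S`
  -- arrives, after `j` blocks, in some `W i` with `i < l`, or else in the remainder `T l`. In the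
  -- first case the uniform estimate applies up to the visit to `S`, and the last `i` blocks are a
  -- fixed nonsingular map.
  let W : ℕ → Set Ω := fun l => σ.symm^[l * N] ⁻¹' S
  have hW : ∀ l, MeasurableSet (W l) := fun l => hsymm _ hS
  let T : ℕ → Set Ω := fun l => (⋃ i, W i) \ ⋃ i ∈ Finset.range l, W i
  have hT : ∀ l, MeasurableSet (T l) := fun l =>
    (MeasurableSet.iUnion hW).diff (Finset.measurableSet_biUnion _ fun i _ => hW i)
  have hTlim : Tendsto (fun l => P (T l)) atTop (𝓝 0) := by
    have h1 := tendsto_measure_iInter_atTop (μ := P) (s := T) (fun l => (hT l).nullMeasurableSet)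
      (fun l l' hl ω hω => ⟨hω.1, fun hc => hω.2 ?_⟩) ⟨0, measure_ne_top _ _⟩
    · have h2 : ⋂ l, T l = ∅ := by
        rw [eq_empty_iff_forall_notMem]
        intro ω hω
        obtain ⟨i, hi⟩ := mem_iUnion.1 (mem_iInter.1 hω 0).1
        exact (mem_iInter.1 hω (i + 1)).2
          (mem_iUnion₂.2 ⟨i, Finset.mem_range.2 (Nat.lt_succ_self i), hi⟩)
      rwa [h2, measure_empty] at h1
    · obtain ⟨i, hi, hiω⟩ := mem_iUnion₂.1 hc
      exact mem_iUnion₂.2 ⟨i, Finset.mem_range.2 ((Finset.mem_range.1 hi).trans_le hl), hiω⟩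
  let b : ℕ → ℕ → ℕ → ℝ≥0∞ := fun l L k => ∑ i ∈ Finset.range l,
    (ENNReal.ofReal (((L : ℝ) + 1) ^ n) *
      P.prod volume ((skewProduct σ f)^[i * N] ⁻¹' E k) +
      ENNReal.ofReal (n * Z / ((L : ℝ) + 1))) + P (T l)
  have hb : ∀ l L k j, l ≤ j →
      P.prod volume {p | p.1 ∈ S ∧ (skewProduct σ f)^[j * N] p ∈ E k} ≤ b l L k := by
    intro l L k j hj
    have hsub : {p : Ω × Cube n | p.1 ∈ S ∧ (skewProduct σ f)^[j * N] p ∈ E k} ⊆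
        (⋃ i ∈ Finset.range l, {p : Ω × Cube n | σ^[(j - i) * N] p.1 ∈ S ∧
          (skewProduct σ f)^[(j - i) * N] p ∈ (skewProduct σ f)^[i * N] ⁻¹' E k}) ∪
        {p : Ω × Cube n | σ^[j * N] p.1 ∈ T l} := by
      rintro p ⟨hp, hpE⟩
      by_cases hi : ∃ i < l, σ^[j * N] p.1 ∈ W i
      · obtain ⟨i, hil, hi⟩ := hi
        have hadd : i * N + (j - i) * N = j * N := by
          rw [← add_mul, Nat.add_sub_cancel' (hil.le.trans hj)]
        refine Or.inl (mem_iUnion₂.2 ⟨i, Finset.mem_range.2 hil, ?_, ?_⟩)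
        · have hi' : σ.symm^[i * N] (σ^[j * N] p.1) ∈ S := hi
          rwa [← hadd, Function.iterate_add_apply, hcan] at hi'
        · change (skewProduct σ f)^[i * N] ((skewProduct σ f)^[(j - i) * N] p) ∈ E k
          rwa [← Function.iterate_add_apply, hadd]
      · refine Or.inr ⟨mem_iUnion.2 ⟨j, ?_⟩, fun hc => ?_⟩
        · change σ.symm^[j * N] (σ^[j * N] p.1) ∈ S
          rwa [hcan]
        · obtain ⟨i, hil, hi'⟩ := mem_iUnion₂.1 hc
          exact hi ⟨i, Finset.mem_range.1 hil, hi'⟩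
    refine (measure_mono hsub).trans ((measure_union_le _ _).trans (add_le_add ?_ ?_))
    · refine (measure_biUnion_finset_le _ _).trans (Finset.sum_le_sum fun i _ => ?_)
      exact ht (j - i) _ ((hqm _).measurable (hE k)) ((L : ℝ) + 1) (by positivity)
    · have e : {p : Ω × Cube n | σ^[j * N] p.1 ∈ T l} = (σ^[j * N] ⁻¹' T l) ×ˢ univ := by
        ext p
        simp
      rw [e, Measure.prod_prod, measure_univ, mul_one, (hmp _).measure_preimage
        (hT l).nullMeasurableSet]
  -- The order of choices matters: `l` makes the remainder small, then `L` makes the `l` Chebyshev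
  -- terms small, and only then `k` makes the preimages of `E k` small for these fixed `l` and `L`.
  obtain ⟨l, hl⟩ := (hTlim.eventually_lt_const hε).exists
  have hlimL : Tendsto (fun L : ℕ => ∑ i ∈ Finset.range l,
      (ENNReal.ofReal (((L : ℝ) + 1) ^ n) * 0 + ENNReal.ofReal (n * Z / ((L : ℝ) + 1))) + P (T l))
      atTop (𝓝 (∑ i ∈ Finset.range l, (0 + ENNReal.ofReal 0) + P (T l))) := by
    simp only [mul_zero]
    refine (tendsto_finsetSum _ fun i _ => tendsto_const_nhds.add
      (ENNReal.tendsto_ofReal ?_)).add tendsto_const_nhds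
    have := tendsto_one_div_add_atTop_nhds_zero_nat (𝕜 := ℝ).const_mul ((n : ℝ) * Z)
    simpa [div_eq_mul_inv] using this
  simp only [ENNReal.ofReal_zero, add_zero, Finset.sum_const_zero, zero_add] at hlimL
  obtain ⟨L, hL⟩ := (hlimL.eventually_lt_const hl).exists
  have hlimk : Tendsto (fun k => b l L k) atTop (𝓝 (∑ i ∈ Finset.range l,
      (ENNReal.ofReal (((L : ℝ) + 1) ^ n) * 0 + ENNReal.ofReal (n * Z / ((L : ℝ) + 1))) +
        P (T l))) := by
    refine (tendsto_finsetSum _ fun i _ => (ENNReal.Tendsto.const_mul ?_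
      (Or.inr ENNReal.ofReal_ne_top)).add tendsto_const_nhds).add tendsto_const_nhds
    have h1 := tendsto_measure_iInter_atTop (μ := P.prod volume)
      (s := fun k => (skewProduct σ f)^[i * N] ⁻¹' E k)
      (fun k => ((hqm _).measurable (hE k)).nullMeasurableSet)
      (fun k k' hk => preimage_mono (hanti hk)) ⟨0, measure_ne_top _ _⟩
    rwa [← preimage_iInter, (hqm (i * N)).preimage_null h0] at h1
  obtain ⟨k, hk⟩ := (hlimk.eventually_lt_const (by simpa using hL)).exists
  exact ⟨k, l, fun j hj => (hb l L k j hj).trans hk.le⟩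

/-- There is an invariant probability measure that is absolutely continuous. -/
lemma Expanding.exists_acip [IsProbabilityMeasure P] (h : Expanding P σ f Q) :
    ∃ ν : Measure (Ω × Cube n), IsProbabilityMeasure ν ∧
      MeasurePreserving (skewProduct σ f) ν ν ∧ ν ≪ P.prod volume := by
  obtain ⟨N, hN, S, hS, hSpos, hsmall⟩ := h.uniform_small
  have hF := h.measurable
  set F := skewProduct σ f with hFdef
  have hFk : ∀ k, Measurable (F^[k]) := fun k => hF.iterate k
  have hS' : MeasurableSet {p : Ω × Cube n | p.1 ∈ S} := measurable_fst hS
  -- The images of `P × m`, restricted to starting points over `S`, under `j` blocks. Their total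
  -- mass is `P S`, and it survives in the limit.
  let lam : ℕ → Measure (Ω × Cube n) := fun j =>
    ((P.prod volume).restrict {p | p.1 ∈ S}).map F^[j * N]
  have hlam : ∀ j E, MeasurableSet E → lam j E = P.prod volume {p | p.1 ∈ S ∧ F^[j * N] p ∈ E} := by
    intro j E hE
    rw [Measure.map_apply (hFk _) hE, Measure.restrict_apply (hFk _ hE), inter_comm]
    rfl
  have hlam1 : ∀ j E, MeasurableSet E → lam j E ≤ 1 := fun j E hE => by
    rw [hlam j E hE]
    exact prob_le_one
  have hlamN : ∀ j E, MeasurableSet E → lam j (F^[N] ⁻¹' E) = lam (j + 1) E := by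
    intro j E hE
    rw [hlam _ _ (hFk _ hE), hlam _ _ hE, add_mul, one_mul, add_comm (j * N) N,
      Function.iterate_add]
    rfl
  let a : ℕ → Measure (Ω × Cube n) := fun J =>
    ((J : ℝ≥0∞) + 1)⁻¹ • ∑ j ∈ Finset.range (J + 1), lam j
  have ha : ∀ J E, a J E = ((J : ℝ≥0∞) + 1)⁻¹ * ∑ j ∈ Finset.range (J + 1), lam j E := by
    intro J E
    simp only [a, Measure.smul_apply, Measure.finsetSum_apply, smul_eq_mul]
  obtain ⟨ν, hνac, hν⟩ := exists_limit_measure (m := P.prod volume) (a := a)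
    (Filter.hyperfilter ℕ) Nat.hyperfilter_le_atTop (by
      intro E hE hanti h0 ε hε
      obtain ⟨δ, hδ0, hδ⟩ := exists_between hε
      obtain ⟨k, l, hkl⟩ := hsmall E hE hanti h0 δ hδ0
      refine ⟨k, ?_⟩
      simp only [ha]
      refine eventually_average_le (l := l) (δ := δ) (fun j => hlam1 j _ (hE k)) (fun j hj => ?_) hδ
      rw [hlam j _ (hE k)]
      exact hkl j hj)
  have hlim0 : Tendsto (fun J : ℕ => ((J : ℝ≥0∞) + 1)⁻¹) (Filter.hyperfilter ℕ : Filter ℕ)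
      (𝓝 0) := by
    have := (tendsto_add_atTop_iff_nat 1).2 ENNReal.tendsto_inv_nat_nhds_zero
    exact Tendsto.mono_left (by simpa using this) Nat.hyperfilter_le_atTop
  have hνuniv : ν univ = P S := by
    refine tendsto_nhds_unique (hν univ MeasurableSet.univ) ?_
    have : ∀ J, a J univ = P S := by
      intro J
      have e : {p : Ω × Cube n | p.1 ∈ S} = S ×ˢ univ := by
        ext p
        simp
      have e1 : ∀ j, lam j univ = P S := fun j => by
        rw [hlam j _ MeasurableSet.univ]
        simp only [mem_univ, and_true]
        rw [e, Measure.prod_prod, measure_univ, mul_one]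
      rw [ha, Finset.sum_congr rfl fun j _ => e1 j, Finset.sum_const, Finset.card_range,
        nsmul_eq_mul]
      push_cast
      rw [← mul_assoc, ENNReal.inv_mul_cancel (by simp) (by simp), one_mul]
    simp only [this]
    exact tendsto_const_nhds
  -- Shifting a Cesàro average by one block changes it by at most two boundary terms of size `1 / (J
  -- + 1)`.
  have hνinv : ν.map F^[N] = ν := by
    ext E hE
    rw [Measure.map_apply (hFk N) hE]
    have e : ∀ J, a J (F^[N] ⁻¹' E) =
        ((J : ℝ≥0∞) + 1)⁻¹ * ∑ j ∈ Finset.range (J + 1), lam (j + 1) E := fun J => by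
      rw [ha, Finset.sum_congr rfl fun j _ => hlamN j E hE]
    have e2 : ∀ J : ℕ, ∑ j ∈ Finset.range (J + 1), lam (j + 1) E + lam 0 E =
        ∑ j ∈ Finset.range (J + 1), lam j E + lam (J + 1) E := fun J => by
      rw [← Finset.sum_range_succ' (fun j => lam j E), Finset.sum_range_succ]
    have l1 := hν _ (hFk N hE)
    have l2 := hν _ hE
    apply le_antisymm
    · have := l2.add hlim0
      rw [add_zero] at this
      refine le_of_tendsto_of_tendsto' l1 this fun J => ?_
      rw [e, ha, ← mul_add_one]
      gcongr
      exact (le_self_add.trans (e2 J).le).trans (by gcongr; exact hlam1 _ _ hE)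
    · have := l1.add hlim0
      rw [add_zero] at this
      refine le_of_tendsto_of_tendsto' l2 this fun J => ?_
      rw [e, ha, ← mul_add_one]
      gcongr
      exact (le_self_add.trans (e2 J).ge).trans (by gcongr; exact hlam1 _ _ hE)
  -- The limit is invariant under the `N`-th iterate only; adding its first `N` images gives
  -- invariance under `F`.
  let κ : Measure (Ω × Cube n) := ∑ k ∈ Finset.range N, ν.map F^[k]
  have hκinv : κ.map F = κ := by
    obtain ⟨N', rfl⟩ : ∃ N', N = N' + 1 := ⟨N - 1, by omega⟩
    have hstep : ∀ k, (ν.map F^[k]).map F = ν.map F^[k + 1] := fun k => by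
      rw [Measure.map_map hF (hFk k), ← Function.iterate_succ']
    ext E hE
    rw [Measure.map_apply hF hE]
    simp only [κ, Measure.finsetSum_apply]
    have e1 : ∀ k, (ν.map F^[k]) (F ⁻¹' E) = (ν.map F^[k + 1]) E := fun k => by
      rw [← hstep k, Measure.map_apply hF hE]
    rw [Finset.sum_congr rfl fun k _ => e1 k, Finset.sum_range_succ, hνinv,
      Finset.sum_range_succ' (fun k => (ν.map F^[k]) E), Function.iterate_zero, Measure.map_id]
  have hκac : κ ≪ P.prod volume := by
    refine Measure.AbsolutelyContinuous.mk fun E hE h0 => ?_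
    simp only [κ, Measure.finsetSum_apply]
    refine Finset.sum_eq_zero fun k _ => ?_
    rw [Measure.map_apply (hFk k) hE]
    exact hνac ((h.quasiMeasurePreserving.iterate k).preimage_null h0)
  have hκuniv : κ univ = N * P S := by
    simp only [κ, Measure.finsetSum_apply]
    have e1 : ∀ k, (ν.map F^[k]) univ = P S := fun k => by
      rw [Measure.map_apply (hFk k) MeasurableSet.univ, preimage_univ, hνuniv]
    rw [Finset.sum_congr rfl fun k _ => e1 k, Finset.sum_const, Finset.card_range, nsmul_eq_mul]
  have hκ0 : κ univ ≠ 0 := by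
    rw [hκuniv]
    exact mul_ne_zero (by exact_mod_cast (by omega : N ≠ 0)) hSpos.ne'
  have hκt : κ univ ≠ ∞ := by
    rw [hκuniv]
    exact ENNReal.mul_ne_top (ENNReal.natCast_ne_top N) (measure_ne_top _ _)
  refine ⟨(κ univ)⁻¹ • κ, ⟨?_⟩, ⟨hF, ?_⟩, hκac.smul_left _⟩
  · rw [Measure.smul_apply, smul_eq_mul, ENNReal.inv_mul_cancel hκ0 hκt]
  · rw [Measure.map_smul, hκinv]

end

/-! ### The number of ergodic absolutely continuous invariant measures -/

section

variable {Ω : Type*} {n : ℕ}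

/-- The image of each rectangle `B` contains a rectangle of volume at least `γ` times that of `B`,
and no rectangle in the cube exceeds volume `1`. Summing over the partition, whose volumes add up to
`1`, gives the bound. -/
lemma JablonskiMap.totalExpansion_le_card {f : JablonskiMap n} (hf : f.IsC2Monotone)
    (hγ : ∀ i, 0 < f.expansion i) (hm : Measurable f.toFun) :
    f.totalExpansion ≤ f.part.parts.card := by
  calc f.totalExpansion = ∑ B ∈ f.part.parts, f.totalExpansion * B.vol := by
        rw [← Finset.mul_sum]
        simp only [Rect.vol]
        rw [f.part.sum_volume, mul_one]
    _ ≤ ∑ B ∈ f.part.parts, 1 := by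
        refine Finset.sum_le_sum fun B hB => ?_
        obtain ⟨R', h, -⟩ := exists_image hf hγ hm ⟨B, hB, subset_rfl⟩
        exact h.trans R'.vol_le_one
    _ = _ := by simp

lemma RectPartition.one_le_maxHyperplaneCount (Pt : RectPartition n) (hn : 1 ≤ n) :
    1 ≤ Pt.maxHyperplaneCount := by
  obtain ⟨B, hB⟩ := Pt.parts_nonempty
  let d : Fin n := ⟨0, hn⟩
  refine le_trans ?_ (Pt.hyperplaneCount_le d ((B.lo d + B.hi d) / 2))
  have hfin : {C : Rect n | C ∈ Pt.parts ∧ ({x : Fin n → ℝ | x d = (B.lo d + B.hi d) / 2} ∩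
      C.openBox).Nonempty}.Finite := Pt.parts.finite_toSet.subset fun C hC => hC.1
  refine (Set.ncard_pos hfin).2 ⟨B, hB, fun i => (B.lo i + B.hi i) / 2, rfl,
    fun i => ?_⟩
  have := B.lo_lt_hi i
  constructor <;> linarith

lemma JablonskiMap.log_totalExpansion {f : JablonskiMap n} (hγ : ∀ i, 0 < f.expansion i) :
    Real.log f.totalExpansion = ∑ i, Real.log (f.expansion i) :=
  Real.log_prod fun i _ => (hγ i).ne'

variable [MeasurableSpace Ω] {P : Measure Ω} {σ : Ω ≃ᵐ Ω} {f : Ω → JablonskiMap n}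
  {Q : RectPartition n}

lemma Expanding.ae_log_le (h : Expanding P σ f Q) {q : ℝ}
    (hq : ∀ᵐ ω ∂P, (numRects f ω : ℝ) ≤ q) :
    ∀ᵐ ω ∂P, Real.log (f ω).totalExpansion ≤ Real.log q := by
  filter_upwards [hq, h.pos] with ω h1 h2
  exact Real.log_le_log (Finset.prod_pos fun i _ => h2 i)
    (((JablonskiMap.totalExpansion_le_card (h.smooth ω) h2
      (measurable_toFun h.measurable ω))).trans h1)

/-- The function lies between `n` times the integrable minimum of the `log γ_i` and the constant
`log q`. -/
lemma Expanding.integrable_log [IsFiniteMeasure P] (h : Expanding P σ f Q)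
    (hm : ∀ i, AEMeasurable (fun ω => (f ω).expansion i) P) {q : ℝ}
    (hq : ∀ᵐ ω ∂P, (numRects f ω : ℝ) ≤ q) :
    Integrable (fun ω => Real.log (f ω).totalExpansion) P := by
  have hmeas : AEMeasurable (fun ω => Real.log (f ω).totalExpansion) P :=
    Real.measurable_log.comp_aemeasurable (Finset.aemeasurable_fun_prod _ fun i _ => hm i)
  refine integrable_of_le_of_le hmeas.aestronglyMeasurable ?_ (h.ae_log_le hq)
    (h.integrable.const_mul (n : ℝ)) (integrable_const _)
  filter_upwards [h.pos] with ω hω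
  rw [JablonskiMap.log_totalExpansion hω]
  calc (n : ℝ) * ⨅ i, Real.log ((f ω).expansion i)
      = ∑ _j : Fin n, ⨅ i, Real.log ((f ω).expansion i) := by simp
    _ ≤ _ := Finset.sum_le_sum fun j _ => ciInf_le (finite_range _).bddBelow j

/-- Whether an orbit eventually stays in `S` does not depend on its first point. This replaces a set
by one that is exactly invariant, although `F` need not be invertible. -/
lemma preimage_eventually_mem {α : Type*} (F : α → α) (S : Set α) :
    F ⁻¹' {p | ∀ᶠ k in atTop, F^[k] p ∈ S} = {p | ∀ᶠ k in atTop, F^[k] p ∈ S} := by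
  ext p
  simp only [mem_preimage, mem_ofPred_eq]
  conv_rhs => rw [← Filter.map_add_atTop_eq_nat 1, eventually_map]
  rfl

/-- Pairwise mutually singular invariant measures live on pairwise disjoint invariant sets. -/
lemma exists_invariant_sets {α ι : Type*} [Countable ι] [MeasurableSpace α] {F : α → α}
    {μ : ι → Measure α} (hF : ∀ i, MeasurePreserving F (μ i) (μ i))
    (hμ : ∀ i j, i ≠ j → (μ i).MutuallySingular (μ j)) (hFm : Measurable F) :
    ∃ A : ι → Set α, (∀ i, MeasurableSet (A i)) ∧ (∀ i, F ⁻¹' A i = A i) ∧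
      (Pairwise fun i j => Disjoint (A i) (A j)) ∧ ∀ i, ∀ᵐ p ∂μ i, p ∈ A i := by
  have h : ∀ i j, ∃ s : Set α, MeasurableSet s ∧ (i ≠ j → μ i s = 0 ∧ μ j sᶜ = 0) := by
    intro i j
    by_cases hij : i = j
    · exact ⟨∅, MeasurableSet.empty, fun hc => absurd hij hc⟩
    · obtain ⟨s, hs, h1, h2⟩ := hμ i j hij
      exact ⟨s, hs, fun _ => ⟨h1, h2⟩⟩
  choose s hs h0 using h
  -- Two of these carriers are disjoint, since `S i` avoids `s i j` while `S j` lies in it; so no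
  -- orbit can eventually stay in both.
  let S : ι → Set α := fun i => ⋂ j, ⋂ (_ : i ≠ j), (s i j)ᶜ ∩ s j i
  have hS : ∀ i, MeasurableSet (S i) := fun i =>
    MeasurableSet.iInter fun j => MeasurableSet.iInter fun _ => (hs i j).compl.inter (hs j i)
  refine ⟨fun i => {p | ∀ᶠ k in atTop, F^[k] p ∈ S i}, fun i => ?_,
    fun i => preimage_eventually_mem F (S i), fun i j hij => ?_, fun i => ?_⟩
  · have e : {p | ∀ᶠ k in atTop, F^[k] p ∈ S i} = ⋃ K : ℕ, ⋂ k : ℕ, ⋂ (_ : K ≤ k),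
        F^[k] ⁻¹' S i := by
      ext p
      simp [eventually_atTop]
    change MeasurableSet {p | ∀ᶠ k in atTop, F^[k] p ∈ S i}
    rw [e]
    exact MeasurableSet.iUnion fun K => MeasurableSet.iInter fun k => MeasurableSet.iInter fun _ =>
      hFm.iterate k (hS i)
  · refine Set.disjoint_left.2 fun p hi hj => ?_
    obtain ⟨k, hki, hkj⟩ := (Eventually.and hi hj).exists
    exact ((mem_iInter₂.1 hki j hij).1) ((mem_iInter₂.1 hkj i hij.symm).2)
  · have hmem : ∀ᵐ p ∂μ i, p ∈ S i := by
      simp only [S, mem_iInter, mem_inter_iff]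
      refine ae_all_iff.2 fun j => ?_
      by_cases hij : i = j
      · exact Eventually.of_forall fun p hc => absurd hij hc
      · have h1 : ∀ᵐ p ∂μ i, p ∈ (s i j)ᶜ := by
          rw [ae_iff]
          simpa using (h0 i j hij).1
        have h2 : ∀ᵐ p ∂μ i, p ∈ s j i := (h0 j i (Ne.symm hij)).2
        filter_upwards [h1, h2] with p hp1 hp2 _
        exact ⟨hp1, hp2⟩
    filter_upwards [ae_iterate (hF i) hmem] with p hp
    exact Eventually.of_forall hp

/-- If all invariant sets are null or conull, there is exactly one ergodic absolutely continuous
invariant measure. -/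
lemma Expanding.existsUnique_ergodicACIP [IsProbabilityMeasure P] (h : Expanding P σ f Q)
    (hdich : ∀ A, MeasurableSet A → skewProduct σ f ⁻¹' A = A →
      P.prod volume A = 0 ∨ P.prod volume Aᶜ = 0) :
    ∃! μ : Measure (Ω × Cube n), IsErgodicACIP P σ f μ := by
  have herg : ∀ ν : Measure (Ω × Cube n), MeasurePreserving (skewProduct σ f) ν ν →
      ν ≪ P.prod volume → Ergodic (skewProduct σ f) ν := by
    refine fun ν hν hac => ⟨hν, ⟨fun A hA hinv => ?_⟩⟩
    rw [eventuallyConst_set']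
    rcases hdich A hA hinv with h0 | h0
    · exact Or.inl (ae_eq_empty.2 (hac h0))
    · exact Or.inr (ae_eq_univ.2 (hac h0))
  obtain ⟨ν, hν1, hν, hac⟩ := h.exists_acip
  refine ⟨ν, ⟨hν1, herg ν hν hac, hac⟩, fun μ hμ => ?_⟩
  obtain ⟨hμ1, hμ, hμac⟩ := hμ
  -- The average is again an ACIP, hence ergodic. An invariant probability measure that is
  -- absolutely continuous with respect to an ergodic one equals it, so both measures equal their
  -- average.
  set κ : Measure (Ω × Cube n) := (2 : ℝ≥0∞)⁻¹ • (μ + ν) with hκ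
  have hκ1 : IsProbabilityMeasure κ := ⟨by
    rw [hκ, Measure.smul_apply, Measure.add_apply, measure_univ, measure_univ, smul_eq_mul,
      one_add_one_eq_two, ENNReal.inv_mul_cancel (by simp) (by simp)]⟩
  have hκmp : MeasurePreserving (skewProduct σ f) κ κ := by
    refine ⟨h.measurable, ?_⟩
    rw [hκ, Measure.map_smul, Measure.map_add _ _ h.measurable, hμ.map_eq, hν.map_eq]
  have hle : μ + ν ≪ P.prod volume := by
    refine Measure.AbsolutelyContinuous.mk fun E _ h0 => ?_
    rw [Measure.add_apply, hμac h0, hac h0, add_zero]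
  have hκe := herg κ hκmp (hle.smul_left _)
  have hback : μ + ν ≪ κ := Measure.absolutelyContinuous_smul (by simp)
  have e1 : μ = κ := hκe.eq_of_absolutelyContinuous hμ.toMeasurePreserving
    ((Measure.AbsolutelyContinuous.rfl.add_right ν).trans hback)
  have e2 : ν = κ := hκe.eq_of_absolutelyContinuous hν
    ((Measure.absolutelyContinuous_of_le (Measure.le_add_left le_rfl)).trans hback)
  rw [e1, ← e2]

end

end

end Jablonski

/-! ### Proof of the lemma -/

theorem lemma5p5 {Ω : Type*} [TopologicalSpace Ω] [PolishSpace Ω] [MeasurableSpace Ω]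
    [BorelSpace Ω] (P : MeasureTheory.Measure Ω) [MeasureTheory.IsProbabilityMeasure P]
    (σ : Ω ≃ᵐ Ω) (hσ : Ergodic σ P)
    (n : ℕ) (hn : 1 ≤ n) (f : Ω → Jablonski.JablonskiMap n)
    (hf : Jablonski.Admissible P σ f) (hlog : Jablonski.LogIntegrable P f)
    (M c q : ℝ)
    (hM : ∀ᵐ ω ∂P, (Jablonski.complexity σ f ω : ℝ) ≤ M)
    (hc : ∀ᵐ ω ∂P, (Jablonski.numCrossing σ f ω : ℝ) ≤ c)
    (hq : ∀ᵐ ω ∂P, (Jablonski.numRects f ω : ℝ) ≤ q) :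
    (Real.log M < ∫ ω, Real.log (f ω).totalExpansion ∂P →
      ∀ (r : ℕ) (μ : Fin r → MeasureTheory.Measure (Ω × Jablonski.Cube n)),
        (∀ i, Jablonski.IsErgodicACIP P σ f (μ i)) →
        (∀ i j, i ≠ j → (μ i).MutuallySingular (μ j)) →
        (r : ℝ) ≤ c * (Real.log q - Real.log M) /
          ((∫ ω, Real.log (f ω).totalExpansion ∂P) - Real.log M)) ∧
    (MeasureTheory.Integrable (fun ω => Real.log (f ω).totalExpansion) P ∧
      ∫ ω, Real.log (f ω).totalExpansion ∂P ≤ Real.log q) ∧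
    (Real.log M < ∫ ω, Real.log (f ω).totalExpansion ∂P →
      c * (Real.log q - Real.log M) /
          ((∫ ω, Real.log (f ω).totalExpansion ∂P) - Real.log M) < 2 →
      ∃! μ : MeasureTheory.Measure (Ω × Jablonski.Cube n), Jablonski.IsErgodicACIP P σ f μ) := by
  obtain ⟨Q, -, hQ⟩ := hf.common_grid
  obtain ⟨g, hg, hgi⟩ := hf.expanding_on_average
  have h : Jablonski.Expanding P σ f Q := ⟨hn, hσ, hQ, hf.smooth, hf.measurable_skewProduct,
    hf.nonsingular, hf.expansion_pos, hf.integrable_min_log, hg.trans hgi, hf.bounded_generator,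
    hlog⟩
  have hint := h.integrable_log hf.aemeasurable_expansion hq
  have hle : ∫ ω, Real.log (f ω).totalExpansion ∂P ≤ Real.log q := by
    have := MeasureTheory.integral_mono_ae hint (MeasureTheory.integrable_const _) (h.ae_log_le hq)
    simpa using this
  -- At least one rectangle meets some hyperplane, at any `ω` where the bound holds. In particular
  -- `log M` and `log q` are genuine logarithms of positive numbers.
  have hM1 : 1 ≤ M := by
    obtain ⟨ω, hω⟩ := hM.exists
    refine le_trans ?_ hω
    exact_mod_cast (f (σ ω)).part.one_le_maxHyperplaneCount hn
  have hq1 : 0 < q := by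
    obtain ⟨ω, hω⟩ := hq.exists
    refine lt_of_lt_of_le ?_ hω
    exact_mod_cast (f ω).part.parts_nonempty.card_pos
  -- Together with `∫ log γ ≤ log q`, the assumption forces `M ≤ q`, so that the penalty `log q -
  -- log M` per crossing point is nonnegative.
  have hMq : Real.log M < ∫ ω, Real.log (f ω).totalExpansion ∂P → M ≤ q := fun hlt =>
    ((Real.log_lt_log_iff (by linarith) hq1).1 (hlt.trans_le hle)).le
  refine ⟨fun hlt r μ hμ hsing => ?_, ⟨hint, hle⟩, fun hlt hlt2 => ?_⟩
  · rw [le_div_iff₀ (sub_pos.2 hlt)]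
    obtain ⟨A, hA, hinv, hd, hmem⟩ := Jablonski.exists_invariant_sets
      (fun i => (hμ i).2.1.toMeasurePreserving) hsing h.measurable
    refine h.card_mul_le hf.grid hint hM1 (hMq hlt) hM hc hq hA hinv hd fun i h0 => ?_
    have hprob := (hμ i).1
    obtain ⟨p, hp, hp'⟩ := ((hmem i).and
      (MeasureTheory.measure_eq_zero_iff_ae_notMem.1 ((hμ i).2.2 h0))).exists
    exact hp' hp
  · refine h.existsUnique_ergodicACIP fun A hA hinv => ?_
    by_contra! hcon
    rw [div_lt_iff₀ (sub_pos.2 hlt)] at hlt2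
    -- The count concerns disjoint invariant sets and not measures, so it can be applied directly to
    -- an invariant set and its complement.
    refine absurd (h.card_mul_le (r := 2) (A := ![A, Aᶜ]) hf.grid hint hM1 (hMq hlt) hM hc hq
      ?_ ?_ ?_ ?_) (by push_cast; exact hlt2.not_ge)
    · exact fun i => by fin_cases i <;> simp [hA]
    · exact fun i => by fin_cases i <;> simp [hinv]
    · intro i j hij
      fin_cases i <;> fin_cases j <;> simp_all [disjoint_compl_right, disjoint_compl_left]
    · intro i
      fin_cases i
      · exact hcon.1
      · exact hcon.2
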